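/- **Setting.** For a circle $S\subset\mathbb R^2$ with centre $(p_1,p_2)$ and radius $r>0$, its vertical poles are $(p_1\pm r,p_2)$ and its horizontal poles are $(p_1,p_2\pm r)$. *Admissible data* $(D,\{S_j\}_{j=1}^{l_1},\mu)$, with $l_1,l_2\ge 1$, consist of circles $S_j\subset\mathbb R^2$, each the zero set of $f_j=\pm\big((x_1-p_{j,1})^2+(x_2-p_{j,2})^2-r_j^2\big)$ with a chosen sign, a non-empty connected open set $D\subset\mathbb R^2$ with compact connected closure $\overline D$, and a surjection $\mu:\{1,\dots,l_1\}\to\{1,\dots,l_2\}$ such that: (i) $D=U\cap\bigcap_j\{f_j>0\}$ for every sufficiently small open neighbourhood $U$ of $\overline D$; (ii) for every non-empty set $J$ of indices and every $p\in\overline D\cap\bigcap_{j\in J}S_j$, $\dim\bigcap_{j\in J}T_pS_j=2-|J|$; (iii) $\mu$ is injective on every non-empty $J$ with $\overline D\cap\bigcap_{j\in J}S_j\neq\emptyset$. For $\nu:\{1,\dots,l_2\}\to\{1,2,\dots\}$ the *moment-like map* of $(D,\{S_j\},\mu,\nu)$ is the restriction $f:M\to\mathbb R^2$ of $(x,y)\mapsto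 x$ to $$M=\Big\{(x,y_1,\dots,y_{l_2})\in U\times\prod_{i=1}^{l_2}\mathbb R^{\nu(i)+1}\ \Big|\ \prod_{j\in\mu^{-1}(i)}f_j(x)=\|y_i\|^2\ (1\le i\le l_2)\Big\},$$ where $U$ is any sufficiently small open neighbourhood of $\overline D$ ($M$ does not depend on it, and lies over $\overline D$). Put $f_0=\pi_{2,1}\circ f:M\to\mathbb R$, the first coordinate of $f$. The Reeb space of $f_0$ is the quotient of $M$ that collapses each connected component of each level set of $f_0$ to a point; its vertices are the points whose preimage contains a singular point of $f_0$, and its edges are the connected components of the complement of the vertex set. It is called the Reeb graph if this makes it a finite graph (without loops, multiple edges allowed). A smooth function is Morse–Bott if around each singular point it is the composition of a submersion with a Morse function. Isomorphic graphs are those related by a homeomorphism that maps vertices onto vertices and edges onto edges. **Theorem.** Let $(D_1,\{S_{1,j}\}_{j=1}^{l_{1,1}},\mu_1)$ be admissible data with $l_{1,2}$ classes such that $\overline{D_1}\setminus D_1\subset\bigcup_j S_{1,j}$, $(\overline{D_1}\setminus D_1)\cap S_{1,j}\ne\emptyset$ for each $j$, and no $S_{1,j}$ contains a vertical or horizontal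 pole of another circle $S_{1,k}$, $k\neq j$. Let $\nu_1:\{1,\dots,l_{1,2}\}\to\{1,2,\dots\}$, and let $f_1:M_1\to\mathbb R^2$ be the moment-like map and $W$ the Reeb space of $\pi_{2,1}\circ f_1$. Then $W$ is a Reeb graph. Moreover, for each edge $e$ of $W$ and each $\nu:\{1,\dots,l_{1,2}+1\}\to\{1,2,\dots\}$ that extends $\nu_1$, there are admissible data $(D,\{S_j\}_{j=1}^{l_{1,1}+1},\mu)$ with $l_{1,2}+1$ classes whose moment-like map $f:M\to\mathbb R^2$ for $\nu$ has the following properties. 1. $M$ is a closed connected non-singular real algebraic manifold of dimension $2+\sum_{i=1}^{l_{1,2}+1}\nu(i)$: it is a union of connected components of the common zero set of the defining polynomials, whose differentials are independent along $M$. If $M_1$ is the whole common zero set of its defining polynomials (that is, $U=\mathbb R^2$ may be taken for $M_1$), then $M$ is the whole common zero set of its own. 2. $D$ is a proper subset of $D_1$; $S_j=S_{1,j}$, with the same $f_j$ and $\mu(j)=\mu_1(j)$, for $j\le l_{1,1}$; $\mu(l_{1,1}+1)=l_{1,2}+1$; $(\overline D\setminus D)\cap S_j\neq\emptyset$ for $j\le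 l_{1,1}$; and the new circle $S_{l_{1,1}+1}$ meets exactly one of the circles $S_{1,j}$, in exactly two points. 3. $\pi_{2,1}\circ f$ is a Morse–Bott function. 4. The Reeb space of $\pi_{2,1}\circ f$ is a Reeb graph. It is isomorphic to the graph obtained from $W$ by adding two distinct new vertices $v_1,v_2$ in the interior of $e$ and a new edge that joins one of $v_1,v_2$ to a further new vertex. So it has three more vertices and three more edges than $W$. -/

import Mathlib

open scoped ContDiff

noncomputable section

/-! ### Regular zero loci, singular points and Morse-Bott functions -/

section RegularLoci

variable {E G : Type*} [NormedAddCommGroup E] [NormedSpace ℝ E]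
  [NormedAddCommGroup G] [NormedSpace ℝ G]

/-- `M` is a union of connected components of the zero set of `F`, and the differential of `F` is
surjective along `M`, so that `M` is a smooth submanifold of `E` without boundary, cut out by `F`.
For a polynomial map `F` this says that `M` is a non-singular real algebraic manifold. -/
structure IsNonsingularLocus (F : E → G) (M : Set E) : Prop where
  subset_zeros : M ⊆ F ⁻¹' {0}
  union_components : ∀ p ∈ M, connectedComponentIn (F ⁻¹' {0}) p ⊆ M
  surjective_fderiv : ∀ p ∈ M, Function.Surjective (fderiv ℝ F p)

/-- The tangent space at `p` of the manifold cut out by `F`. -/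
def locusTangent (F : E → G) (p : E) : Submodule ℝ E :=
  LinearMap.ker (fderiv ℝ F p : E →ₗ[ℝ] G)

/-- The singular points of the restriction to `M` of the real-valued function `g`: the points where
the differential of `g` vanishes on the tangent space of `M`. -/
def singularPoints (F : E → G) (M : Set E) (g : E → ℝ) : Set E :=
  {p | p ∈ M ∧ ∀ v ∈ locusTangent F p, fderiv ℝ g p v = 0}

/-- `h` is a Morse function on the open set `V`. -/
structure IsMorseOn (h : E → ℝ) (V : Set E) : Prop where
  isOpen : IsOpen V
  smooth : ContDiffOn ℝ ∞ h V
  nondegenerate : ∀ y ∈ V, fderiv ℝ h y = 0 →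
    ∀ v : E, (∀ w : E, fderiv ℝ (fderiv ℝ h) y v w = 0) → v = 0

/-- The restriction to `M` of `g` is a Morse-Bott function: it is smooth and, around each of its
singular points, it is the composition `h ∘ s` of a submersion `s` of `M` into some `ℝᵏ` with a
Morse function `h`. -/
structure IsMorseBottOn (F : E → G) (M : Set E) (g : E → ℝ) : Prop where
  smooth : ∀ p ∈ M, ContDiffAt ℝ ∞ g p
  local_form : ∀ p ∈ singularPoints F M g,
    ∃ (k : ℕ) (N : Set E) (s : E → EuclideanSpace ℝ (Fin k))
      (V : Set (EuclideanSpace ℝ (Fin k))) (h : EuclideanSpace ℝ (Fin k) → ℝ),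
      IsOpen N ∧ p ∈ N ∧ ContDiffOn ℝ ∞ s N ∧
      (∀ z ∈ M ∩ N, ∀ u, ∃ v ∈ locusTangent F z, fderiv ℝ s z v = u) ∧
      (∀ z ∈ M ∩ N, s z ∈ V) ∧ IsMorseOn h V ∧ ∀ z ∈ M ∩ N, g z = h (s z)

end RegularLoci

/-! ### Graphs and Reeb spaces -/

section Graphs

variable {W : Type*} [TopologicalSpace W]

/-- The (open) edges of the graph with underlying space `W` and vertex set `V`: the connected
components of the complement of `V`. -/
def graphEdges (V : Set W) : Set (Set W) :=
  {e | ∃ w ∈ Vᶜ, e = connectedComponentIn Vᶜ w}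

/-- The space `W` with vertex set `V` is a finite graph (a finite `1`-dimensional CW complex)
without loops, possibly with multiple edges: `W` is Hausdorff, there are finitely many vertices and
edges, and each edge is the interior of an embedded closed arc with end points in `V`. -/
structure IsFiniteGraph (V : Set W) : Prop where
  t2 : T2Space W
  finite_vertices : V.Finite
  finite_edges : (graphEdges V).Finite
  edge_arc : ∀ e ∈ graphEdges V, ∃ φ : unitInterval → W, Continuous φ ∧ Function.Injective φ ∧
    φ 0 ∈ V ∧ φ 1 ∈ V ∧ φ '' Set.Ioo 0 1 = e

/-- The space obtained from `W` by attaching a copy of `[0, 1]`, the end point `0` being glued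
to `v`. -/
def AttachArc (v : W) : Type _ :=
  Quot (fun a b : W ⊕ unitInterval => a = Sum.inl v ∧ b = Sum.inr 0)

instance (v : W) : TopologicalSpace (AttachArc v) :=
  inferInstanceAs (TopologicalSpace (Quot _))

/-- The image in `AttachArc v` of a point of `W` or of the arc. -/
def AttachArc.mk (v : W) (a : W ⊕ unitInterval) : AttachArc v := Quot.mk _ a

/-- The vertices of the graph obtained from `(W, V)` by adding the vertices `v₁`, `v₂` and a new
edge that joins `v` to a further new vertex. -/
def attachVertices (V : Set W) (v₁ v₂ v : W) : Set (AttachArc v) :=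
  (fun w => AttachArc.mk v (Sum.inl w)) '' (V ∪ {v₁, v₂}) ∪ {AttachArc.mk v (Sum.inr 1)}

/-- Graphs `(W, V)` and `(W', V')` are isomorphic: some homeomorphism maps vertices onto vertices
(hence edges onto edges, these being the components of the complements). -/
def GraphIsomorphic {W' : Type*} [TopologicalSpace W'] (V : Set W) (V' : Set W') : Prop :=
  ∃ h : W ≃ₜ W', h '' V = V'

/-- Two points are equivalent when they lie in the same connected component of a level set. -/
def reebSetoid {X : Type*} [TopologicalSpace X] (c : X → ℝ) : Setoid X where
  r x y := y ∈ connectedComponentIn (c ⁻¹' {c x}) x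
  iseqv := by
    have key : ∀ {x y : X}, y ∈ connectedComponentIn (c ⁻¹' {c x}) x →
        connectedComponentIn (c ⁻¹' {c y}) y = connectedComponentIn (c ⁻¹' {c x}) x := by
      intro x y h
      have hy : c y = c x := by
        have := connectedComponentIn_subset _ _ h
        simpa using this
      rw [hy]
      exact (connectedComponentIn_eq h).symm
    refine ⟨fun x => mem_connectedComponentIn rfl, fun {x y} h => ?_, fun {x y z} h h2 => ?_⟩
    · rw [key h]
      exact mem_connectedComponentIn rfl
    · rwa [key h] at h2

/-- The Reeb space of `c`, with the quotient topology. -/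
abbrev ReebSpace {X : Type*} [TopologicalSpace X] (c : X → ℝ) : Type _ := Quotient (reebSetoid c)

end Graphs

/-! ### Regions bounded by circles and moment-like maps -/

/-- The Euclidean plane. -/
abbrev Plane : Type := EuclideanSpace ℝ (Fin 2)

/-- A region `D` of the plane, `l₁` circles, for each circle the side on which its polynomial is
positive (the inside if `inside j` is `true`), and a map from the circles to `l₂` classes. -/
structure CircleData (l₁ l₂ : ℕ) where
  D : Set Plane
  center : Fin l₁ → Plane
  radius : Fin l₁ → ℝ
  inside : Fin l₁ → Bool
  cls : Fin l₁ → Fin l₂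

/-- The affine space `ℝ² × ∏ i, ℝ^(m i + 1)`. -/
abbrev Ambient {l₂ : ℕ} (m : Fin l₂ → ℕ) : Type :=
  Plane × ((i : Fin l₂) → EuclideanSpace ℝ (Fin (m i + 1)))

/-- The coordinates of a point of the affine space. -/
def ambientCoords {l₂ : ℕ} {m : Fin l₂ → ℕ} (z : Ambient m) :
    Fin 2 ⊕ ((i : Fin l₂) × Fin (m i + 1)) → ℝ :=
  Sum.elim (fun k => z.1 k) (fun s => z.2 s.1 s.2)

namespace CircleData

variable {l₁ l₂ : ℕ} (A : CircleData l₁ l₂)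

/-- The circle `S_j`. -/
def circle (j : Fin l₁) : Set Plane := Metric.sphere (A.center j) (A.radius j)

/-- The vertical poles of `S_j`: its points with extreme first coordinate. -/
def verticalPoles (j : Fin l₁) : Set Plane :=
  {!₂[A.center j 0 + A.radius j, A.center j 1], !₂[A.center j 0 - A.radius j, A.center j 1]}

/-- The horizontal poles of `S_j`: its points with extreme second coordinate. -/
def horizontalPoles (j : Fin l₁) : Set Plane :=
  {!₂[A.center j 0, A.center j 1 + A.radius j], !₂[A.center j 0, A.center j 1 - A.radius j]}

/-- The polynomial `f_j` of `S_j`, either `(x₁ - p₁)² + (x₂ - p₂)² - r²` or its negative. -/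
def poly (j : Fin l₁) : MvPolynomial (Fin 2) ℝ :=
  let q : MvPolynomial (Fin 2) ℝ :=
    (∑ k, (MvPolynomial.X k - MvPolynomial.C (A.center j k)) ^ 2)
      - MvPolynomial.C (A.radius j ^ 2)
  if A.inside j then -q else q

/-- The value `f_j(x)`. -/
def f (j : Fin l₁) (x : Plane) : ℝ := MvPolynomial.eval (fun k => x k) (A.poly j)

/-- The tangent line (as a linear subspace) at a point `p` of the circle `S_j`. -/
def tangentLine (j : Fin l₁) (p : Plane) : Submodule ℝ Plane :=
  (Submodule.span ℝ {p - A.center j})ᗮ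

/-- The conditions on the data under which the moment-like map is defined. -/
structure IsAdmissible : Prop where
  pos_left : 0 < l₁
  pos_right : 0 < l₂
  radius_pos : ∀ j, 0 < A.radius j
  isOpen : IsOpen A.D
  isConnected : IsConnected A.D
  isCompact_closure : IsCompact (closure A.D)
  isConnected_closure : IsConnected (closure A.D)
  /-- For any sufficiently small open neighbourhood `U` of `closure D`, the region `D` is the set of
  points of `U` at which all the `f_j` are positive. -/
  eq_inter : ∃ U₀ : Set Plane, IsOpen U₀ ∧ closure A.D ⊆ U₀ ∧
    ∀ U : Set Plane, IsOpen U → closure A.D ⊆ U → U ⊆ U₀ → A.D = U ∩ {x | ∀ j, 0 < A.f j x}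
  /-- The circles through any point of `closure D` are transverse. -/
  transverse : ∀ J : Finset (Fin l₁), J.Nonempty → ∀ p ∈ (⋂ j ∈ J, A.circle j) ∩ closure A.D,
    Module.finrank ℝ (⨅ j ∈ J, A.tangentLine j p : Submodule ℝ Plane) + J.card = 2
  cls_surjective : Function.Surjective A.cls
  /-- Circles with a common point in `closure D` belong to different classes. -/
  cls_injOn : ∀ J : Finset (Fin l₁), J.Nonempty →
    ((⋂ j ∈ J, A.circle j) ∩ closure A.D).Nonempty → Set.InjOn A.cls J

variable (m : Fin l₂ → ℕ)

/-- The polynomial `∏_{j in class i} f_j(x) - ‖y_i‖²`. -/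
def momentPoly (i : Fin l₂) : MvPolynomial (Fin 2 ⊕ ((i : Fin l₂) × Fin (m i + 1))) ℝ :=
  (∏ j with A.cls j = i, MvPolynomial.rename Sum.inl (A.poly j))
    - ∑ k : Fin (m i + 1), MvPolynomial.X (Sum.inr ⟨i, k⟩) ^ 2

/-- The real polynomial map `(x, y) ↦ (∏_{j in class i} f_j(x) - ‖y_i‖²)_i`. -/
def momentSystem (z : Ambient m) (i : Fin l₂) : ℝ :=
  MvPolynomial.eval (ambientCoords z) (A.momentPoly m i)

/-- The common zero set of the polynomials in `U × ∏ i, ℝ^(m i + 1)`. -/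
def zerosOver (U : Set Plane) : Set (Ambient m) :=
  {z | z.1 ∈ U ∧ A.momentSystem m z = 0}

/-- The domain of the moment-like map. The moment-like map itself is the restriction to this set of
the projection `(x, y) ↦ x`. -/
def momentManifold : Set (Ambient m) := A.zerosOver m (closure A.D)

/-- The domain of the moment-like map is the part of the zero set of the polynomials that lies over
any sufficiently small open neighbourhood of `closure D`. -/
def IsLocusOverSmallNhds : Prop :=
  ∃ U₀ : Set Plane, IsOpen U₀ ∧ closure A.D ⊆ U₀ ∧
    ∀ U : Set Plane, IsOpen U → closure A.D ⊆ U → U ⊆ U₀ → A.zerosOver m U = A.momentManifold m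

/-- The first coordinate `(x, y) ↦ x₁`, whose restriction to the domain of the moment-like map is
the composition of that map with the projection `ℝ² → ℝ`. -/
def height (z : Ambient m) : ℝ := z.1 0

/-- The Reeb space of the composition of the moment-like map with the projection `ℝ² → ℝ`. -/
abbrev momentReeb : Type :=
  ReebSpace (fun z : A.momentManifold m => height m (z : Ambient m))

/-- The vertices of the Reeb graph: the points of the Reeb space which, as subsets of the manifold,
contain singular points. -/
def reebVertices : Set (A.momentReeb m) :=
  {w | ∃ z : A.momentManifold m,
    (z : Ambient m) ∈ singularPoints (A.momentSystem m) (A.momentManifold m) (height m) ∧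
      (Quotient.mk _ z : A.momentReeb m) = w}

end CircleData

end

/-! Everything is read off the planar region. The projection of the moment manifold to `closure D`
is a closed surjection whose fibres are images of products of spheres of positive dimension, hence
connected. So the Reeb space of the height is that of the first coordinate on `closure D`
(`exists_homeomorph_reebSpace`, `exists_homeomorph_momentReeb`), and its points are the maximal
vertical segments of `closure D`. A tangent space computation puts the singular points exactly over
the corners and the vertical poles (`mem_singularPoints_iff`), a finite set.

Away from that set the boundary is locally the graph of a continuous function, so around each
remaining segment the region is a strip between two graphs (`exists_strip`). Hence the level
function on the Reeb space has local sections with open image outside the vertices. Together with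
compactness and the separation of points of one level, this makes the Reeb space a finite graph
(`HasLocalSections.isFiniteGraph`).

For the surgery on an edge, choose a point `p` on the upper boundary of a strip of that edge, on one
circle only and at none of its four poles. After a reflection of the first coordinate (which does
not change the Reeb space) the boundary near `p` is an increasing graph `T`. Remove a small disc
centred at `p` and let its circle form a new class. In coordinates centred at `p`, the circle of
radius `ε` crosses the graph over `xl < 0` and over `xr > 0`. Over `[xr, ε]` the slice splits into a
piece below the disc and a piece above it, and the two pieces join at the right pole `(ε, 0)`; the
left pole is outside the region. The lower pieces continue the old edge past the new vertices at
`xl` and `ε`; the upper pieces form an arc that leaves the vertex at `ε` and ends at the corner over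
`xr`. This is `exists_arcAttachment_removeDisc`.

The new data stay admissible: the new circle is transverse to the only circle it meets, and near `p`
what is left of `D` is a connected annular sector, so that `D` stays connected
(`IsSmallDisc.isAdmissible`). The Morse-Bott property comes from solving the equations of the
circles for the first coordinate, which writes the height as a sum of squares with non-vanishing
coefficients, provided that no corner is a vertical pole (`IsAdmissible.isMorseBottOn`). The pole
hypothesis gives this for old corners, the choice of `p` and `ε` for new ones. -/

noncomputable section

/-! ### Reeb spaces of functions: separation of points and maps with connected fibres -/

section ReebGeneral

open Set Topology

variable {X : Type*} [TopologicalSpace X]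

/-- The function induced on the Reeb space. -/
def reebLevel (c : X → ℝ) : ReebSpace c → ℝ :=
  Quotient.lift c (by
    intro x y h
    have h' : y ∈ connectedComponentIn (c ⁻¹' {c x}) x := h
    have := connectedComponentIn_subset _ _ h'
    simpa using this.symm)

/-- The class of a point in the Reeb space. -/
def reebMk (c : X → ℝ) (x : X) : ReebSpace c := Quotient.mk _ x

@[simp] lemma reebLevel_mk (c : X → ℝ) (x : X) : reebLevel c (reebMk c x) = c x := rfl

lemma reebMk_surjective (c : X → ℝ) : Function.Surjective (reebMk c) := Quotient.mk_surjective

lemma continuous_reebMk (c : X → ℝ) : Continuous (reebMk c) := continuous_quotient_mk'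

lemma isQuotientMap_reebMk (c : X → ℝ) : IsQuotientMap (reebMk c) := isQuotientMap_quotient_mk'

lemma reebMk_eq_iff (c : X → ℝ) (x y : X) :
    reebMk c x = reebMk c y ↔ y ∈ connectedComponentIn (c ⁻¹' {c x}) x :=
  Quotient.eq (r := reebSetoid c)

lemma reebMk_eq_of_isPreconnected {c : X → ℝ} {s : Set X} (hs : IsPreconnected s)
    {x y : X} (hx : x ∈ s) (hy : y ∈ s) (h : ∀ z ∈ s, c z = c x) : reebMk c x = reebMk c y :=
  (reebMk_eq_iff c x y).2 (hs.subset_connectedComponentIn hx h hy)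

lemma continuous_reebLevel {c : X → ℝ} (hc : Continuous c) : Continuous (reebLevel c) :=
  hc.quotient_lift _

lemma level_eq_of_reebMk_eq {c : X → ℝ} {x y : X} (h : reebMk c x = reebMk c y) : c x = c y := by
  simpa using congrArg (reebLevel c) h

/-- Distinct classes at the same level are separated by open sets that cover all nearby levels. -/
lemma exists_separation_of_level_eq [CompactSpace X] [T2Space X] {c : X → ℝ} (hc : Continuous c)
    (w w' : ReebSpace c) (hne : w ≠ w') (hl : reebLevel c w = reebLevel c w') :
    ∃ U V : Set (ReebSpace c), IsOpen U ∧ IsOpen V ∧ Disjoint U V ∧ w ∈ U ∧ w' ∈ V ∧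
      ∃ δ > 0, reebLevel c ⁻¹' Ioo (reebLevel c w - δ) (reebLevel c w + δ) ⊆ U ∪ V := by
  obtain ⟨x, rfl⟩ := reebMk_surjective c w
  obtain ⟨y, rfl⟩ := reebMk_surjective c w'
  simp only [reebLevel_mk] at hl
  set F := c ⁻¹' {c x} with hF
  have hFc : IsClosed F := isClosed_singleton.preimage hc
  have : CompactSpace F := isCompact_iff_compactSpace.1 hFc.isCompact
  have hxF : x ∈ F := rfl
  have hyF : y ∈ F := hl.symm
  have hy : y ∉ connectedComponentIn F x := fun h => hne ((reebMk_eq_iff c x y).2 h)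
  have hy' : (⟨y, hyF⟩ : F) ∉ connectedComponent (⟨x, hxF⟩ : F) := by
    intro h
    apply hy
    rw [connectedComponentIn_eq_image hxF]
    exact ⟨_, h, rfl⟩
  -- In a compact Hausdorff space components are quasi-components, so some clopen part of the level
  -- set contains `x` and not `y`.
  rw [connectedComponent_eq_iInter_isClopen] at hy'
  simp only [mem_iInter, Subtype.forall, not_forall] at hy'
  obtain ⟨Z, ⟨hZ, hxZ⟩, hyZ⟩ := hy'
  have hA : IsCompact (Subtype.val '' Z : Set X) :=
    hZ.1.isCompact.image continuous_subtype_val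
  have hB : IsCompact (Subtype.val '' Zᶜ : Set X) :=
    hZ.compl.1.isCompact.image continuous_subtype_val
  have hAB : Disjoint (Subtype.val '' Z : Set X) (Subtype.val '' Zᶜ) :=
    (disjoint_image_iff Subtype.val_injective).2 disjoint_compl_right
  obtain ⟨U, V, hU, hV, hAU, hBV, hUV⟩ := SeparatedNhds.of_isCompact_isCompact hA hB hAB
  have hFUV : F ⊆ U ∪ V := by
    intro z hz
    by_cases hzZ : (⟨z, hz⟩ : F) ∈ Z
    · exact Or.inl (hAU ⟨_, hzZ, rfl⟩)
    · exact Or.inr (hBV ⟨_, hzZ, rfl⟩)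
  -- The values taken outside `U ∪ V` form a closed set that misses `c x`, so a whole interval of
  -- levels lies over `U ∪ V`.
  have hcl : IsClosed (c '' (U ∪ V)ᶜ) := (hc.isClosedMap) _ (hU.union hV).isClosed_compl
  have hn : c x ∉ c '' (U ∪ V)ᶜ := by
    rintro ⟨z, hz, hzx⟩
    exact hz (hFUV hzx)
  obtain ⟨δ, hδ, hball⟩ := Metric.isOpen_iff.1 hcl.isOpen_compl _ hn
  rw [Real.ball_eq_Ioo] at hball
  set I := Ioo (c x - δ) (c x + δ) with hI
  have hcov : c ⁻¹' I ⊆ U ∪ V := by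
    intro z hz
    by_contra h
    exact hball hz ⟨z, h, rfl⟩
  -- Over these levels `U` and `V` are saturated: a component of a level set is connected and
  -- covered by both, so it lies in one of them.
  have sat : ∀ {U V : Set X}, IsOpen U → IsOpen V → Disjoint U V → c ⁻¹' I ⊆ U ∪ V →
      ∀ z z', z ∈ U → c z ∈ I → reebMk c z = reebMk c z' → z' ∈ U := by
    intro U V hU hV hUV hcov z z' hz hzI hzz'
    have hm := (reebMk_eq_iff c z z').1 hzz'
    have hsub : connectedComponentIn (c ⁻¹' {c z}) z ⊆ U ∪ V := by
      refine (connectedComponentIn_subset _ _).trans (fun a ha => hcov ?_)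
      have : c a = c z := ha
      simpa [this] using hzI
    exact isPreconnected_connectedComponentIn.subset_left_of_subset_union hU hV hUV hsub
      ⟨z, mem_connectedComponentIn rfl, hz⟩ hm
  have key : ∀ {U V : Set X}, IsOpen U → IsOpen V → Disjoint U V → c ⁻¹' I ⊆ U ∪ V →
      reebMk c ⁻¹' (reebMk c '' (U ∩ c ⁻¹' I)) = U ∩ c ⁻¹' I := by
    intro U V hU hV hUV hcov
    refine Subset.antisymm ?_ (subset_preimage_image _ _)
    rintro z ⟨z', ⟨hz', hzI⟩, hzz'⟩
    exact ⟨sat hU hV hUV hcov z' z hz' hzI hzz', by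
      have := level_eq_of_reebMk_eq hzz'
      simpa [← this] using hzI⟩
  have hcov' : c ⁻¹' I ⊆ V ∪ U := by rwa [union_comm]
  have hIo : IsOpen (c ⁻¹' I) := isOpen_Ioo.preimage hc
  have hxI : c x ∈ I := by simp [hI, hδ]
  refine ⟨reebMk c '' (U ∩ c ⁻¹' I), reebMk c '' (V ∩ c ⁻¹' I), ?_, ?_, ?_, ?_, ?_, δ, hδ, ?_⟩
  · rw [← (isQuotientMap_reebMk c).isOpen_preimage, key hU hV hUV hcov]
    exact hU.inter hIo
  · rw [← (isQuotientMap_reebMk c).isOpen_preimage, key hV hU hUV.symm hcov']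
    exact hV.inter hIo
  · rw [Set.disjoint_left]
    rintro _ ⟨z, ⟨hz, hzI⟩, rfl⟩ ⟨z', ⟨hz', hzI'⟩, hzz'⟩
    exact Set.disjoint_left.1 hUV hz (sat hV hU hUV.symm hcov' z' z hz' hzI' hzz')
  · exact ⟨x, ⟨hAU ⟨_, hxZ, rfl⟩, hxI⟩, rfl⟩
  · exact ⟨y, ⟨hBV ⟨_, hyZ, rfl⟩, by
      change c y ∈ I
      rw [← hl]; exact hxI⟩, rfl⟩
  · intro w hw
    obtain ⟨z, rfl⟩ := reebMk_surjective c w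
    have hz : z ∈ c ⁻¹' I := hw
    rcases hcov hz with h | h
    · exact Or.inl ⟨z, ⟨h, hz⟩, rfl⟩
    · exact Or.inr ⟨z, ⟨h, hz⟩, rfl⟩

/-- Points at different levels are separated by the level function, points at the same level by the
clopen splitting of that level set. -/
lemma t2Space_reebSpace [CompactSpace X] [T2Space X] {c : X → ℝ} (hc : Continuous c) :
    T2Space (ReebSpace c) := by
  refine ⟨fun w w' hne => ?_⟩
  by_cases hl : reebLevel c w = reebLevel c w'
  · obtain ⟨U, V, hU, hV, hUV, hw, hw', -⟩ := exists_separation_of_level_eq hc w w' hne hl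
    exact ⟨U, V, hU, hV, hw, hw', hUV⟩
  · obtain ⟨U, V, hU, hV, hw, hw', hUV⟩ := t2_separation hl
    exact ⟨_, _, hU.preimage (continuous_reebLevel hc), hV.preimage (continuous_reebLevel hc),
      hw, hw', hUV.preimage _⟩

/-- The preimage of a connected set under a closed map with connected fibres is connected. -/
lemma isPreconnected_preimage_of_isClosedMap {Y : Type*} [TopologicalSpace Y] {f : X → Y}
    (hf : IsClosedMap f) (hfib : ∀ y, IsPreconnected (f ⁻¹' {y}))
    (hsurj : Function.Surjective f) {s : Set Y} (hs : IsPreconnected s) (hsc : IsClosed s)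
    (hcont : Continuous f) : IsPreconnected (f ⁻¹' s) := by
  have hcl : IsClosed (f ⁻¹' s) := hsc.preimage hcont
  rw [isPreconnected_iff_subset_of_fully_disjoint_closed hcl]
  intro u v hu hv huv hd
  -- Each connected fibre stays on one side, so a splitting of the preimage descends to disjoint
  -- closed sets that cover `s`.
  have hfibre : ∀ y ∈ s, f ⁻¹' {y} ⊆ u ∨ f ⁻¹' {y} ⊆ v := by
    intro y hy
    have hyc : f ⁻¹' {y} ⊆ f ⁻¹' s := preimage_mono (by simpa using hy)
    have := isPreconnected_iff_subset_of_disjoint_closed.1 (hfib y) u v hu hv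
      (hyc.trans huv) (by rw [hd.inter_eq, inter_empty])
    exact this
  have hA : IsClosed (f '' (u ∩ f ⁻¹' s)) := hf _ (hu.inter hcl)
  have hB : IsClosed (f '' (v ∩ f ⁻¹' s)) := hf _ (hv.inter hcl)
  have hcov : s ⊆ f '' (u ∩ f ⁻¹' s) ∪ f '' (v ∩ f ⁻¹' s) := by
    intro y hy
    obtain ⟨x, rfl⟩ := hsurj y
    rcases huv (show x ∈ f ⁻¹' s from hy) with h | h
    · exact Or.inl ⟨x, ⟨h, hy⟩, rfl⟩
    · exact Or.inr ⟨x, ⟨h, hy⟩, rfl⟩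
  have hdis : s ∩ (f '' (u ∩ f ⁻¹' s) ∩ f '' (v ∩ f ⁻¹' s)) = ∅ := by
    rw [Set.eq_empty_iff_forall_notMem]
    rintro y ⟨hy, ⟨a, ⟨ha, -⟩, rfl⟩, ⟨b, ⟨hb, -⟩, hba⟩⟩
    rcases hfibre _ hy with h | h
    · exact Set.disjoint_left.1 hd (h (show b ∈ f ⁻¹' {f a} from hba)) hb
    · exact Set.disjoint_left.1 hd ha (h (show a ∈ f ⁻¹' {f a} from rfl))
  have hback : ∀ {u' v' : Set X}, Disjoint u' v' →
      (∀ y ∈ s, f ⁻¹' {y} ⊆ u' ∨ f ⁻¹' {y} ⊆ v') →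
      s ⊆ f '' (u' ∩ f ⁻¹' s) → f ⁻¹' s ⊆ u' := by
    intro u' v' hd' hfib' hsub x hx
    obtain ⟨a, ⟨ha, -⟩, hax⟩ := hsub hx
    rcases hfib' _ hx with h | h
    · exact h rfl
    · exact absurd (h (show a ∈ f ⁻¹' {f x} from hax)) (Set.disjoint_left.1 hd' ha)
  rcases isPreconnected_iff_subset_of_disjoint_closed.1 hs _ _ hA hB hcov hdis with h | h
  · exact Or.inl (hback hd hfibre h)
  · exact Or.inr (hback hd.symm (fun y hy => (hfibre y hy).symm) h)

/-- A continuous closed surjection with connected fibres that matches the levels identifies the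
Reeb spaces. -/
lemma exists_homeomorph_reebSpace {Y : Type*} [TopologicalSpace Y] [T1Space Y] {f : X → Y}
    (hcont : Continuous f)
    (hf : IsClosedMap f) (hfib : ∀ y, IsPreconnected (f ⁻¹' {y}))
    (hsurj : Function.Surjective f) {c : X → ℝ} {d : Y → ℝ} (hd : Continuous d)
    (hcd : ∀ x x', c x = c x' ↔ d (f x) = d (f x')) :
    ∃ H : ReebSpace c ≃ₜ ReebSpace d, ∀ x, H (reebMk c x) = reebMk d (f x) := by
  -- Only the partitions into levels have to agree, not the values; this leaves room for a
  -- reflection and a translation of the first coordinate.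
  have hlev : ∀ x, c ⁻¹' {c x} = f ⁻¹' (d ⁻¹' {d (f x)}) := by
    intro x; ext z; simp [hcd]
  have hrel : ∀ x x', reebMk c x = reebMk c x' ↔ reebMk d (f x) = reebMk d (f x') := by
    intro x x'
    constructor
    · intro h
      have hm := (reebMk_eq_iff c x x').1 h
      refine reebMk_eq_of_isPreconnected
        (isPreconnected_connectedComponentIn.image f hcont.continuousOn :
          IsPreconnected (f '' connectedComponentIn (c ⁻¹' {c x}) x))
        ⟨x, mem_connectedComponentIn rfl, rfl⟩ ⟨x', hm, rfl⟩ ?_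
      rintro _ ⟨z, hz, rfl⟩
      have := connectedComponentIn_subset _ _ hz
      rw [hlev] at this
      exact this
    · intro h
      have hm := (reebMk_eq_iff d _ _).1 h
      have hFc : IsClosed (d ⁻¹' {d (f x)}) := isClosed_singleton.preimage hd
      have hcc : IsClosed (connectedComponentIn (d ⁻¹' {d (f x)}) (f x)) := by
        have hx : f x ∈ d ⁻¹' {d (f x)} := rfl
        rw [connectedComponentIn_eq_image hx]
        exact hFc.isClosedEmbedding_subtypeVal.isClosedMap _ isClosed_connectedComponent
      refine reebMk_eq_of_isPreconnected
        (isPreconnected_preimage_of_isClosedMap hf hfib hsurj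
          isPreconnected_connectedComponentIn hcc hcont)
        (show x ∈ f ⁻¹' _ from mem_connectedComponentIn rfl) hm ?_
      intro z hz
      have := connectedComponentIn_subset _ _ hz
      exact (hcd _ _).2 this
  let Φ : ReebSpace c → ReebSpace d := Quotient.lift (fun x => reebMk d (f x))
    (fun x x' h => (hrel x x').1 (Quotient.sound h))
  have hΦ : ∀ x, Φ (reebMk c x) = reebMk d (f x) := fun x => rfl
  have hΦc : Continuous Φ := Continuous.quotient_lift ((continuous_reebMk d).comp hcont) _
  have hq : IsQuotientMap (fun x => reebMk d (f x)) :=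
    (isQuotientMap_reebMk d).comp (hf.isQuotientMap hcont hsurj)
  have hΦinj : Function.Injective Φ := by
    intro a b hab
    obtain ⟨x, rfl⟩ := reebMk_surjective c a
    obtain ⟨y, rfl⟩ := reebMk_surjective c b
    exact (hrel x y).2 hab
  have hΦq : IsQuotientMap Φ :=
    IsQuotientMap.of_comp (continuous_reebMk c) hΦc (by exact hq)
  have hΦs : Function.Surjective Φ := hΦq.surjective
  let E := Equiv.ofBijective Φ ⟨hΦinj, hΦs⟩
  refine ⟨⟨E, hΦc, ?_⟩, hΦ⟩
  refine hΦq.continuous_iff.2 ?_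
  have : (E.symm ∘ Φ) = id := funext fun a => E.symm_apply_apply a
  exact this ▸ continuous_id

end ReebGeneral

/-! ### A criterion for a space with a level function to be a finite graph -/

section GraphCriterion

open Set Topology Filter

variable {W : Type*} [TopologicalSpace W] {g : W → ℝ} {V : Set W}

/-- Around every point outside `V` the function `g` has a continuous section with open image. -/
def HasLocalSections (g : W → ℝ) (V : Set W) : Prop :=
  ∀ w ∉ V, ∃ δ > 0, ∃ σ : ℝ → W, ContinuousOn σ (Ioo (g w - δ) (g w + δ)) ∧
    (∀ u ∈ Ioo (g w - δ) (g w + δ), g (σ u) = u) ∧ IsOpen (σ '' Ioo (g w - δ) (g w + δ)) ∧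
    w ∈ σ '' Ioo (g w - δ) (g w + δ) ∧ σ '' Ioo (g w - δ) (g w + δ) ⊆ Vᶜ

/-- Distinct points of a level of `g` are separated by open sets covering all nearby levels. -/
def SeparatesLevels (g : W → ℝ) : Prop :=
  ∀ w w', w ≠ w' → g w = g w' → ∃ U U' : Set W, IsOpen U ∧ IsOpen U' ∧ Disjoint U U' ∧
    w ∈ U ∧ w' ∈ U' ∧ ∃ δ > 0, g ⁻¹' Ioo (g w - δ) (g w + δ) ⊆ U ∪ U'

/-- An open connected set outside `V` on which `g` is injective. -/
structure IsLevelChart (g : W → ℝ) (V N : Set W) : Prop where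
  isOpen : IsOpen N
  isPreconnected : IsPreconnected N
  subset_compl : N ⊆ Vᶜ
  injOn : InjOn g N

lemma HasLocalSections.exists_chart (h : HasLocalSections g V) {w : W} (hw : w ∉ V) :
    ∃ N, IsLevelChart g V N ∧ w ∈ N := by
  obtain ⟨δ, -, σ, hσ, hg, ho, hwσ, hV⟩ := h w hw
  refine ⟨_, ⟨ho, isPreconnected_Ioo.image _ hσ, hV, ?_⟩, hwσ⟩
  rintro _ ⟨u, hu, rfl⟩ _ ⟨u', hu', rfl⟩ huu'
  rw [hg u hu, hg u' hu'] at huu'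
  rw [huu']

/-- A local section through a point of `O` stays in `O` for nearby levels, so those levels are
attained: outside `V` the function `g` is open. -/
lemma HasLocalSections.isOpen_image (h : HasLocalSections g V) {O : Set W} (hO : IsOpen O)
    (hOV : O ⊆ Vᶜ) : IsOpen (g '' O) := by
  rw [isOpen_iff_mem_nhds]
  rintro _ ⟨w, hw, rfl⟩
  obtain ⟨δ, hδ, σ, hσ, hg, ho, ⟨u, hu, hwσ⟩, hV⟩ := h w (hOV hw)
  have hgu : g w = u := by rw [← hwσ, hg u hu]
  have hI : Ioo (g w - δ) (g w + δ) ∈ 𝓝 (g w) := isOpen_Ioo.mem_nhds (by simp [hδ])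
  have hc : ContinuousAt σ (g w) := hσ.continuousAt hI
  have hO' : O ∈ 𝓝 (σ (g w)) := hO.mem_nhds (by rw [hgu, hwσ]; exact hw)
  filter_upwards [hI, hc hO'] with x hx hx'
  exact ⟨σ x, hx', hg x hx⟩

/-- Two charts through a common point invert `g` by two sections. The levels where the sections
agree form an open set because `g` is open, those where they differ form an open set because `W` is
Hausdorff. On an interval of common levels they therefore agree everywhere once they agree
somewhere. -/
lemma IsLevelChart.union [T2Space W] (h : HasLocalSections g V) (hgc : Continuous g)
    {N₁ N₂ : Set W}
    (h₁ : IsLevelChart g V N₁) (h₂ : IsLevelChart g V N₂) (hne : (N₁ ∩ N₂).Nonempty) :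
    IsLevelChart g V (N₁ ∪ N₂) := by
  refine ⟨h₁.isOpen.union h₂.isOpen, h₁.isPreconnected.union' hne h₂.isPreconnected,
    union_subset h₁.subset_compl h₂.subset_compl, ?_⟩
  have key : ∀ w₁ ∈ N₁, ∀ w₂ ∈ N₂, g w₁ = g w₂ → w₁ = w₂ := by
    intro w₁ hw₁ w₂ hw₂ hgw
    obtain ⟨w₃, hw₃, hw₃'⟩ := hne
    set J := uIcc (g w₃) (g w₁)
    have hJ₁ : J ⊆ g '' N₁ :=
      ((h₁.isPreconnected.image g hgc.continuousOn).ordConnected).uIcc_subset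
        ⟨w₃, hw₃, rfl⟩ ⟨w₁, hw₁, rfl⟩
    have hJ₂ : J ⊆ g '' N₂ :=
      ((h₂.isPreconnected.image g hgc.continuousOn).ordConnected).uIcc_subset
        ⟨w₃, hw₃', rfl⟩ ⟨w₂, hw₂, hgw.symm⟩
    set A := g '' (N₁ ∩ N₂)
    have hA : IsOpen A := h.isOpen_image (h₁.isOpen.inter h₂.isOpen)
      (inter_subset_left.trans h₁.subset_compl)
    -- `A` collects the levels at which the charts share a point, `B` those at which their points
    -- are separated. Both are open, and on `J` they are complementary.
    set B : Set ℝ := ⋃ (O : Set W × Set W) (_ : IsOpen O.1 ∧ IsOpen O.2 ∧ Disjoint O.1 O.2),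
      g '' (N₁ ∩ O.1) ∩ g '' (N₂ ∩ O.2)
    have hB : IsOpen B := isOpen_biUnion fun O hO =>
      (h.isOpen_image (h₁.isOpen.inter hO.1) (inter_subset_left.trans h₁.subset_compl)).inter
        (h.isOpen_image (h₂.isOpen.inter hO.2.1) (inter_subset_left.trans h₂.subset_compl))
    have hcov : J ⊆ A ∪ B := by
      intro z hz
      obtain ⟨a, ha, haz⟩ := hJ₁ hz
      obtain ⟨b, hb, hbz⟩ := hJ₂ hz
      by_cases hab : a = b
      · subst hab
        exact Or.inl ⟨a, ⟨ha, hb⟩, haz⟩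
      · obtain ⟨O, O', hO, hO', haO, hbO, hd⟩ := t2_separation hab
        refine Or.inr (mem_biUnion (show (O, O') ∈ {O : Set W × Set W | IsOpen O.1 ∧ IsOpen O.2 ∧
          Disjoint O.1 O.2} from ⟨hO, hO', hd⟩) ⟨⟨a, ⟨ha, haO⟩, haz⟩, ⟨b, ⟨hb, hbO⟩, hbz⟩⟩)
    have hdis : J ∩ (A ∩ B) = ∅ := by
      rw [Set.eq_empty_iff_forall_notMem]
      rintro z ⟨-, ⟨c, ⟨hc₁, hc₂⟩, hcz⟩, hzB⟩
      obtain ⟨O, ⟨-, -, hd⟩, ⟨a, ⟨ha, haO⟩, haz⟩, ⟨b, ⟨hb, hbO⟩, hbz⟩⟩ := mem_iUnion₂.1 hzB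
      have h1 : a = c := h₁.injOn ha hc₁ (haz.trans hcz.symm)
      have h2 : b = c := h₂.injOn hb hc₂ (hbz.trans hcz.symm)
      exact Set.disjoint_left.1 hd (h1 ▸ haO) (h2 ▸ hbO)
    have hJp : IsPreconnected J := isPreconnected_uIcc
    rcases isPreconnected_iff_subset_of_disjoint.1 hJp A B hA hB hcov hdis with hs | hs
    · obtain ⟨c, ⟨hc₁, hc₂⟩, hc⟩ := hs (right_mem_uIcc)
      rw [← h₁.injOn hc₁ hw₁ hc, h₂.injOn hc₂ hw₂ (hc.trans hgw)]
    · exfalso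
      have : g w₃ ∈ J ∩ (A ∩ B) := ⟨left_mem_uIcc, ⟨w₃, ⟨hw₃, hw₃'⟩, rfl⟩, hs left_mem_uIcc⟩
      rw [hdis] at this
      exact this
  rintro a (ha | ha) b (hb | hb) hab
  · exact h₁.injOn ha hb hab
  · exact key a ha b hb hab
  · exact (key b hb a ha hab.symm).symm
  · exact h₂.injOn ha hb hab

/-- The components of the complement of `V` are charts. -/
lemma HasLocalSections.isLevelChart_component [T2Space W] (h : HasLocalSections g V)
    (hgc : Continuous g) {w : W} (hw : w ∉ V) :
    IsLevelChart g V (connectedComponentIn Vᶜ w) := by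
  -- The union of all charts through `w` is again a chart, by gluing in pairs. It is the whole
  -- component because the charts disjoint from it cover the rest of `Vᶜ`.
  set 𝒩 : Set (Set W) := {N | IsLevelChart g V N ∧ w ∈ N}
  obtain ⟨N₀, hN₀, hwN₀⟩ := h.exists_chart hw
  have hU : IsLevelChart g V (⋃₀ 𝒩) := by
    refine ⟨isOpen_sUnion fun N hN => hN.1.isOpen,
      isPreconnected_sUnion w _ (fun N hN => hN.2) fun N hN => hN.1.isPreconnected,
      sUnion_subset fun N hN => hN.1.subset_compl, ?_⟩
    rintro a ⟨N, hN, haN⟩ b ⟨N', hN', hbN'⟩ hab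
    exact (hN.1.union h hgc hN'.1 ⟨w, hN.2, hN'.2⟩).injOn (Or.inl haN) (Or.inr hbN') hab
  have hwU : w ∈ ⋃₀ 𝒩 := ⟨N₀, ⟨hN₀, hwN₀⟩, hwN₀⟩
  have heq : connectedComponentIn Vᶜ w = ⋃₀ 𝒩 := by
    refine Subset.antisymm ?_ (hU.isPreconnected.subset_connectedComponentIn hwU hU.subset_compl)
    set B : Set W := ⋃₀ {N | IsLevelChart g V N ∧ Disjoint N (⋃₀ 𝒩)}
    have hB : IsOpen B := isOpen_sUnion fun N hN => hN.1.isOpen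
    refine isPreconnected_connectedComponentIn.subset_left_of_subset_union hU.isOpen hB ?_ ?_
      ⟨w, mem_connectedComponentIn hw, hwU⟩
    · rw [Set.disjoint_left]
      rintro a ha ⟨N, ⟨-, hN⟩, haN⟩
      exact Set.disjoint_left.1 hN haN ha
    · intro z hz
      have hzV : z ∉ V := connectedComponentIn_subset _ _ hz
      obtain ⟨N, hN, hzN⟩ := h.exists_chart hzV
      by_cases hd : Disjoint N (⋃₀ 𝒩)
      · exact Or.inr ⟨N, ⟨hN, hd⟩, hzN⟩
      · rw [disjoint_comm, Set.not_disjoint_iff_nonempty_inter] at hd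
        exact Or.inl ⟨_, ⟨hU.union h hgc hN hd, Or.inl hwU⟩, Or.inr hzN⟩
  rw [heq]
  exact hU

/-- By compactness it is enough that there is only one cluster point. Every cluster point is at
level `x₀`. Two of them would be separated by disjoint open sets that cover all nearby levels, and
the connected image of `σ` near `x₀` would have to meet both. -/
lemma SeparatesLevels.tendsto_section [CompactSpace W] (hs : SeparatesLevels g)
    (hgc : Continuous g) {a b x₀ : ℝ} (hx₀ : x₀ = a ∨ x₀ = b) (hab : a < b) {σ : ℝ → W}
    (hσ : ContinuousOn σ (Ioo a b)) (hg : ∀ u ∈ Ioo a b, g (σ u) = u) :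
    ∃ v, Tendsto σ (𝓝[Ioo a b] x₀) (𝓝 v) ∧ g v = x₀ := by
  have hne : (𝓝[Ioo a b] x₀).NeBot := by
    rw [← mem_closure_iff_nhdsWithin_neBot, closure_Ioo hab.ne]
    rcases hx₀ with rfl | rfl
    · exact left_mem_Icc.2 hab.le
    · exact right_mem_Icc.2 hab.le
  have hlim : ∀ v, ClusterPt v (map σ (𝓝[Ioo a b] x₀)) → g v = x₀ := by
    intro v hv
    have h1 : ClusterPt (g v) (map g (map σ (𝓝[Ioo a b] x₀))) :=
      hv.map hgc.continuousAt tendsto_map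
    have h2 : map g (map σ (𝓝[Ioo a b] x₀)) ≤ 𝓝 x₀ := by
      rw [map_map]
      have : Tendsto (g ∘ σ) (𝓝[Ioo a b] x₀) (𝓝 x₀) := by
        refine Tendsto.congr' ?_ (tendsto_id.mono_left nhdsWithin_le_nhds)
        filter_upwards [self_mem_nhdsWithin] with u hu
        exact (hg u hu).symm
      exact this
    have h3 : ClusterPt (g v) (𝓝 x₀) := h1.mono h2
    exact (eq_of_nhds_neBot h3)
  obtain ⟨v, hv⟩ := exists_clusterPt_of_compactSpace (map σ (𝓝[Ioo a b] x₀))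
  refine ⟨v, ?_, hlim v hv⟩
  refine isCompact_univ.le_nhds_of_unique_clusterPt univ_mem ?_
  intro v' _ hv'
  by_contra hne'
  obtain ⟨U, U', hU, hU', hd, hvU, hvU', δ, hδ, hcov⟩ :=
    hs v v' (Ne.symm hne') (by rw [hlim v hv, hlim v' hv'])
  rw [hlim v hv] at hcov
  set I := Ioo a b ∩ Ioo (x₀ - δ) (x₀ + δ)
  have hI : I ∈ 𝓝[Ioo a b] x₀ := inter_mem self_mem_nhdsWithin
    (mem_nhdsWithin_of_mem_nhds (isOpen_Ioo.mem_nhds (by simp [hδ])))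
  have hIp : IsPreconnected I := (ordConnected_Ioo.inter ordConnected_Ioo).isPreconnected
  have hIσ : IsPreconnected (σ '' I) := hIp.image _ (hσ.mono inter_subset_left)
  have hsub : σ '' I ⊆ U ∪ U' := by
    rintro _ ⟨u, hu, rfl⟩
    exact hcov (by simpa [hg u hu.1] using hu.2)
  have hm : σ '' I ∈ map σ (𝓝[Ioo a b] x₀) := image_mem_map hI
  have e1 : (U ∩ σ '' I).Nonempty := clusterPt_iff_nonempty.1 hv (hU.mem_nhds hvU) hm
  have e2 : (U' ∩ σ '' I).Nonempty := clusterPt_iff_nonempty.1 hv' (hU'.mem_nhds hvU') hm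
  obtain ⟨z, -, hz, hz'⟩ :=
    hIσ U U' hU hU' hsub (by rwa [inter_comm]) (by rwa [inter_comm])
  exact Set.disjoint_left.1 hd hz hz'

/-- Every edge is an open arc on which `g` is a coordinate, with end points in `V`. -/
lemma HasLocalSections.exists_arc [T2Space W] [CompactSpace W] (h : HasLocalSections g V)
    (hgc : Continuous g) (hs : SeparatesLevels g) {e : Set W} (he : e ∈ graphEdges V) :
    ∃ (a b : ℝ) (τ : ℝ → W), a < b ∧ ContinuousOn τ (Icc a b) ∧ (∀ u ∈ Icc a b, g (τ u) = u) ∧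
      τ a ∈ V ∧ τ b ∈ V ∧ τ '' Ioo a b = e := by
  obtain ⟨w, hw, rfl⟩ := he
  set e := connectedComponentIn Vᶜ w with he
  have hch := h.isLevelChart_component hgc hw
  have hwe : w ∈ e := mem_connectedComponentIn hw
  have hgo : IsOpen (g '' e) := h.isOpen_image hch.isOpen hch.subset_compl
  have hgp : IsPreconnected (g '' e) := hch.isPreconnected.image g hgc.continuousOn
  have hcomp : IsCompact (range g) := isCompact_range hgc
  have hbdd : Bornology.IsBounded (g '' e) := hcomp.isBounded.subset (image_subset_range _ _)
  obtain ⟨a, b, hIoo⟩ : ∃ a b, g '' e = Ioo a b := by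
    have hne : (g '' e).Nonempty := ⟨_, w, hwe, rfl⟩
    refine ⟨sInf (g '' e), sSup (g '' e), Subset.antisymm ?_ ?_⟩
    · intro x hx
      obtain ⟨ε, hε, hball⟩ := Metric.isOpen_iff.1 hgo x hx
      rw [Real.ball_eq_Ioo] at hball
      constructor
      · have : x - ε / 2 ∈ g '' e := hball ⟨by linarith, by linarith⟩
        linarith [csInf_le hbdd.bddBelow this]
      · have : x + ε / 2 ∈ g '' e := hball ⟨by linarith, by linarith⟩
        linarith [le_csSup hbdd.bddAbove this]
    · intro x hx
      obtain ⟨y, hy, hyx⟩ := exists_lt_of_csInf_lt hne hx.1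
      obtain ⟨z, hz, hzx⟩ := exists_lt_of_lt_csSup hne hx.2
      exact hgp.ordConnected.out hy hz ⟨hyx.le, hzx.le⟩
  have hab : a < b := by
    have : g w ∈ Ioo a b := hIoo ▸ ⟨w, hwe, rfl⟩
    exact this.1.trans this.2
  have hinv : ∀ u ∈ Ioo a b, ∃ z ∈ e, g z = u := fun u hu => by
    rw [← hIoo] at hu; exact hu
  have : Nonempty W := ⟨w⟩
  choose! σ hσe hσg using hinv
  have hσc : ContinuousOn σ (Ioo a b) := by
    intro u hu
    refine ContinuousAt.continuousWithinAt ?_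
    intro O hO
    rw [mem_map]
    obtain ⟨O', hO'O, hO', hzO'⟩ := mem_nhds_iff.1 hO
    have ho : IsOpen (g '' (O' ∩ e)) := h.isOpen_image (hO'.inter hch.isOpen)
      (inter_subset_right.trans hch.subset_compl)
    have hu' : u ∈ g '' (O' ∩ e) := ⟨σ u, ⟨hzO', hσe u hu⟩, hσg u hu⟩
    filter_upwards [ho.mem_nhds hu'] with x hx
    obtain ⟨z, ⟨hzO, hze⟩, hzx⟩ := hx
    have hxI : x ∈ Ioo a b := hIoo ▸ ⟨z, hze, hzx⟩
    have : σ x = z := hch.injOn (hσe x hxI) hze ((hσg x hxI).trans hzx.symm)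
    exact hO'O (this ▸ hzO)
  have himg : σ '' Ioo a b = e := by
    refine Subset.antisymm (by rintro _ ⟨u, hu, rfl⟩; exact hσe u hu) ?_
    intro z hz
    have hzI : g z ∈ Ioo a b := hIoo ▸ ⟨z, hz, rfl⟩
    exact ⟨g z, hzI, hch.injOn (hσe _ hzI) hz (hσg _ hzI)⟩
  -- A limit outside `V` would have an open component that meets `e`, hence would belong to `e`, and
  -- its level `x₀` would be an interior point of `Ioo a b`.
  have hend : ∀ x₀, x₀ = a ∨ x₀ = b → ∃ v ∈ V, Tendsto σ (𝓝[Ioo a b] x₀) (𝓝 v) ∧ g v = x₀ := by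
    intro x₀ hx₀
    obtain ⟨v, hv, hgv⟩ := hs.tendsto_section hgc hx₀ hab hσc hσg
    refine ⟨v, ?_, hv, hgv⟩
    by_contra hvV
    have hne : (𝓝[Ioo a b] x₀).NeBot := by
      rw [← mem_closure_iff_nhdsWithin_neBot, closure_Ioo hab.ne]
      rcases hx₀ with rfl | rfl
      · exact left_mem_Icc.2 hab.le
      · exact right_mem_Icc.2 hab.le
    have hcl : v ∈ closure e := by
      refine mem_closure_of_tendsto hv ?_
      filter_upwards [self_mem_nhdsWithin] with u hu using hσe u hu
    have hve : v ∈ e := by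
      have hch' := h.isLevelChart_component hgc hvV
      obtain ⟨z, hz, hze⟩ := mem_closure_iff.1 hcl _ hch'.isOpen (mem_connectedComponentIn hvV)
      have h1 := connectedComponentIn_eq hz
      have h2 := connectedComponentIn_eq hze
      rw [he, h2, ← h1]
      exact mem_connectedComponentIn hvV
    have : x₀ ∈ Ioo a b := by rw [← hIoo, ← hgv]; exact ⟨v, hve, rfl⟩
    rcases hx₀ with rfl | rfl
    · exact lt_irrefl _ this.1
    · exact lt_irrefl _ this.2
  obtain ⟨va, hvaV, hva, hgva⟩ := hend a (Or.inl rfl)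
  obtain ⟨vb, hvbV, hvb, hgvb⟩ := hend b (Or.inr rfl)
  rw [nhdsWithin_Ioo_eq_nhdsGT hab] at hva
  rw [nhdsWithin_Ioo_eq_nhdsLT hab] at hvb
  set τ := extendFrom (Ioo a b) σ
  have hτa : τ a = va := eq_lim_at_left_extendFrom_Ioo hab hva
  have hτb : τ b = vb := eq_lim_at_right_extendFrom_Ioo hab hvb
  have hτ : ∀ u ∈ Ioo a b, τ u = σ u := fun u hu =>
    extendFrom_eq (subset_closure hu) (hσc u hu)
  refine ⟨a, b, τ, hab, continuousOn_Icc_extendFrom_Ioo hσc hva hvb, ?_, hτa ▸ hvaV,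
    hτb ▸ hvbV, ?_⟩
  · intro u hu
    rcases eq_endpoints_or_mem_Ioo_of_mem_Icc hu with rfl | rfl | hu'
    · rw [hτa, hgva]
    · rw [hτb, hgvb]
    · rw [hτ u hu', hσg u hu']
  · rw [← himg]
    exact image_congr hτ

/-- A compact space with a function that separates its levels and has local sections outside a
finite set `V` is a finite graph with vertex set `V`. -/
lemma HasLocalSections.isFiniteGraph [T2Space W] [CompactSpace W] (h : HasLocalSections g V)
    (hgc : Continuous g) (hs : SeparatesLevels g) (hV : V.Finite) : IsFiniteGraph V := by
  refine ⟨inferInstance, hV, ?_, ?_⟩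
  -- For each vertex level `a` a level `t a` just above it, below the next vertex level: every edge
  -- that starts at level `a` crosses it.
  · have hgap : ∀ a ∈ g '' V, ∃ t, a < t ∧ ∀ b ∈ g '' V, a < b → t < b := by
      intro a _
      have hfin : (g '' V ∩ Ioi a).Finite := (hV.image g).inter_of_left _
      by_cases hne : (g '' V ∩ Ioi a).Nonempty
      · obtain ⟨b, hb, hmin⟩ := hfin.exists_minimal hne
        have hab : a < b := hb.2
        refine ⟨(a + b) / 2, by linarith, fun b' hb' hab' => ?_⟩
        have : b ≤ b' := by
          by_contra hlt
          exact hlt (hmin ⟨hb', hab'⟩ (not_le.1 hlt).le)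
        linarith
      · exact ⟨a + 1, by linarith, fun b hb hab => absurd ⟨b, hb, hab⟩ hne⟩
    choose! t hat hbt using hgap
    -- This level set is compact and avoids `V`, and each chart contains at most one of its points;
    -- so it is finite, and so is the set of edges that cross it.
    have hfib : ∀ a ∈ g '' V, (g ⁻¹' {t a}).Finite := by
      intro a ha
      have hcomp : IsCompact (g ⁻¹' {t a}) := (isClosed_singleton.preimage hgc).isCompact
      have hnot : ∀ w ∈ g ⁻¹' {t a}, w ∉ V := by
        intro w hw hwV
        have hw' : g w = t a := hw
        have := hbt a ha (g w) ⟨w, hwV, rfl⟩ (hw' ▸ hat a ha)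
        rw [hw'] at this
        exact lt_irrefl _ this
      choose! N hN hwN using fun w (hw : w ∉ V) => h.exists_chart hw
      obtain ⟨s, hs1, hs2⟩ := hcomp.elim_nhds_subcover N
        (fun w hw => (hN w (hnot w hw)).isOpen.mem_nhds (hwN w (hnot w hw)))
      refine s.finite_toSet.subset fun z hz => ?_
      obtain ⟨w, hw, hzw⟩ := mem_iUnion₂.1 (hs2 hz)
      have hwf := hs1 w hw
      have : z = w := (hN w (hnot w hwf)).injOn hzw (hwN w (hnot w hwf))
        ((show g z = t a from hz).trans (show g w = t a from hwf).symm)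
      rw [this]; exact hw
    refine ((hV.image g).biUnion fun a ha =>
      ((hfib a ha).image (fun w => connectedComponentIn Vᶜ w))).subset ?_
    intro e he
    obtain ⟨a, b, τ, hab, hτ, hgτ, ha, hb, hτe⟩ := h.exists_arc hgc hs he
    have hga : a ∈ g '' V := ⟨_, ha, hgτ a (left_mem_Icc.2 hab.le)⟩
    have hgb : b ∈ g '' V := ⟨_, hb, hgτ b (right_mem_Icc.2 hab.le)⟩
    have htI : t a ∈ Ioo a b := ⟨hat a hga, hbt a hga b hgb hab⟩
    refine mem_biUnion hga ⟨τ (t a), hgτ _ (Ioo_subset_Icc_self htI), ?_⟩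
    have hme : τ (t a) ∈ e := hτe ▸ ⟨_, htI, rfl⟩
    obtain ⟨w, hw, rfl⟩ := he
    exact (connectedComponentIn_eq hme).symm
  · intro e he
    obtain ⟨a, b, τ, hab, hτ, hgτ, ha, hb, hτe⟩ := h.exists_arc hgc hs he
    set ℓ : ℝ → ℝ := fun s => a + s * (b - a)
    have hba : 0 < b - a := sub_pos.2 hab
    have hℓ : ∀ s ∈ Icc (0 : ℝ) 1, ℓ s ∈ Icc a b := fun s hs => by
      constructor <;> simp only [ℓ] <;> nlinarith [hs.1, hs.2]
    refine ⟨fun s => τ (ℓ s), ?_, ?_, ?_, ?_, ?_⟩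
    · exact hτ.comp_continuous (by fun_prop) fun s => hℓ s s.2
    · intro s s' hss
      have := congrArg g hss
      simp only [hgτ _ (hℓ s s.2), hgτ _ (hℓ s' s'.2)] at this
      have h2 : (s : ℝ) * (b - a) = s' * (b - a) := by simpa [ℓ] using this
      exact Subtype.ext (mul_right_cancel₀ hba.ne' h2)
    · simpa [ℓ] using ha
    · simpa [ℓ] using hb
    · rw [← hτe]
      ext z
      constructor
      · rintro ⟨s, hs, rfl⟩
        have h0 : (0 : ℝ) < s := hs.1
        have h1 : (s : ℝ) < 1 := hs.2
        refine ⟨ℓ s, ⟨?_, ?_⟩, rfl⟩ <;> simp only [ℓ] <;> nlinarith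
      · rintro ⟨u, hu, rfl⟩
        have h0 : 0 < (u - a) / (b - a) := div_pos (sub_pos.2 hu.1) hba
        have h1 : (u - a) / (b - a) < 1 := (div_lt_one hba).2 (by linarith [hu.2])
        refine ⟨⟨(u - a) / (b - a), h0.le, h1.le⟩, ⟨h0, h1⟩, ?_⟩
        have : ℓ ((u - a) / (b - a)) = u := by simp only [ℓ]; field_simp; ring
        simp only [this]

end GraphCriterion

set_option linter.unusedSectionVars false

/-! ### Subdividing an edge, attaching an arc, counting vertices and edges -/

section GraphOperations

open Set Topology

variable {W : Type*} [TopologicalSpace W]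

/-- A partition of the complement of `V` into open connected sets is the set of its components. -/
lemma graphEdges_eq_of_partition {V : Set W} {F : Set (Set W)} (ho : ∀ N ∈ F, IsOpen N)
    (hc : ∀ N ∈ F, IsConnected N) (hd : F.PairwiseDisjoint id) (hU : ⋃₀ F = Vᶜ) :
    graphEdges V = F := by
  have key : ∀ N ∈ F, ∀ w ∈ N, connectedComponentIn Vᶜ w = N := by
    intro N hN w hw
    have hNV : N ⊆ Vᶜ := hU ▸ subset_sUnion_of_mem hN
    refine Subset.antisymm ?_ ((hc N hN).isPreconnected.subset_connectedComponentIn hw hNV)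
    have hB : IsOpen (⋃₀ (F \ {N})) := isOpen_sUnion fun M hM => ho M hM.1
    refine isPreconnected_connectedComponentIn.subset_left_of_subset_union (ho N hN) hB ?_ ?_
      ⟨w, mem_connectedComponentIn (hNV hw), hw⟩
    · rw [Set.disjoint_left]
      rintro a ha ⟨M, ⟨hM, hMN⟩, haM⟩
      exact Set.disjoint_left.1 (hd hN hM (Ne.symm hMN)) ha haM
    · refine (connectedComponentIn_subset _ _).trans ?_
      rw [← hU]
      rintro a ⟨M, hM, haM⟩
      by_cases h : M = N
      · exact Or.inl (h ▸ haM)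
      · exact Or.inr ⟨M, ⟨hM, h⟩, haM⟩
  ext e
  constructor
  · rintro ⟨w, hw, rfl⟩
    rw [← hU] at hw
    obtain ⟨N, hN, hwN⟩ := hw
    rw [key N hN w hwN]; exact hN
  · intro he
    obtain ⟨w, hw⟩ := (hc e he).nonempty
    exact ⟨w, hU ▸ ⟨e, he, hw⟩, (key e he w hw).symm⟩

lemma sUnion_graphEdges (V : Set W) : ⋃₀ graphEdges V = Vᶜ := by
  ext w
  constructor
  · rintro ⟨_, ⟨z, -, rfl⟩, hwz⟩
    exact connectedComponentIn_subset _ _ hwz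
  · intro hw
    exact ⟨_, ⟨w, hw, rfl⟩, mem_connectedComponentIn hw⟩

lemma isConnected_of_mem_graphEdges {V e : Set W} (he : e ∈ graphEdges V) : IsConnected e := by
  obtain ⟨w, hw, rfl⟩ := he
  exact isConnected_connectedComponentIn_iff.2 hw

lemma pairwiseDisjoint_graphEdges (V : Set W) : (graphEdges V).PairwiseDisjoint id := by
  rintro _ ⟨w, -, rfl⟩ _ ⟨w', -, rfl⟩ hne
  rw [Function.onFun, Set.disjoint_left]
  intro a ha ha'
  exact hne ((connectedComponentIn_eq ha).trans (connectedComponentIn_eq ha').symm)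

/-- The closed arcs of the other edges are compact and add only vertices to them, so an edge is the
complement of the finite set `V` and of finitely many closed arcs. No local connectedness of `W` is
assumed. -/
lemma IsFiniteGraph.isOpen_edge {V : Set W} (h : IsFiniteGraph V) {e : Set W}
    (he : e ∈ graphEdges V) : IsOpen e := by
  have := h.t2
  have hVo : IsOpen Vᶜ := h.finite_vertices.isClosed.isOpen_compl
  have hcl : ∀ e' ∈ graphEdges V, ∃ C, IsClosed C ∧ e' ⊆ C ∧ C ⊆ e' ∪ V := by
    intro e' he'
    obtain ⟨φ, hφ, -, h0, h1, himg⟩ := h.edge_arc e' he'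
    refine ⟨range φ, (isCompact_range hφ).isClosed, himg ▸ image_subset_range _ _, ?_⟩
    rintro _ ⟨s, rfl⟩
    rcases eq_or_ne s 0 with rfl | hs0
    · exact Or.inr h0
    rcases eq_or_ne s 1 with rfl | hs1
    · exact Or.inr h1
    exact Or.inl (himg ▸ ⟨s, ⟨unitInterval.pos_iff_ne_zero.2 hs0,
      unitInterval.lt_one_iff_ne_one.2 hs1⟩, rfl⟩)
  choose! C hC hsub hsup using hcl
  have hcl2 : IsClosed (⋃ e' ∈ graphEdges V \ {e}, C e') :=
    (h.finite_edges.subset sdiff_subset).isClosed_biUnion fun e' he' => hC e' he'.1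
  have heq : e = Vᶜ ∩ (⋃ e' ∈ graphEdges V \ {e}, C e')ᶜ := by
    ext w
    constructor
    · intro hw
      have hwV : w ∈ Vᶜ := sUnion_graphEdges V ▸ ⟨e, he, hw⟩
      refine ⟨hwV, fun hw' => ?_⟩
      obtain ⟨e', ⟨he', hne⟩, hwe'⟩ := mem_iUnion₂.1 hw'
      rcases hsup e' he' hwe' with h' | h'
      · exact Set.disjoint_left.1 (pairwiseDisjoint_graphEdges V he he' (Ne.symm hne)) hw h'
      · exact hwV h'
    · rintro ⟨hwV, hw⟩
      rw [← sUnion_graphEdges] at hwV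
      obtain ⟨e', he', hwe'⟩ := hwV
      by_cases h' : e' = e
      · exact h' ▸ hwe'
      · exact absurd (mem_biUnion (show e' ∈ graphEdges V \ {e} from ⟨he', h'⟩) (hsub e' he' hwe')) hw
  rw [heq]
  exact hVo.inter hcl2.isOpen_compl

/-- Two new vertices in the interior of an edge yield two more edges. -/
lemma IsFiniteGraph.subdivide {V : Set W} (h : IsFiniteGraph V) {e : Set W}
    (he : e ∈ graphEdges V) {v₁ v₂ : W} (hv₁ : v₁ ∈ e) (hv₂ : v₂ ∈ e) (hne : v₁ ≠ v₂) :
    (∀ N ∈ graphEdges (V ∪ {v₁, v₂}), IsOpen N) ∧ (graphEdges (V ∪ {v₁, v₂})).Finite ∧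
      (graphEdges (V ∪ {v₁, v₂})).ncard = (graphEdges V).ncard + 2 := by
  have := h.t2
  obtain ⟨φ, hφ, hφi, h0, h1, himg⟩ := h.edge_arc e he
  obtain ⟨s₁, hs₁, rfl⟩ : v₁ ∈ φ '' Ioo 0 1 := himg ▸ hv₁
  obtain ⟨s₂, hs₂, rfl⟩ : v₂ ∈ φ '' Ioo 0 1 := himg ▸ hv₂
  clear hv₁ hv₂
  wlog hlt : s₁ < s₂ generalizing s₁ s₂
  · have := this s₂ hs₂ s₁ hs₁ hne.symm
      (lt_of_le_of_ne (not_lt.1 hlt) fun h => hne (congrArg φ h).symm)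
    rwa [pair_comm] at this
  have heo : IsOpen e := h.isOpen_edge he
  have hclosed : IsClosedMap φ := hφ.isClosedMap
  have harc : ∀ a b : unitInterval, a < b →
      IsOpen (φ '' Ioo a b) ∧ IsConnected (φ '' Ioo a b) ∧ φ '' Ioo a b ⊆ e := by
    intro a b hab
    have hsub : φ '' Ioo a b ⊆ e := himg ▸ image_mono
      (Ioo_subset_Ioo unitInterval.nonneg' unitInterval.le_one')
    refine ⟨?_, (isConnected_Ioo hab).image _ hφ.continuousOn, hsub⟩
    -- Since `φ` is a closed map and `e` is open, this form shows that subarcs of an edge are open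
    -- in `W`.
    have : φ '' Ioo a b = e ∩ (φ '' (Ioo a b)ᶜ)ᶜ := by
      ext z
      constructor
      · rintro ⟨s, hs, rfl⟩
        refine ⟨hsub ⟨s, hs, rfl⟩, ?_⟩
        rintro ⟨s', hs', hss'⟩
        exact hs' (hφi hss' ▸ hs)
      · rintro ⟨hz, hz'⟩
        obtain ⟨s, hs, rfl⟩ : z ∈ φ '' Ioo 0 1 := himg ▸ hz
        by_contra hn
        exact hz' ⟨s, fun hs' => hn ⟨s, hs', rfl⟩, rfl⟩
    rw [this]
    exact heo.inter (hclosed _ isOpen_Ioo.isClosed_compl).isOpen_compl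
  have h01 := harc 0 s₁ hs₁.1
  have h12 := harc s₁ s₂ hlt
  have h23 := harc s₂ 1 hs₂.2
  set A₁ := φ '' Ioo 0 s₁ with hA₁
  set A₂ := φ '' Ioo s₁ s₂ with hA₂
  set A₃ := φ '' Ioo s₂ 1 with hA₃
  have hd12 : Disjoint A₁ A₂ := (disjoint_image_iff hφi).2 (Set.disjoint_left.2
    fun x hx hx' => lt_asymm hx.2 hx'.1)
  have hd13 : Disjoint A₁ A₃ := (disjoint_image_iff hφi).2 (Set.disjoint_left.2
    fun x hx hx' => lt_asymm (hx.2.trans hlt) hx'.1)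
  have hd23 : Disjoint A₂ A₃ := (disjoint_image_iff hφi).2 (Set.disjoint_left.2
    fun x hx hx' => lt_asymm hx.2 hx'.1)
  have hout : ∀ e' ∈ graphEdges V \ {e}, Disjoint e e' := fun e' he' =>
    pairwiseDisjoint_graphEdges V he he'.1 (Ne.symm he'.2)
  have hne12 : A₁ ≠ A₂ := fun h => h01.2.1.nonempty.ne_empty (disjoint_self.1 (h ▸ hd12 : Disjoint A₁ A₁))
  have hne13 : A₁ ≠ A₃ := fun h => h01.2.1.nonempty.ne_empty (disjoint_self.1 (h ▸ hd13 : Disjoint A₁ A₁))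
  have hne23 : A₂ ≠ A₃ := fun h => h12.2.1.nonempty.ne_empty (disjoint_self.1 (h ▸ hd23 : Disjoint A₂ A₂))
  have hnot : ∀ A : Set W, A.Nonempty → A ⊆ e → A ∉ graphEdges V \ {e} := by
    intro A hA hAe hmem
    obtain ⟨z, hz⟩ := hA
    exact Set.disjoint_left.1 (hout A hmem) (hAe hz) hz
  set F : Set (Set W) := insert A₁ (insert A₂ (insert A₃ (graphEdges V \ {e}))) with hF
  have hFo : ∀ N ∈ F, IsOpen N := by
    rintro N (rfl | rfl | rfl | hN)
    exacts [h01.1, h12.1, h23.1, h.isOpen_edge hN.1]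
  have hFeq : graphEdges (V ∪ {φ s₁, φ s₂}) = F := by
    refine graphEdges_eq_of_partition hFo ?_ ?_ ?_
    · rintro N (rfl | rfl | rfl | hN)
      exacts [h01.2.1, h12.2.1, h23.2.1, isConnected_of_mem_graphEdges hN.1]
    · have hsub := (pairwiseDisjoint_graphEdges V).subset (sdiff_subset (t := {e}))
      have ho : ∀ A ⊆ e, ∀ j ∈ graphEdges V \ {e}, A ≠ j → Disjoint (id A) (id j) :=
        fun A hA j hj _ => (hout j hj).mono_left hA
      refine ((hsub.insert (ho _ h23.2.2)).insert ?_).insert ?_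
      · rintro j (rfl | hj) hne
        exacts [hd23, ho _ h12.2.2 j hj hne]
      · rintro j (rfl | rfl | hj) hne
        exacts [hd12, hd13, ho _ h01.2.2 j hj hne]
    · ext z
      constructor
      · rintro ⟨N, hN, hzN⟩
        have hVe : e ⊆ Vᶜ := fun w hw => sUnion_graphEdges V ▸ ⟨e, he, hw⟩
        rintro (hz | hz)
        · rcases hN with rfl | rfl | rfl | hN
          · exact hVe (h01.2.2 hzN) hz
          · exact hVe (h12.2.2 hzN) hz
          · exact hVe (h23.2.2 hzN) hz
          · have : z ∈ Vᶜ := sUnion_graphEdges V ▸ ⟨N, hN.1, hzN⟩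
            exact this hz
        · have hze : z ∈ e := by
            rcases hz with rfl | hz
            · exact himg ▸ ⟨s₁, hs₁, rfl⟩
            · rw [mem_singleton_iff.1 hz]; exact himg ▸ ⟨s₂, hs₂, rfl⟩
          rcases hN with rfl | rfl | rfl | hN
          · obtain ⟨s, hs, rfl⟩ := hzN
            rcases hz with hz | hz
            · exact hs.2.ne (hφi hz)
            · exact (hs.2.trans hlt).ne (hφi hz)
          · obtain ⟨s, hs, rfl⟩ := hzN
            rcases hz with hz | hz
            · exact hs.1.ne' (hφi hz)
            · exact hs.2.ne (hφi hz)
          · obtain ⟨s, hs, rfl⟩ := hzN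
            rcases hz with hz | hz
            · exact (hlt.trans hs.1).ne' (hφi hz)
            · exact hs.1.ne' (hφi hz)
          · exact Set.disjoint_left.1 (hout N hN) hze hzN
      · intro hz
        have hzV : z ∈ Vᶜ := fun h => hz (Or.inl h)
        rw [← sUnion_graphEdges] at hzV
        obtain ⟨e', he', hze'⟩ := hzV
        by_cases hee : e' = e
        · subst hee
          obtain ⟨s, hs, rfl⟩ : z ∈ φ '' Ioo 0 1 := himg ▸ hze'
          rcases lt_trichotomy s s₁ with hs' | rfl | hs'
          · exact ⟨A₁, Or.inl rfl, s, ⟨hs.1, hs'⟩, rfl⟩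
          · exact absurd (Or.inr (Or.inl rfl)) hz
          rcases lt_trichotomy s s₂ with hs'' | rfl | hs''
          · exact ⟨A₂, Or.inr (Or.inl rfl), s, ⟨hs', hs''⟩, rfl⟩
          · exact absurd (Or.inr (Or.inr rfl)) hz
          · exact ⟨A₃, Or.inr (Or.inr (Or.inl rfl)), s, ⟨hs'', hs.2⟩, rfl⟩
        · exact ⟨e', Or.inr (Or.inr (Or.inr ⟨he', hee⟩)), hze'⟩
  have hfin0 : (graphEdges V \ {e}).Finite := h.finite_edges.subset sdiff_subset
  rw [hFeq]
  refine ⟨hFo, ((hfin0.insert _).insert _).insert _, ?_⟩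
  rw [hF, ncard_insert_of_notMem ?_ ((hfin0.insert _).insert _),
    ncard_insert_of_notMem ?_ (hfin0.insert _), ncard_insert_of_notMem ?_ hfin0]
  · have := ncard_sdiff_singleton_add_one he h.finite_edges
    omega
  · exact hnot _ h23.2.1.nonempty h23.2.2
  · rintro (h | h)
    exacts [hne23 h, hnot _ h12.2.1.nonempty h12.2.2 h]
  · rintro (h | h | h)
    exacts [hne12 h, hne13 h, hnot _ h01.2.1.nonempty h01.2.2 h]

/-! ### The graph with an attached arc and its recognition -/

section AttachArc

variable (v : W)

lemma AttachArc.continuous_mk : Continuous (AttachArc.mk v) := continuous_quot_mk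

lemma AttachArc.glue : AttachArc.mk v (Sum.inl v) = AttachArc.mk v (Sum.inr 0) :=
  Quot.sound ⟨rfl, rfl⟩

/-- The retraction that collapses the arc. -/
def AttachArc.base : AttachArc v → W :=
  Quot.lift (Sum.elim id (fun _ => v)) (by rintro _ _ ⟨rfl, rfl⟩; rfl)

/-- The position along the arc. -/
def AttachArc.position : AttachArc v → unitInterval :=
  Quot.lift (Sum.elim (fun _ => 0) id) (by rintro _ _ ⟨rfl, rfl⟩; rfl)

lemma AttachArc.continuous_base : Continuous (AttachArc.base v) :=
  continuous_quot_lift _ (by fun_prop)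

lemma AttachArc.continuous_position : Continuous (AttachArc.position v) :=
  continuous_quot_lift _ (by fun_prop)

@[simp] lemma AttachArc.position_inl (w : W) :
    AttachArc.position v (AttachArc.mk v (Sum.inl w)) = 0 := rfl

@[simp] lemma AttachArc.position_inr (s : unitInterval) :
    AttachArc.position v (AttachArc.mk v (Sum.inr s)) = s := rfl

lemma AttachArc.mk_surjective : Function.Surjective (AttachArc.mk v) := Quot.mk_surjective

lemma AttachArc.injective_inl : Function.Injective (fun w => AttachArc.mk v (Sum.inl w)) :=
  Function.LeftInverse.injective (g := AttachArc.base v) fun _ => rfl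

lemma ncard_attachVertices {V : Set W} (hV : V.Finite) {v₁ v₂ : W} (h₁ : v₁ ∉ V) (h₂ : v₂ ∉ V)
    (hne : v₁ ≠ v₂) : (attachVertices V v₁ v₂ v).ncard = V.ncard + 3 := by
  have hfin : (V ∪ {v₁, v₂}).Finite := hV.union (toFinite _)
  rw [attachVertices, union_singleton, ncard_insert_of_notMem ?_ (hfin.image _),
    ncard_image_of_injective _ (AttachArc.injective_inl v), ncard_union_eq ?_ hV (toFinite _),
    ncard_pair hne]
  · rw [Set.disjoint_left]
    rintro a ha (rfl | rfl)
    exacts [h₁ ha, h₂ ha]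
  · rintro ⟨w, -, hw⟩
    have := congrArg (AttachArc.position v) hw
    simp at this

/-- The arc attached at a vertex is one more edge. -/
lemma ncard_graphEdges_attach {V : Set W} (hv : v ∈ V) (ho : ∀ N ∈ graphEdges V, IsOpen N)
    (hfin : (graphEdges V).Finite) :
    (graphEdges ((fun w => AttachArc.mk v (Sum.inl w)) '' V ∪ {AttachArc.mk v (Sum.inr 1)})).ncard
      = (graphEdges V).ncard + 1 := by
  set i : W → AttachArc v := fun w => AttachArc.mk v (Sum.inl w) with hi
  have hic : Continuous i := (AttachArc.continuous_mk v).comp continuous_inl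
  set A : Set (AttachArc v) := (fun s => AttachArc.mk v (Sum.inr s)) '' Ioo 0 1 with hA
  have hAo : IsOpen A := by
    have : A = AttachArc.position v ⁻¹' Ioo 0 1 := by
      ext x
      constructor
      · rintro ⟨s, hs, rfl⟩
        exact hs
      · intro hx
        obtain ⟨w | s, rfl⟩ := AttachArc.mk_surjective v x
        · exact absurd hx.1 (lt_irrefl _)
        · exact ⟨s, hx, rfl⟩
    rw [this]
    exact isOpen_Ioo.preimage (AttachArc.continuous_position v)
  have hAc : IsConnected A := (isConnected_Ioo zero_lt_one).image _
    ((AttachArc.continuous_mk v).comp continuous_inr).continuousOn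
  have hio : ∀ N : Set W, IsOpen N → v ∉ N → IsOpen (i '' N) := by
    intro N hN hvN
    have : i '' N = AttachArc.base v ⁻¹' N := by
      ext x
      constructor
      · rintro ⟨w, hw, rfl⟩
        exact hw
      · intro hx
        obtain ⟨w | s, rfl⟩ := AttachArc.mk_surjective v x
        · exact ⟨w, hx, rfl⟩
        · exact absurd hx hvN
    rw [this]
    exact hN.preimage (AttachArc.continuous_base v)
  have hvN : ∀ N ∈ graphEdges V, v ∉ N := by
    rintro N hN hvN
    have : v ∈ Vᶜ := sUnion_graphEdges V ▸ ⟨N, hN, hvN⟩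
    exact this hv
  have hAi : ∀ N : Set W, Disjoint A (i '' N) := by
    intro N
    rw [Set.disjoint_left]
    rintro _ ⟨s, hs, rfl⟩ ⟨w, -, hw⟩
    have := congrArg (AttachArc.position v) hw
    simp only [hi, AttachArc.position_inl, AttachArc.position_inr] at this
    exact hs.1.ne this
  have heq : graphEdges (i '' V ∪ {AttachArc.mk v (Sum.inr 1)}) =
      insert A ((fun N => i '' N) '' graphEdges V) := by
    refine graphEdges_eq_of_partition ?_ ?_ ?_ ?_
    · rintro _ (rfl | ⟨N, hN, rfl⟩)
      exacts [hAo, hio N (ho N hN) (hvN N hN)]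
    · rintro _ (rfl | ⟨N, hN, rfl⟩)
      exacts [hAc, (isConnected_of_mem_graphEdges hN).image _ hic.continuousOn]
    · refine PairwiseDisjoint.insert ?_ ?_
      · rintro _ ⟨N, hN, rfl⟩ _ ⟨N', hN', rfl⟩ hne
        refine (disjoint_image_iff (AttachArc.injective_inl v)).2
          (pairwiseDisjoint_graphEdges V hN hN' fun h => hne (by rw [h]))
      · rintro _ ⟨N, -, rfl⟩ -
        exact hAi N
    · ext x
      constructor
      · rintro ⟨_, rfl | ⟨N, hN, rfl⟩, hx⟩
        · rintro (⟨w, -, rfl⟩ | hx')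
          · exact Set.disjoint_left.1 (hAi {w}) hx ⟨w, rfl, rfl⟩
          · obtain ⟨s, hs, rfl⟩ := hx
            have := congrArg (AttachArc.position v) (mem_singleton_iff.1 hx')
            simp only [AttachArc.position_inr] at this
            exact hs.2.ne this
        · obtain ⟨w, hw, rfl⟩ := hx
          rintro (⟨w', hw', hww'⟩ | hx')
          · have : w ∈ Vᶜ := sUnion_graphEdges V ▸ ⟨N, hN, hw⟩
            exact this (AttachArc.injective_inl v hww' ▸ hw')
          · have := congrArg (AttachArc.position v) (mem_singleton_iff.1 hx')
            simp [hi] at this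
      · intro hx
        obtain ⟨w | s, rfl⟩ := AttachArc.mk_surjective v x
        · have hw : w ∈ Vᶜ := fun h => hx (Or.inl ⟨w, h, rfl⟩)
          rw [← sUnion_graphEdges] at hw
          obtain ⟨N, hN, hwN⟩ := hw
          exact ⟨_, Or.inr ⟨N, hN, rfl⟩, w, hwN, rfl⟩
        · rcases eq_or_ne s 0 with rfl | hs0
          · exact absurd (Or.inl ⟨v, hv, AttachArc.glue v⟩) hx
          rcases eq_or_ne s 1 with rfl | hs1
          · exact absurd (Or.inr rfl) hx
          exact ⟨A, Or.inl rfl, s, ⟨unitInterval.pos_iff_ne_zero.2 hs0,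
            unitInterval.lt_one_iff_ne_one.2 hs1⟩, rfl⟩
  rw [heq, ncard_insert_of_notMem ?_ (hfin.image _),
    ncard_image_of_injective _ (image_injective.2 (AttachArc.injective_inl v))]
  rintro ⟨N, -, hN⟩
  have := hAi N
  rw [show i '' N = A from hN] at this
  exact hAc.nonempty.ne_empty (disjoint_self.1 this)

lemma ncard_graphEdges_attachVertices {V : Set W} (h : IsFiniteGraph V) {e : Set W}
    (he : e ∈ graphEdges V) {v₁ v₂ : W} (hv₁ : v₁ ∈ e) (hv₂ : v₂ ∈ e) (hne : v₁ ≠ v₂)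
    (hv : v = v₁ ∨ v = v₂) :
    (graphEdges (attachVertices V v₁ v₂ v)).ncard = (graphEdges V).ncard + 3 := by
  obtain ⟨ho, hfin, hcard⟩ := h.subdivide he hv₁ hv₂ hne
  rw [attachVertices, ncard_graphEdges_attach v ?_ ho hfin, hcard]
  rcases hv with rfl | rfl <;> simp

instance [CompactSpace W] : CompactSpace (AttachArc v) :=
  inferInstanceAs (CompactSpace (Quot _))

/-- The space `W'` is the union of an injective image of `W` and an arc meeting it in the image of
`v` alone. -/
structure IsArcAttachment {W' : Type*} [TopologicalSpace W'] (v : W) (ψ : W → W')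
    (a : unitInterval → W') : Prop where
  continuous_map : Continuous ψ
  injective_map : Function.Injective ψ
  continuous_arc : Continuous a
  injective_arc : Function.Injective a
  arc_zero : a 0 = ψ v
  eq_zero_of_eq : ∀ w s, ψ w = a s → s = 0
  cover : ∀ x, x ∈ range ψ ∪ range a

/-- Transports an attachment between planar Reeb spaces to the Reeb spaces of the manifolds, which
are only homeomorphic to them. -/
lemma IsArcAttachment.comp_homeomorph {W' X X' : Type*} [TopologicalSpace W'] [TopologicalSpace X]
    [TopologicalSpace X'] {v : W} {ψ : W → W'} {a : unitInterval → W'} (h : IsArcAttachment v ψ a)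
    (H : X ≃ₜ W) (H' : X' ≃ₜ W') :
    IsArcAttachment (H.symm v) (H'.symm ∘ ψ ∘ H) (H'.symm ∘ a) where
  continuous_map := H'.symm.continuous.comp (h.continuous_map.comp H.continuous)
  injective_map := H'.symm.injective.comp (h.injective_map.comp H.injective)
  continuous_arc := H'.symm.continuous.comp h.continuous_arc
  injective_arc := H'.symm.injective.comp h.injective_arc
  arc_zero := by simp [h.arc_zero]
  eq_zero_of_eq w s hws := h.eq_zero_of_eq _ _ (H'.symm.injective hws)
  cover x := by
    rcases h.cover (H' x) with ⟨w, hw⟩ | ⟨s, hs⟩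
    · exact Or.inl ⟨H.symm w, by simp [hw]⟩
    · exact Or.inr ⟨s, by simp [hs]⟩

/-- The two maps glue to a continuous bijection from the compact space `AttachArc v` to a Hausdorff
space, which is a homeomorphism; no openness has to be checked. -/
lemma IsArcAttachment.graphIsomorphic {W' : Type*} [TopologicalSpace W'] [CompactSpace W]
    [T2Space W'] {v : W} {V : Set W} {V' : Set W'} {v₁ v₂ : W} {ψ : W → W'}
    {a : unitInterval → W'} (h : IsArcAttachment v ψ a)
    (hV : V' = ψ '' (V ∪ {v₁, v₂}) ∪ {a 1}) :
    GraphIsomorphic V' (attachVertices V v₁ v₂ v) := by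
  obtain ⟨hψ, hψi, ha, hai, h0, hd, hcov⟩ := h
  let Φ : AttachArc v → W' := Quot.lift (Sum.elim ψ a) (by rintro _ _ ⟨rfl, rfl⟩; exact h0.symm)
  have hΦ : Continuous Φ := continuous_quot_lift _ (by fun_prop)
  have hinl : ∀ w, Φ (AttachArc.mk v (Sum.inl w)) = ψ w := fun _ => rfl
  have hinr : ∀ s, Φ (AttachArc.mk v (Sum.inr s)) = a s := fun _ => rfl
  have hmix : ∀ w s, ψ w = a s → AttachArc.mk v (Sum.inl w) = AttachArc.mk v (Sum.inr s) := by
    intro w s h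
    have hs := hd w s h
    subst hs
    rw [h0] at h
    rw [hψi h, AttachArc.glue]
  have hbij : Function.Bijective Φ := by
    constructor
    · intro x y hxy
      obtain ⟨w | s, rfl⟩ := AttachArc.mk_surjective v x <;>
      obtain ⟨w' | s', rfl⟩ := AttachArc.mk_surjective v y <;>
      simp only [hinl, hinr] at hxy
      · rw [hψi hxy]
      · exact hmix _ _ hxy
      · exact (hmix _ _ hxy.symm).symm
      · rw [hai hxy]
    · intro x
      rcases hcov x with ⟨w, rfl⟩ | ⟨s, rfl⟩
      exacts [⟨AttachArc.mk v (Sum.inl w), hinl w⟩, ⟨AttachArc.mk v (Sum.inr s), hinr s⟩]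
  let E := Equiv.ofBijective Φ hbij
  have hE : Continuous E := hΦ
  let H : AttachArc v ≃ₜ W' := hE.homeoOfEquivCompactToT2
  have hHΦ : ∀ x, H x = Φ x := fun _ => rfl
  refine ⟨H.symm, ?_⟩
  have : V' = H '' attachVertices V v₁ v₂ v := by
    rw [hV, attachVertices, image_union H, image_singleton, image_image]
    simp only [hHΦ, hinl, hinr]
  rw [this, ← image_comp]
  simp

end AttachArc

lemma graphEdges_image {W' : Type*} [TopologicalSpace W'] (H : W ≃ₜ W') (V : Set W) :
    graphEdges (H '' V) = (fun e => H '' e) '' graphEdges V := by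
  ext e
  constructor
  · rintro ⟨w, hw, rfl⟩
    obtain ⟨z, rfl⟩ := H.surjective w
    have hz : z ∈ Vᶜ := fun h => hw ⟨z, h, rfl⟩
    refine ⟨_, ⟨z, hz, rfl⟩, ?_⟩
    simp only
    rw [H.image_connectedComponentIn hz, image_compl_eq H.bijective]
  · rintro ⟨_, ⟨z, hz, rfl⟩, rfl⟩
    refine ⟨H z, fun ⟨z', hz', h⟩ => hz (H.injective h ▸ hz'), ?_⟩
    simp only
    rw [H.image_connectedComponentIn hz, image_compl_eq H.bijective]

lemma GraphIsomorphic.ncard_eq {W' : Type*} [TopologicalSpace W'] {V : Set W} {V' : Set W'}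
    (h : GraphIsomorphic V V') : (graphEdges V).ncard = (graphEdges V').ncard ∧
      V.ncard = V'.ncard := by
  obtain ⟨H, rfl⟩ := h
  refine ⟨?_, (ncard_image_of_injective _ H.injective).symm⟩
  rw [graphEdges_image, ncard_image_of_injective _ (image_injective.2 H.injective)]

lemma IsFiniteGraph.image {W' : Type*} [TopologicalSpace W'] {V : Set W} (h : IsFiniteGraph V)
    (H : W ≃ₜ W') : IsFiniteGraph (H '' V) where
  t2 := by
    have := h.t2
    exact H.symm.isEmbedding.t2Space
  finite_vertices := h.finite_vertices.image H
  finite_edges := by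
    rw [graphEdges_image]
    exact h.finite_edges.image _
  edge_arc e he := by
    rw [graphEdges_image] at he
    obtain ⟨e, he, rfl⟩ := he
    obtain ⟨φ, hφ, hφi, h0, h1, rfl⟩ := h.edge_arc e he
    exact ⟨H ∘ φ, H.continuous.comp hφ, H.injective.comp hφi, mem_image_of_mem _ h0,
      mem_image_of_mem _ h1, image_comp _ _ _⟩

end GraphOperations

/-! ### Planar compact sets: vertical slices, strips and their classes -/

section PlanarStrips

open Set Topology Filter

/-- The first coordinate on a subset of the plane. -/
def abscissa (K : Set (ℝ × ℝ)) (q : K) : ℝ := (q : ℝ × ℝ).1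

lemma continuous_abscissa (K : Set (ℝ × ℝ)) : Continuous (abscissa K) :=
  continuous_fst.comp continuous_subtype_val

/-- Two points are in the same class exactly when they are the end points of a vertical segment
in `K`. -/
lemma reebMk_abscissa_eq_iff {K : Set (ℝ × ℝ)} (q q' : K) :
    reebMk (abscissa K) q = reebMk (abscissa K) q' ↔
      (q : ℝ × ℝ).1 = (q' : ℝ × ℝ).1 ∧
        ∀ s ∈ uIcc (q : ℝ × ℝ).2 (q' : ℝ × ℝ).2, ((q : ℝ × ℝ).1, s) ∈ K := by
  constructor
  · intro h
    refine ⟨level_eq_of_reebMk_eq (c := abscissa K) h, fun s hs => ?_⟩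
    have hm := (reebMk_eq_iff _ _ _).1 h
    have hp : IsPreconnected ((fun x : K => (x : ℝ × ℝ).2) ''
        connectedComponentIn (abscissa K ⁻¹' {abscissa K q}) q) :=
      isPreconnected_connectedComponentIn.image _ (by fun_prop)
    obtain ⟨x, hx, hxs⟩ := hp.ordConnected.uIcc_subset
      ⟨q, mem_connectedComponentIn rfl, rfl⟩ ⟨q', hm, rfl⟩ hs
    have h1 : (x : ℝ × ℝ).1 = (q : ℝ × ℝ).1 :=
      connectedComponentIn_subset (abscissa K ⁻¹' {abscissa K q}) q hx
    rw [← h1, ← hxs]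
    exact x.2
  · rintro ⟨h1, h2⟩
    let γ : uIcc (q : ℝ × ℝ).2 (q' : ℝ × ℝ).2 → K := fun s => ⟨((q : ℝ × ℝ).1, s), h2 s s.2⟩
    have hγ : Continuous γ := by
      refine Continuous.subtype_mk ?_ _
      fun_prop
    have : PreconnectedSpace (uIcc (q : ℝ × ℝ).2 (q' : ℝ × ℝ).2) :=
      isPreconnected_iff_preconnectedSpace.1 isPreconnected_uIcc
    refine reebMk_eq_of_isPreconnected (isPreconnected_range hγ) ⟨⟨_, left_mem_uIcc⟩, ?_⟩
      ⟨⟨_, right_mem_uIcc⟩, ?_⟩ ?_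
    · exact Subtype.ext rfl
    · exact Subtype.ext (Prod.ext h1 rfl)
    · rintro _ ⟨s, rfl⟩
      rfl

/-- Outside `S`, the set `K` is locally everything or one side of the graph of a continuous
function. -/
def HasRegularSlices (K S : Set (ℝ × ℝ)) : Prop :=
  ∀ q ∈ K, q ∉ S → K ∈ 𝓝 q ∨
    (∃ h : ℝ → ℝ, Continuous h ∧ h q.1 = q.2 ∧ ∀ᶠ x in 𝓝 q, (x ∈ K ↔ x.2 ≤ h x.1)) ∨
    (∃ h : ℝ → ℝ, Continuous h ∧ h q.1 = q.2 ∧ ∀ᶠ x in 𝓝 q, (x ∈ K ↔ h x.1 ≤ x.2))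

/-- In the box `(t - δ, t + δ) × [lo, hi]` the set `K` is the region between two graphs. -/
structure IsStrip (K : Set (ℝ × ℝ)) (t δ lo hi : ℝ) (b T : ℝ → ℝ) : Prop where
  pos : 0 < δ
  continuous_lower : Continuous b
  continuous_upper : Continuous T
  lo_lt : ∀ u, |u - t| < δ → lo < b u
  lower_lt_upper : ∀ u, |u - t| < δ → b u < T u
  lt_hi : ∀ u, |u - t| < δ → T u < hi
  mem_iff : ∀ u y, |u - t| < δ → lo ≤ y → y ≤ hi → ((u, y) ∈ K ↔ b u ≤ y ∧ y ≤ T u)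

/-- The bound in the second coordinate is non-strict, so that such a box and a box with a common
horizontal edge leave no gap. -/
lemma eventually_box {P : ℝ × ℝ → Prop} {t y : ℝ} (h : ∀ᶠ x in 𝓝 (t, y), P x) {r : ℝ}
    (hr : 0 < r) :
    ∃ η, 0 < η ∧ η < r ∧ ∀ u s, |u - t| < η → |s - y| ≤ η → P (u, s) := by
  obtain ⟨ε, hε, hball⟩ := Metric.eventually_nhds_iff.1 h
  refine ⟨min (ε / 2) (r / 2), by positivity, (min_le_right _ _).trans_lt (by linarith), ?_⟩
  intro u s hu hs
  refine hball ?_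
  rw [Prod.dist_eq, max_lt_iff, Real.dist_eq, Real.dist_eq]
  have := min_le_left (ε / 2) (r / 2)
  constructor <;> simp only <;> linarith

/-- The component of the slice through `y₀` is a compact interval `[α, β]` free of `S`. Regularity
makes `K` the region under a graph near its top, the region over a graph near its bottom, and a full
neighbourhood in between. Two boxes at the ends and a tube around the compact middle part fit
together to a strip. -/
lemma exists_strip {K S : Set (ℝ × ℝ)} (hK : IsCompact K) (hS : IsClosed S) (hSK : S ⊆ K)
    (hreg : HasRegularSlices K S) {t y₀ : ℝ} (hq : (t, y₀) ∈ K)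
    (hns : ∀ s, (∀ y ∈ uIcc y₀ s, (t, y) ∈ K) → (t, s) ∉ S) :
    ∃ (δ lo hi : ℝ) (b T : ℝ → ℝ), IsStrip K t δ lo hi b T ∧ b t ≤ y₀ ∧ y₀ ≤ T t ∧
      ∀ x ∈ S, |x.1 - t| < δ → ¬ (lo ≤ x.2 ∧ x.2 ≤ hi) := by
  set F : Set ℝ := {y | (t, y) ∈ K} with hF
  have hFc : IsCompact F := by
    have h1 : IsClosed F := hK.isClosed.preimage (by fun_prop : Continuous fun y : ℝ => (t, y))
    refine (hK.image continuous_snd).of_isClosed_subset h1 fun y hy => ⟨_, hy, rfl⟩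
  have hy₀ : y₀ ∈ F := hq
  set C := connectedComponentIn F y₀ with hC
  have hCF : C ⊆ F := connectedComponentIn_subset _ _
  have hyC : y₀ ∈ C := mem_connectedComponentIn hy₀
  have hCcl : IsClosed C := by
    rw [hC, connectedComponentIn_eq_image hy₀]
    exact hFc.isClosed.isClosedEmbedding_subtypeVal.isClosedMap _ isClosed_connectedComponent
  have hCcomp : IsCompact C := hFc.of_isClosed_subset hCcl hCF
  have hCconn : IsConnected C := isConnected_connectedComponentIn_iff.2 hy₀
  obtain ⟨α, β, hCI⟩ : ∃ α β, C = Icc α β := ⟨_, _, eq_Icc_of_connected_compact hCconn hCcomp⟩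
  have hαβ : α ≤ β := by
    have : y₀ ∈ Icc α β := hCI ▸ hyC
    exact this.1.trans this.2
  have hmax : ∀ a c, a ≤ c → Icc a c ⊆ F → (Icc a c ∩ C).Nonempty → Icc a c ⊆ C := by
    rintro a c hac hsub ⟨z, hz, hzC⟩
    have := isPreconnected_Icc.subset_connectedComponentIn hz hsub
    rwa [← connectedComponentIn_eq hzC] at this
  have hCS : ∀ y ∈ C, (t, y) ∉ S := fun y hy => hns y fun s hs =>
    hCF (hCconn.isPreconnected.ordConnected.uIcc_subset hyC hy hs)
  have hαC : α ∈ C := hCI ▸ left_mem_Icc.2 hαβ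
  have hβC : β ∈ C := hCI ▸ right_mem_Icc.2 hαβ
  -- no point of `C` has a neighbourhood above it inside the slice, unless that is inside `C`
  have hup : ∀ r > 0, ¬ Icc β (β + r) ⊆ F := by
    intro r hr hsub
    have := hmax β (β + r) (by linarith) hsub ⟨β, left_mem_Icc.2 (by linarith), hβC⟩
      (right_mem_Icc.2 (by linarith))
    rw [hCI] at this
    linarith [this.2]
  have hdown : ∀ r > 0, ¬ Icc (α - r) α ⊆ F := by
    intro r hr hsub
    have := hmax (α - r) α (by linarith) hsub ⟨α, right_mem_Icc.2 (by linarith), hαC⟩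
      (left_mem_Icc.2 (by linarith))
    rw [hCI] at this
    linarith [this.1]
  -- Of the three local models at `β`, an interior point and the upper side of a graph would both
  -- prolong the component beyond `β`.
  obtain ⟨T, hTc, hTβ, hT⟩ : ∃ h : ℝ → ℝ, Continuous h ∧ h t = β ∧
      ∀ᶠ x in 𝓝 (t, β), (x ∈ K ↔ x.2 ≤ h x.1) := by
    rcases hreg (t, β) (hCF hβC) (hCS β hβC) with h | h | ⟨h, -, hh, hev⟩
    · exfalso
      obtain ⟨η, hη, -, hbox⟩ := eventually_box (P := fun x => x ∈ K) h one_pos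
      exact hup η hη fun s hs => hbox t s (by simpa using hη)
        (abs_le.2 ⟨by linarith [hs.1], by linarith [hs.2]⟩)
    · exact h
    · exfalso
      obtain ⟨η, hη, -, hbox⟩ := eventually_box hev one_pos
      refine hup η hη fun s hs => (hbox t s (by simpa using hη)
        (abs_le.2 ⟨by linarith [hs.1], by linarith [hs.2]⟩)).2 ?_
      simp only at hh ⊢
      rw [hh]; exact hs.1
  obtain ⟨b, hbc, hbα, hb⟩ : ∃ h : ℝ → ℝ, Continuous h ∧ h t = α ∧
      ∀ᶠ x in 𝓝 (t, α), (x ∈ K ↔ h x.1 ≤ x.2) := by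
    rcases hreg (t, α) (hCF hαC) (hCS α hαC) with h | ⟨h, -, hh, hev⟩ | h
    · exfalso
      obtain ⟨η, hη, -, hbox⟩ := eventually_box (P := fun x => x ∈ K) h one_pos
      exact hdown η hη fun s hs => hbox t s (by simpa using hη)
        (abs_le.2 ⟨by linarith [hs.1], by linarith [hs.2]⟩)
    · exfalso
      obtain ⟨η, hη, -, hbox⟩ := eventually_box hev one_pos
      refine hdown η hη fun s hs => (hbox t s (by simpa using hη)
        (abs_le.2 ⟨by linarith [hs.1], by linarith [hs.2]⟩)).2 ?_
      simp only at hh ⊢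
      rw [hh]; exact hs.2
    · exact h
  have hlt : α < β := by
    refine lt_of_le_of_ne hαβ fun heq => ?_
    obtain ⟨η, hη, -, hbox⟩ := eventually_box hT one_pos
    refine hdown η hη fun s hs => (hbox t s (by simpa using hη)
        (abs_le.2 ⟨by linarith [hs.1], by linarith [hs.2]⟩)).2 ?_
    simp only
    rw [hTβ]; linarith [hs.2]
  -- A one-sided model at an inner point would remove points of the slice just above or just below
  -- it, which belong to `C`.
  have hint : ∀ y, α < y → y < β → K ∈ 𝓝 (t, y) := by
    intro y hαy hyβ
    have hyC' : y ∈ C := hCI ▸ ⟨hαy.le, hyβ.le⟩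
    rcases hreg (t, y) (hCF hyC') (hCS y hyC') with h | ⟨h, -, hh, hev⟩ | ⟨h, -, hh, hev⟩
    · exact h
    · exfalso
      obtain ⟨η, hη, hηr, hbox⟩ := eventually_box hev (sub_pos.2 hyβ)
      have h1 : (t, y + η) ∈ K := hCF (hCI ▸ ⟨by linarith, by linarith⟩)
      have := (hbox t (y + η) (by simpa using hη) (by simp [abs_of_pos hη])).1 h1
      simp only at this hh
      linarith
    · exfalso
      obtain ⟨η, hη, hηr, hbox⟩ := eventually_box hev (sub_pos.2 hαy)
      have h1 : (t, y - η) ∈ K := hCF (hCI ▸ ⟨by linarith, by linarith⟩)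
      have := (hbox t (y - η) (by simpa using hη) (by simp [abs_of_pos hη])).1 h1
      simp only at this hh
      linarith
  -- A third of the length keeps the boxes at the two ends disjoint, which gives `b u < T u` in the
  -- end.
  obtain ⟨η₁, hη₁, hη₁r, hbox₁⟩ := eventually_box hT (show 0 < (β - α) / 3 by linarith)
  obtain ⟨η₂, hη₂, hη₂r, hbox₂⟩ := eventually_box hb (show 0 < (β - α) / 3 by linarith)
  obtain ⟨δ₃, hδ₃, hmid⟩ : ∃ δ > 0, ∀ u y, |u - t| < δ → α + η₂ ≤ y → y ≤ β - η₁ →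
      (u, y) ∈ K := by
    obtain ⟨U, V, hU, -, htU, hV, hUV⟩ := generalized_tube_lemma (isCompact_singleton (x := t))
      (isCompact_Icc (a := α + η₂) (b := β - η₁)) (isOpen_interior (s := K)) (by
        rintro ⟨u, y⟩ ⟨hu, hy⟩
        rw [mem_singleton_iff] at hu
        simp only at hu hy
        subst hu
        exact mem_interior_iff_mem_nhds.2 (hint y (by linarith [hy.1]) (by linarith [hy.2])))
    obtain ⟨δ, hδ, hball⟩ := Metric.isOpen_iff.1 hU t (htU rfl)
    refine ⟨δ, hδ, fun u y hu h1 h2 => interior_subset (hUV ⟨hball ?_, hV ⟨h1, h2⟩⟩)⟩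
    simpa [Real.dist_eq] using hu
  obtain ⟨δ₄, hδ₄, hTb⟩ : ∃ δ > 0, ∀ u, |u - t| < δ →
      (β - η₁ < T u ∧ T u < β + η₁) ∧ (α - η₂ < b u ∧ b u < α + η₂) := by
    have h1 : ∀ᶠ u in 𝓝 t, T u ∈ Ioo (β - η₁) (β + η₁) :=
      hTc.continuousAt.eventually (isOpen_Ioo.mem_nhds (by rw [hTβ]; constructor <;> linarith))
    have h2 : ∀ᶠ u in 𝓝 t, b u ∈ Ioo (α - η₂) (α + η₂) :=
      hbc.continuousAt.eventually (isOpen_Ioo.mem_nhds (by rw [hbα]; constructor <;> linarith))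
    obtain ⟨δ, hδ, hball⟩ := Metric.eventually_nhds_iff.1 (h1.and h2)
    exact ⟨δ, hδ, fun u hu => hball (by simpa [Real.dist_eq] using hu)⟩
  -- The range exceeds `[α, β]`, but points of `S` belong to `K`, and in the end boxes over `t` the
  -- set `K` does not leave `C`, which is free of `S`.
  obtain ⟨δ₅, hδ₅, hS5⟩ : ∃ δ > 0, ∀ u y, |u - t| < δ → α - η₂ ≤ y → y ≤ β + η₁ →
      (u, y) ∉ S := by
    obtain ⟨U, V, hU, -, htU, hV, hUV⟩ := generalized_tube_lemma (isCompact_singleton (x := t))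
      (isCompact_Icc (a := α - η₂) (b := β + η₁)) hS.isOpen_compl (by
        rintro ⟨u, y⟩ ⟨hu, hy⟩ hyS
        rw [mem_singleton_iff] at hu
        simp only at hu hy
        subst hu
        refine hCS y ?_ hyS
        rw [hCI]
        constructor
        · by_contra hlt'
          have := (hbox₂ u y (by simpa using hη₂)
            (abs_le.2 ⟨by linarith [hy.1], by linarith [hy.2]⟩)).1 (hSK hyS)
          simp only [hbα] at this
          linarith
        · by_contra hlt'
          have := (hbox₁ u y (by simpa using hη₁)
            (abs_le.2 ⟨by linarith [hy.1], by linarith [hy.2]⟩)).1 (hSK hyS)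
          simp only [hTβ] at this
          linarith)
    obtain ⟨δ, hδ, hball⟩ := Metric.isOpen_iff.1 hU t (htU rfl)
    refine ⟨δ, hδ, fun u y hu h1 h2 => hUV ⟨hball ?_, hV ⟨h1, h2⟩⟩⟩
    simpa [Real.dist_eq] using hu
  have hy₀I : y₀ ∈ Icc α β := hCI ▸ hyC
  set δ := min (min η₁ η₂) (min δ₃ (min δ₄ δ₅)) with hδdef
  have l1 : δ ≤ η₁ := (min_le_left _ _).trans (min_le_left _ _)
  have l2 : δ ≤ η₂ := (min_le_left _ _).trans (min_le_right _ _)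
  have l3 : δ ≤ δ₃ := (min_le_right _ _).trans (min_le_left _ _)
  have l4 : δ ≤ δ₄ := (min_le_right _ _).trans ((min_le_right _ _).trans (min_le_left _ _))
  have l5 : δ ≤ δ₅ := (min_le_right _ _).trans ((min_le_right _ _).trans (min_le_right _ _))
  refine ⟨δ, α - η₂, β + η₁, b, T,
    ⟨lt_min (lt_min hη₁ hη₂) (lt_min hδ₃ (lt_min hδ₄ hδ₅)), hbc, hTc, ?_, ?_, ?_, ?_⟩,
    hbα ▸ hy₀I.1, hTβ ▸ hy₀I.2, fun x hx hxt hxy =>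
      hS5 x.1 x.2 (hxt.trans_le l5) hxy.1 hxy.2 hx⟩
  · intro u hu
    exact (hTb u (hu.trans_le l4)).2.1
  · intro u hu
    have := hTb u (hu.trans_le l4)
    linarith [this.1.1, this.2.2]
  · intro u hu
    exact (hTb u (hu.trans_le l4)).1.2
  · intro u y hu hlo hhi
    have h4 := hTb u (hu.trans_le l4)
    rcases le_total (β - η₁) y with hy | hy
    · have := hbox₁ u y (hu.trans_le l1) (abs_le.2 ⟨by linarith, by linarith⟩)
      rw [this]
      constructor
      · intro h; exact ⟨by linarith [h4.2.2], h⟩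
      · exact fun h => h.2
    rcases le_total y (α + η₂) with hy' | hy'
    · have := hbox₂ u y (hu.trans_le l2) (abs_le.2 ⟨by linarith, by linarith⟩)
      rw [this]
      constructor
      · intro h; exact ⟨h, by linarith [h4.1.1]⟩
      · exact fun h => h.1
    · have := hmid u y (hu.trans_le l3) hy' hy
      simp only [this, true_iff]
      constructor <;> linarith [h4.1.1, h4.2.2]

/-- The lower end of a slice of a strip belongs to the region. -/
lemma IsStrip.lower_mem {K : Set (ℝ × ℝ)} {t δ lo hi : ℝ} {b T : ℝ → ℝ}
    (h : IsStrip K t δ lo hi b T) {u : ℝ} (hu : |u - t| < δ) : (u, b u) ∈ K :=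
  (h.mem_iff u (b u) hu (h.lo_lt u hu).le
    ((h.lower_lt_upper u hu).trans (h.lt_hi u hu)).le).2 ⟨le_rfl, (h.lower_lt_upper u hu).le⟩

lemma IsStrip.reebMk_eq {K : Set (ℝ × ℝ)} {t δ lo hi : ℝ} {b T : ℝ → ℝ}
    (h : IsStrip K t δ lo hi b T) (q : K) (hu : |(q : ℝ × ℝ).1 - t| < δ)
    (hlo : lo ≤ (q : ℝ × ℝ).2) (hhi : (q : ℝ × ℝ).2 ≤ hi) :
    reebMk (abscissa K) ⟨_, h.lower_mem hu⟩ = reebMk (abscissa K) q := by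
  have hq := (h.mem_iff _ _ hu hlo hhi).1 q.2
  refine (reebMk_abscissa_eq_iff _ _).2 ⟨rfl, fun s hs => ?_⟩
  simp only [uIcc_of_le hq.1] at hs ⊢
  exact (h.mem_iff _ s hu ((h.lo_lt _ hu).le.trans hs.1) (hs.2.trans hhi)).2
    ⟨hs.1, hs.2.trans hq.2⟩

/-- A class that meets a strip is contained in it. -/
lemma IsStrip.mem_of_reebMk_eq {K : Set (ℝ × ℝ)} {t δ lo hi : ℝ} {b T : ℝ → ℝ}
    (h : IsStrip K t δ lo hi b T) {q q' : K} (hu : |(q : ℝ × ℝ).1 - t| < δ)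
    (hlo : lo ≤ (q : ℝ × ℝ).2) (hhi : (q : ℝ × ℝ).2 ≤ hi)
    (hqq : reebMk (abscissa K) q = reebMk (abscissa K) q') :
    (q' : ℝ × ℝ).1 = (q : ℝ × ℝ).1 ∧ lo < (q' : ℝ × ℝ).2 ∧ (q' : ℝ × ℝ).2 < hi := by
  obtain ⟨h1, h2⟩ := (reebMk_abscissa_eq_iff _ _).1 hqq
  refine ⟨h1.symm, ?_, ?_⟩
  · by_contra hn
    have hm := h2 lo (by rw [mem_uIcc]; right; exact ⟨not_lt.1 hn, hlo⟩)
    have := (h.mem_iff _ lo hu le_rfl (hlo.trans hhi)).1 hm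
    linarith [h.lo_lt _ hu]
  · by_contra hn
    have hm := h2 hi (by rw [mem_uIcc]; left; exact ⟨hhi, not_lt.1 hn⟩)
    have := (h.mem_iff _ hi hu (hlo.trans hhi) le_rfl).1 hm
    linarith [h.lt_hi _ hu]

open Classical in
/-- The class of the slice of a strip over `u`. -/
def IsStrip.sliceClass {K : Set (ℝ × ℝ)} {t δ lo hi : ℝ} {b T : ℝ → ℝ}
    (h : IsStrip K t δ lo hi b T) (u : ℝ) : ReebSpace (abscissa K) :=
  if hu : |u - t| < δ then reebMk (abscissa K) ⟨_, h.lower_mem hu⟩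
  else reebMk (abscissa K) ⟨_, h.lower_mem (u := t) (by simpa using h.pos)⟩

lemma IsStrip.sliceClass_eq {K : Set (ℝ × ℝ)} {t δ lo hi : ℝ} {b T : ℝ → ℝ}
    (h : IsStrip K t δ lo hi b T) {u : ℝ} (hu : |u - t| < δ) :
    h.sliceClass u = reebMk (abscissa K) ⟨_, h.lower_mem hu⟩ := by
  simp [IsStrip.sliceClass, hu]

lemma IsStrip.continuousOn_sliceClass {K : Set (ℝ × ℝ)} {t δ lo hi : ℝ} {b T : ℝ → ℝ}
    (h : IsStrip K t δ lo hi b T) : ContinuousOn h.sliceClass (Ioo (t - δ) (t + δ)) := by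
  have hI : ∀ u ∈ Ioo (t - δ) (t + δ), |u - t| < δ := fun u hu =>
    abs_lt.2 ⟨by linarith [hu.1], by linarith [hu.2]⟩
  rw [continuousOn_iff_continuous_domRestrict]
  have : (Ioo (t - δ) (t + δ)).domRestrict h.sliceClass =
      reebMk (abscissa K) ∘ (fun u : Ioo (t - δ) (t + δ) =>
        (⟨_, h.lower_mem (hI u u.2)⟩ : K)) := by
    funext u
    simp [h.sliceClass_eq (hI u u.2)]
  rw [this]
  refine (continuous_reebMk _).comp (Continuous.subtype_mk ?_ _)
  have := h.continuous_lower
  fun_prop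

/-- The strict inequalities at `lo` and `hi` keep a class that meets the box from leaving it. So the
open box is saturated and equals the preimage of the set of slice classes. -/
lemma IsStrip.isOpen_image_sliceClass {K : Set (ℝ × ℝ)} {t δ lo hi : ℝ} {b T : ℝ → ℝ}
    (h : IsStrip K t δ lo hi b T) : IsOpen (h.sliceClass '' Ioo (t - δ) (t + δ)) := by
  have hI : ∀ u, u ∈ Ioo (t - δ) (t + δ) ↔ |u - t| < δ := fun u => by
    rw [abs_lt, mem_Ioo]
    constructor <;> rintro ⟨h1, h2⟩ <;> constructor <;> linarith
  rw [← (isQuotientMap_reebMk _).isOpen_preimage]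
  have : reebMk (abscissa K) ⁻¹' (h.sliceClass '' Ioo (t - δ) (t + δ)) =
      Subtype.val ⁻¹' (Ioo (t - δ) (t + δ) ×ˢ Ioo lo hi) := by
    ext q
    constructor
    · rintro ⟨u, hu, huq⟩
      rw [hI] at hu
      rw [h.sliceClass_eq hu] at huq
      obtain ⟨h1, h2, h3⟩ := h.mem_of_reebMk_eq (q := ⟨_, h.lower_mem hu⟩) hu (h.lo_lt u hu).le
        ((h.lower_lt_upper u hu).trans (h.lt_hi u hu)).le huq
      simp only at h1
      exact ⟨(hI _).2 (h1 ▸ hu), h2, h3⟩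
    · rintro ⟨hu, hy⟩
      refine ⟨_, hu, ?_⟩
      rw [h.sliceClass_eq ((hI _).1 hu)]
      exact h.reebMk_eq q ((hI _).1 hu) hy.1.le hy.2.le
  rw [this]
  exact (isOpen_Ioo.prod isOpen_Ioo).preimage continuous_subtype_val

/-- The Reeb space of a compact set whose slices are regular outside a finite set is a finite
graph. -/
lemma hasLocalSections_of_hasRegularSlices {K S : Set (ℝ × ℝ)} (hK : IsCompact K) (hS : IsClosed S)
    (hSK : S ⊆ K) (hreg : HasRegularSlices K S) :
    HasLocalSections (reebLevel (abscissa K)) (reebMk (abscissa K) '' (Subtype.val ⁻¹' S)) := by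
  intro w hw
  obtain ⟨⟨⟨t, y₀⟩, hq⟩, rfl⟩ := reebMk_surjective _ w
  have hlev : reebLevel (abscissa K) (reebMk (abscissa K) ⟨(t, y₀), hq⟩) = t := rfl
  rw [hlev]
  obtain ⟨δ, lo, hi, b, T, hst, hb, hT, hSs⟩ := exists_strip hK hS hSK hreg hq (by
    intro s hs hsS
    exact hw ⟨⟨_, hSK hsS⟩, hsS, (reebMk_abscissa_eq_iff _ _).2
      ⟨rfl, by simpa [uIcc_comm] using hs⟩⟩)
  have hI : ∀ u, u ∈ Ioo (t - δ) (t + δ) ↔ |u - t| < δ := fun u => by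
    rw [abs_lt, mem_Ioo]
    constructor <;> rintro ⟨h1, h2⟩ <;> constructor <;> linarith
  have ht : |t - t| < δ := by simpa using hst.pos
  refine ⟨δ, hst.pos, hst.sliceClass, hst.continuousOn_sliceClass, ?_, hst.isOpen_image_sliceClass, ?_, ?_⟩
  · intro u hu
    rw [hst.sliceClass_eq ((hI u).1 hu)]
    rfl
  · refine ⟨t, (hI t).2 ht, ?_⟩
    rw [hst.sliceClass_eq ht]
    exact hst.reebMk_eq ⟨(t, y₀), hq⟩ ht ((hst.lo_lt t ht).le.trans hb)
      (hT.trans (hst.lt_hi t ht).le)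
  · rintro _ ⟨u, hu, rfl⟩ ⟨x, hx, hxu⟩
    rw [hI] at hu
    rw [hst.sliceClass_eq hu] at hxu
    obtain ⟨h1, h2, h3⟩ := hst.mem_of_reebMk_eq (q := ⟨_, hst.lower_mem hu⟩) hu (hst.lo_lt u hu).le
        ((hst.lower_lt_upper u hu).trans (hst.lt_hi u hu)).le hxu.symm
    simp only at h1
    exact hSs x hx (h1 ▸ hu) ⟨h2.le, h3.le⟩

lemma compactSpace_reebSpace {X : Type*} [TopologicalSpace X] [CompactSpace X] (c : X → ℝ) :
    CompactSpace (ReebSpace c) :=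
  inferInstanceAs (CompactSpace (Quotient _))

lemma separatesLevels_reebLevel {X : Type*} [TopologicalSpace X] [CompactSpace X] [T2Space X]
    {c : X → ℝ} (hc : Continuous c) : SeparatesLevels (reebLevel c) :=
  fun w w' hne hl => exists_separation_of_level_eq hc w w' hne hl

lemma isFiniteGraph_of_hasRegularSlices {K S : Set (ℝ × ℝ)} (hK : IsCompact K) (hS : S.Finite)
    (hSK : S ⊆ K) (hreg : HasRegularSlices K S) :
    IsFiniteGraph (reebMk (abscissa K) '' (Subtype.val ⁻¹' S)) := by
  have : CompactSpace K := isCompact_iff_compactSpace.1 hK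
  have := compactSpace_reebSpace (abscissa K)
  have := t2Space_reebSpace (continuous_abscissa K)
  exact (hasLocalSections_of_hasRegularSlices hK hS.isClosed hSK hreg).isFiniteGraph
    (continuous_reebLevel (continuous_abscissa K))
    (separatesLevels_reebLevel (continuous_abscissa K))
    ((hS.preimage Subtype.val_injective.injOn).image _)

end PlanarStrips

/-! ### Removal of a small disc at the upper boundary of a strip -/

section PlanarSurgery

open Set Topology Filter

/-- The increasing curve `y = T u` through the origin meets the circle of radius `ε` in one point
on each side. -/
lemma exists_crossings {T : ℝ → ℝ} (hT : Continuous T) (h0 : T 0 = 0) {R ε : ℝ} (hε : 0 < ε)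
    (hεR : ε < R) (hmono : StrictMonoOn T (Ioo (-R) R)) :
    ∃ xl xr : ℝ, (-ε < xl ∧ xl < 0) ∧ (0 < xr ∧ xr < ε) ∧ T xl < 0 ∧ 0 < T xr ∧
      xl ^ 2 + T xl ^ 2 = ε ^ 2 ∧ xr ^ 2 + T xr ^ 2 = ε ^ 2 ∧
      (∀ u, |u| < R → u ^ 2 + T u ^ 2 = ε ^ 2 → u = xl ∨ u = xr) ∧
      (∀ u, 0 < u → u < R → (ε ^ 2 ≤ u ^ 2 + T u ^ 2 ↔ xr ≤ u)) := by
  set E : ℝ → ℝ := fun u => u ^ 2 + T u ^ 2 with hE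
  have hEc : Continuous E := by fun_prop
  have h0m : (0 : ℝ) ∈ Ioo (-R) R := ⟨by linarith, by linarith⟩
  have hpos : ∀ u, 0 < u → u < R → 0 < T u := fun u h1 h2 => by
    have := hmono h0m ⟨by linarith, h2⟩ h1
    rwa [h0] at this
  have hneg : ∀ u, u < 0 → -R < u → T u < 0 := fun u h1 h2 => by
    have := hmono ⟨h2, by linarith⟩ h0m h1
    rwa [h0] at this
  -- The squared distance `E` from the origin to the curve increases strictly away from `0` on both
  -- sides. As `E 0 = 0` and `E` exceeds `ε ^ 2` at `ε` and at `-ε`, each side has exactly one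
  -- crossing, strictly within distance `ε`.
  have hinc : ∀ u u', 0 < u → u < u' → u' < R → E u < E u' := fun u u' h1 h2 h3 => by
    have ha := hpos u h1 (by linarith)
    have hb := hmono ⟨by linarith, by linarith⟩ ⟨by linarith, h3⟩ h2
    simp only [hE]
    nlinarith
  have hdec : ∀ u u', u < u' → u' < 0 → -R < u → E u' < E u := fun u u' h1 h2 h3 => by
    have ha := hneg u' h2 (by linarith)
    have hb := hmono ⟨by linarith, by linarith⟩ ⟨by linarith, by linarith⟩ h1
    simp only [hE]
    nlinarith
  have hE0 : E 0 = 0 := by simp [hE, h0]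
  have hεε : 0 < ε ^ 2 := by positivity
  have hEε : ε ^ 2 < E ε := by
    have := hpos ε hε hεR
    simp only [hE]; nlinarith
  have hEε' : ε ^ 2 < E (-ε) := by
    have := hneg (-ε) (by linarith) (by linarith)
    simp only [hE]; nlinarith
  obtain ⟨xr, hxr, hEr⟩ := intermediate_value_Icc hε.le hEc.continuousOn
    (show ε ^ 2 ∈ Icc (E 0) (E ε) from ⟨by rw [hE0]; exact hεε.le, hEε.le⟩)
  obtain ⟨xl, hxl, hEl⟩ := intermediate_value_Icc' (show -ε ≤ 0 by linarith) hEc.continuousOn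
    (show ε ^ 2 ∈ Icc (E 0) (E (-ε)) from ⟨by rw [hE0]; exact hεε.le, hEε'.le⟩)
  have hxr0 : 0 < xr := lt_of_le_of_ne hxr.1 fun h => by
    rw [← h, hE0] at hEr; exact hεε.ne hEr
  have hxrε : xr < ε := lt_of_le_of_ne hxr.2 fun h => by
    rw [h] at hEr; exact hEε.ne' hEr
  have hxl0 : xl < 0 := lt_of_le_of_ne hxl.2 fun h => by
    rw [h, hE0] at hEl; exact hεε.ne hEl
  have hxlε : -ε < xl := lt_of_le_of_ne hxl.1 fun h => by
    rw [← h] at hEl; exact hEε'.ne' hEl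
  refine ⟨xl, xr, ⟨hxlε, hxl0⟩, ⟨hxr0, hxrε⟩, hneg xl hxl0 (by linarith),
    hpos xr hxr0 (by linarith), hEl, hEr, ?_, ?_⟩
  · intro u hu hEu
    rw [abs_lt] at hu
    rcases lt_trichotomy u 0 with h | rfl | h
    · left
      rcases lt_trichotomy u xl with h' | h' | h'
      · have := hdec u xl h' hxl0 hu.1
        simp only [hE] at this hEl; linarith
      · exact h'
      · have := hdec xl u h' h (by linarith)
        simp only [hE] at this hEl; linarith
    · exact absurd (hE0.symm.trans hEu) hεε.ne
    · right
      rcases lt_trichotomy u xr with h' | h' | h'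
      · have := hinc u xr h h' (by linarith)
        simp only [hE] at this hEr; linarith
      · exact h'
      · have := hinc xr u hxr0 h' hu.2
        simp only [hE] at this hEr; linarith
  · intro u h1 h2
    constructor
    · intro h
      by_contra hlt
      have := hinc u xr h1 (not_le.1 hlt) (by linarith)
      simp only [hE] at this hEr; linarith
    · intro h
      rcases h.eq_or_lt with rfl | h'
      · exact hEr.ge
      · have := hinc xr u hxr0 h' h2
        simp only [hE] at this hEr; linarith

/-- The part of `K` outside the open disc of radius `ε` around the origin. -/
def removeDisc (K : Set (ℝ × ℝ)) (ε : ℝ) : Set (ℝ × ℝ) := {x ∈ K | ε ^ 2 ≤ x.1 ^ 2 + x.2 ^ 2}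

/-- Removing a small disc centred at a point where the upper boundary of a strip is increasing
attaches an arc to the Reeb space. -/
lemma exists_arcAttachment_removeDisc {K S : Set (ℝ × ℝ)} {R lo hi ε : ℝ} {b T : ℝ → ℝ}
    (hst : IsStrip K 0 R lo hi b T) (hε : 0 < ε) (hεR : ε < R) (hεhi : ε < hi)
    (hb : ∀ u, |u| < R → b u < -ε) (h0 : T 0 = 0)
    (hmono : StrictMonoOn T (Ioo (-R) R))
    (hS : ∀ x ∈ S, |x.1| < R → ¬ (lo ≤ x.2 ∧ x.2 ≤ hi)) {xl xr : ℝ}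
    (hxl : -ε < xl ∧ xl < 0) (hxr : 0 < xr ∧ xr < ε) (hTl : T xl < 0)
    (hEl : xl ^ 2 + T xl ^ 2 = ε ^ 2) (hEr : xr ^ 2 + T xr ^ 2 = ε ^ 2)
    (hside : ∀ u, 0 < u → u < R → (ε ^ 2 ≤ u ^ 2 + T u ^ 2 ↔ xr ≤ u)) :
    ∃ (ψ : ReebSpace (abscissa K) → ReebSpace (abscissa (removeDisc K ε)))
      (a : unitInterval → ReebSpace (abscissa (removeDisc K ε))),
      IsArcAttachment (hst.sliceClass ε) ψ a ∧
      reebMk (abscissa (removeDisc K ε)) ''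
          (Subtype.val ⁻¹' (S ∪ {(xl, T xl), (xr, T xr), (ε, 0)})) =
        ψ '' (reebMk (abscissa K) '' (Subtype.val ⁻¹' S) ∪
          {hst.sliceClass xl, hst.sliceClass ε}) ∪ {a 1} := by
  classical
  set K' := removeDisc K ε with hK'
  have hst0 : ∀ u, |u| < R → |u - 0| < R := fun u hu => by simpa using hu
  have hR0 : |(0 : ℝ)| < R := by simpa using hst.pos
  have hlo : lo < -ε := (hst.lo_lt 0 (hst0 0 hR0)).trans (hb 0 hR0)
  have h0m : (0 : ℝ) ∈ Ioo (-R) R := ⟨by linarith, by linarith⟩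
  have hpos : ∀ u, 0 < u → u < R → 0 < T u := fun u h1 h2 => by
    have := hmono h0m ⟨by linarith, h2⟩ h1
    rwa [h0] at this
  have hneg : ∀ u, u ≤ 0 → -R < u → T u ≤ 0 := fun u h1 h2 => by
    have := hmono.monotoneOn ⟨h2, by linarith⟩ h0m h1
    rwa [h0] at this
  -- the part of the strip outside the disc
  have hlow : ∀ {u}, |u| < R → (u, b u) ∈ K' := fun {u} hu =>
    ⟨hst.lower_mem (hst0 u hu), by simp only; nlinarith [hb u hu, sq_nonneg u]⟩
  have hin : ∀ q : ℝ × ℝ, q ∈ K → q ∉ K' → |q.1| < ε ∧ |q.2| < ε := by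
    intro q hq hq'
    have : q.1 ^ 2 + q.2 ^ 2 < ε ^ 2 := by
      by_contra h
      exact hq' ⟨hq, not_lt.1 h⟩
    exact ⟨abs_lt_of_sq_lt_sq (by nlinarith [sq_nonneg q.2]) hε.le,
      abs_lt_of_sq_lt_sq (by nlinarith [sq_nonneg q.1]) hε.le⟩
  set St : Set (ℝ × ℝ) := {q | |q.1| < R ∧ lo < q.2 ∧ q.2 < hi} with hSt
  have hout : ∀ q ∈ K, q ∉ St → q ∈ K' := by
    intro q hq hqS
    by_contra h
    obtain ⟨h1, h2⟩ := hin q hq h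
    rw [abs_lt] at h2
    exact hqS ⟨h1.trans hεR, by linarith, by linarith⟩
  have hmemSt : ∀ {u y}, (u, y) ∈ K → |u| < R → lo < y → y < hi → b u ≤ y ∧ y ≤ T u :=
    fun {u y} hq hu h1 h2 => (hst.mem_iff u y (hst0 u hu) h1.le h2.le).1 hq
  have hsub : K' ⊆ K := fun x hx => hx.1
  -- the map on points
  let r : K → K' := fun q => if h : (q : ℝ × ℝ) ∈ St then ⟨((q : ℝ × ℝ).1, b (q : ℝ × ℝ).1), hlow h.1⟩
    else ⟨q, hout q q.2 h⟩
  have hr_in : ∀ (q : K) (h : (q : ℝ × ℝ) ∈ St), r q = ⟨((q : ℝ × ℝ).1, b (q : ℝ × ℝ).1), hlow h.1⟩ :=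
    fun q h => dif_pos h
  have hr_out : ∀ (q : K) (h : (q : ℝ × ℝ) ∉ St), r q = ⟨q, hout q q.2 h⟩ :=
    fun q h => dif_neg h
  have hr1 : ∀ q : K, ((r q : K') : ℝ × ℝ).1 = (q : ℝ × ℝ).1 := by
    intro q
    by_cases h : (q : ℝ × ℝ) ∈ St
    · rw [hr_in q h]
    · rw [hr_out q h]
  have hStclass : ∀ {q q' : K}, (q : ℝ × ℝ) ∈ St →
      reebMk (abscissa K) q = reebMk (abscissa K) q' → (q' : ℝ × ℝ) ∈ St := by
    intro q q' hq hqq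
    obtain ⟨h1, h2, h3⟩ := hst.mem_of_reebMk_eq (hst0 _ hq.1) hq.2.1.le hq.2.2.le hqq
    exact ⟨h1 ▸ hq.1, h2, h3⟩
  -- points below the disc or beside it are in the class of the lower end
  have hlowclass : ∀ (q : K') (hq : (q : ℝ × ℝ) ∈ St), ε ≤ |(q : ℝ × ℝ).1| ∨ (q : ℝ × ℝ).2 ≤ 0 →
      reebMk (abscissa K') ⟨((q : ℝ × ℝ).1, b (q : ℝ × ℝ).1), hlow hq.1⟩ =
        reebMk (abscissa K') q := by
    rintro ⟨⟨u, y⟩, hqK, hqε⟩ hq h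
    simp only at hqε h hq ⊢
    have hby := hmemSt hqK hq.1 hq.2.1 hq.2.2
    refine (reebMk_abscissa_eq_iff _ _).2 ⟨rfl, fun s hs => ?_⟩
    simp only [uIcc_of_le hby.1] at hs ⊢
    refine ⟨(hst.mem_iff u s (hst0 u hq.1) ((hst.lo_lt u (hst0 u hq.1)).le.trans hs.1)
      (hs.2.trans hq.2.2.le)).2 ⟨hs.1, hs.2.trans hby.2⟩, ?_⟩
    simp only
    rcases h with h | h
    · have := sq_le_sq' (by linarith [abs_nonneg u]) h
      rw [sq_abs] at this
      nlinarith [sq_nonneg s]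
    · nlinarith [hs.2]
  have hsame : ∀ q q' : K, reebMk (abscissa K) q = reebMk (abscissa K) q' →
      reebMk (abscissa K') (r q) = reebMk (abscissa K') (r q') := by
    intro q q' hqq
    have h1 := ((reebMk_abscissa_eq_iff _ _).1 hqq).1
    by_cases h : (q : ℝ × ℝ) ∈ St
    · have h' := hStclass h hqq
      rw [hr_in q h, hr_in q' h']
      congr 1
      exact Subtype.ext (Prod.ext h1 (by simp only [h1]))
    · have h' : (q' : ℝ × ℝ) ∉ St := fun h' => h (hStclass h' hqq.symm)
      rw [hr_out q h, hr_out q' h']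
      refine (reebMk_abscissa_eq_iff _ _).2 ⟨h1, fun s hs => ?_⟩
      have hsK := ((reebMk_abscissa_eq_iff _ _).1 hqq).2 s hs
      refine hout _ hsK fun hsS => h ?_
      refine hStclass (q := ⟨_, hsK⟩) hsS ((reebMk_abscissa_eq_iff _ _).2 ⟨rfl, fun s' hs' => ?_⟩)
      refine ((reebMk_abscissa_eq_iff _ _).1 hqq).2 s' ?_
      exact uIcc_subset_uIcc_left hs (by rwa [uIcc_comm])
  let ψ : ReebSpace (abscissa K) → ReebSpace (abscissa K') :=
    Quotient.lift (fun q => reebMk (abscissa K') (r q)) fun q q' h => hsame q q' (Quotient.sound h)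
  have hψ : ∀ q, ψ (reebMk (abscissa K) q) = reebMk (abscissa K') (r q) := fun _ => rfl
  have hψc : Continuous ψ := by
    refine Continuous.quotient_lift ?_ _
    rw [continuous_iff_continuousAt]
    intro q
    by_cases hq : (q : ℝ × ℝ) ∈ St
    · have hSto : IsOpen St := by
        have : St = (fun q : ℝ × ℝ => |q.1|) ⁻¹' Iio R ∩ Prod.snd ⁻¹' Ioo lo hi := by
          ext; simp [hSt]
        rw [this]
        exact (isOpen_Iio.preimage (by fun_prop)).inter (isOpen_Ioo.preimage continuous_snd)
      have hSto' : IsOpen ((Subtype.val : K → ℝ × ℝ) ⁻¹' St) := hSto.preimage continuous_subtype_val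
      have hc : ContinuousOn (fun q : K => reebMk (abscissa K') (r q)) (Subtype.val ⁻¹' St) := by
        rw [continuousOn_iff_continuous_domRestrict]
        have : (Subtype.val ⁻¹' St).domRestrict (fun q : K => reebMk (abscissa K') (r q)) =
            reebMk (abscissa K') ∘ fun x : ((Subtype.val : K → ℝ × ℝ) ⁻¹' St) =>
              (⟨(((x : K) : ℝ × ℝ).1, b ((x : K) : ℝ × ℝ).1), hlow x.2.1⟩ : K') := by
          funext x
          simp only [Set.domRestrict, Function.comp]
          rw [hr_in x x.2]
        rw [this]
        refine (continuous_reebMk _).comp (Continuous.subtype_mk ?_ _)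
        have := hst.continuous_lower
        fun_prop
      exact hc.continuousAt (hSto'.mem_nhds hq)
    -- Off this box around the disc, `r q` and `q` have the same class by `hlowclass`, even inside
    -- the strip. So near a point outside the strip the map is induced by the identity.
    · set O : Set (ℝ × ℝ) := {x | |x.1| ≤ ε ∧ lo ≤ x.2 ∧ x.2 ≤ hi}ᶜ with hO
      have hOo : IsOpen O := by
        have : IsClosed {x : ℝ × ℝ | |x.1| ≤ ε ∧ lo ≤ x.2 ∧ x.2 ≤ hi} := by
          exact (isClosed_le (f := fun x : ℝ × ℝ => |x.1|) (by fun_prop) continuous_const).inter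
            ((isClosed_le continuous_const continuous_snd).inter
              (isClosed_le continuous_snd continuous_const))
        exact this.isOpen_compl
      have hqO : (q : ℝ × ℝ) ∈ O := by
        rintro ⟨h1, h2, h3⟩
        have hu : |(q : ℝ × ℝ).1| < R := h1.trans_lt hεR
        have := (hst.mem_iff _ _ (hst0 _ hu) h2 h3).1 q.2
        exact hq ⟨hu, (hst.lo_lt _ (hst0 _ hu)).trans_le this.1,
          this.2.trans_lt (hst.lt_hi _ (hst0 _ hu))⟩
      have hOK : ∀ x ∈ O, x ∈ K → x ∈ K' := by
        intro x hx hxK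
        by_contra h
        obtain ⟨h1, h2⟩ := hin x hxK h
        rw [abs_lt] at h2
        exact hx ⟨h1.le, by linarith, by linarith⟩
      have hO' : IsOpen ((Subtype.val : K → ℝ × ℝ) ⁻¹' O) := hOo.preimage continuous_subtype_val
      have hc : ContinuousOn (fun q : K => reebMk (abscissa K') (r q)) (Subtype.val ⁻¹' O) := by
        rw [continuousOn_iff_continuous_domRestrict]
        have : (Subtype.val ⁻¹' O).domRestrict (fun q : K => reebMk (abscissa K') (r q)) =
            reebMk (abscissa K') ∘ fun x : ((Subtype.val : K → ℝ × ℝ) ⁻¹' O) =>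
              (⟨((x : K) : ℝ × ℝ), hOK _ x.2 x.1.2⟩ : K') := by
          funext x
          simp only [Set.domRestrict, Function.comp]
          by_cases hx : ((x : K) : ℝ × ℝ) ∈ St
          · rw [hr_in x hx]
            refine hlowclass ⟨_, hOK _ x.2 x.1.2⟩ hx (Or.inl ?_)
            by_contra h
            exact x.2 ⟨(not_le.1 h).le, hx.2.1.le, hx.2.2.le⟩
          · rw [hr_out x hx]
        rw [this]
        refine (continuous_reebMk _).comp (Continuous.subtype_mk ?_ _)
        fun_prop
      exact hc.continuousAt (hO'.mem_nhds hqO)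
  -- inclusion of `K'` in `K` is compatible with the classes
  have hincl : ∀ q q' : K', reebMk (abscissa K') q = reebMk (abscissa K') q' →
      reebMk (abscissa K) ⟨q, hsub q.2⟩ = reebMk (abscissa K) ⟨q', hsub q'.2⟩ := by
    intro q q' h
    obtain ⟨h1, h2⟩ := (reebMk_abscissa_eq_iff _ _).1 h
    exact (reebMk_abscissa_eq_iff _ _).2 ⟨h1, fun s hs => hsub (h2 s hs)⟩
  have hrK : ∀ q : K, reebMk (abscissa K) ⟨r q, hsub (r q).2⟩ = reebMk (abscissa K) q := by
    intro q
    by_cases h : (q : ℝ × ℝ) ∈ St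
    · have := hst.reebMk_eq q (hst0 _ h.1) h.2.1.le h.2.2.le
      rw [← this]
      congr 1
      exact Subtype.ext (by rw [hr_in q h])
    · congr 1
      exact Subtype.ext (by rw [hr_out q h])
  -- The inclusion of `K'` in `K` maps classes into classes and undoes `r` up to class, so it gives
  -- a left inverse of `ψ`.
  have hψi : Function.Injective ψ := by
    intro w w' hww
    obtain ⟨q, rfl⟩ := reebMk_surjective _ w
    obtain ⟨q', rfl⟩ := reebMk_surjective _ w'
    rw [← hrK q, ← hrK q']
    exact hincl _ _ hww
  -- the arc
  let x : unitInterval → ℝ := fun s => ε + s * (xr - ε)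
  have hx0 : x 0 = ε := by simp [x]
  have hx1 : x 1 = xr := by simp [x]
  have hxm : ∀ s, xr ≤ x s ∧ x s ≤ ε := fun s => by
    have h1 : (0 : ℝ) ≤ s := s.2.1
    have h2 : (s : ℝ) ≤ 1 := s.2.2
    constructor <;> simp only [x] <;> nlinarith [hxr.2]
  have hxR : ∀ s, |x s| < R := fun s => abs_lt.2 ⟨by linarith [(hxm s).1], by linarith [(hxm s).2]⟩
  have hupK : ∀ {u}, |u| < R → (u, T u) ∈ K := fun {u} hu =>
    (hst.mem_iff u (T u) (hst0 u hu) ((hst.lo_lt u (hst0 u hu)).trans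
      (hst.lower_lt_upper u (hst0 u hu))).le (hst.lt_hi u (hst0 u hu)).le).2
      ⟨(hst.lower_lt_upper u (hst0 u hu)).le, le_rfl⟩
  have hupSt : ∀ {u}, |u| < R → (u, T u) ∈ St := fun {u} hu =>
    ⟨hu, (hst.lo_lt u (hst0 u hu)).trans (hst.lower_lt_upper u (hst0 u hu)),
      hst.lt_hi u (hst0 u hu)⟩
  have hxK : ∀ s, (x s, T (x s)) ∈ K' := fun s => ⟨hupK (hxR s),
    (hside (x s) (hxr.1.trans_le (hxm s).1) ((hxm s).2.trans_lt hεR)).2 (hxm s).1⟩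
  -- The classes of the pieces above the disc, from abscissa `ε`, where the pieces above and below
  -- join at the right pole, back to `xr`, where the upper piece shrinks to the corner.
  let a : unitInterval → ReebSpace (abscissa K') := fun s =>
    reebMk (abscissa K') ⟨(x s, T (x s)), hxK s⟩
  have hac : Continuous a := by
    refine (continuous_reebMk _).comp (Continuous.subtype_mk ?_ _)
    have := hst.continuous_upper
    have : Continuous x := by fun_prop
    fun_prop
  have hai : Function.Injective a := by
    intro s s' hss
    have h1 := ((reebMk_abscissa_eq_iff _ _).1 hss).1
    simp only [x] at h1
    have h2 : (s : ℝ) * (xr - ε) = s' * (xr - ε) := by linarith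
    exact Subtype.ext (mul_right_cancel₀ (by linarith [hxr.2] : xr - ε ≠ 0) h2)
  have hslice : ∀ {u} (hu : |u| < R), ψ (hst.sliceClass u) =
      reebMk (abscissa K') ⟨(u, b u), hlow hu⟩ := by
    intro u hu
    rw [hst.sliceClass_eq (hst0 u hu), hψ]
    congr 1
    have : (u, b u) ∈ St := ⟨hu, hst.lo_lt u (hst0 u hu),
      (hst.lower_lt_upper u (hst0 u hu)).trans (hst.lt_hi u (hst0 u hu))⟩
    exact hr_in ⟨(u, b u), _⟩ this
  have hεabs : |ε| < R := by rwa [abs_of_pos hε]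
  have ha0 : a 0 = ψ (hst.sliceClass ε) := by
    rw [hslice hεabs]
    have := hlowclass ⟨(x 0, T (x 0)), hxK 0⟩ (hupSt (hxR 0))
      (Or.inl (by simp only [hx0]; exact le_abs_self ε))
    simp only [a]
    rw [← this]
    congr 1
    simp [hx0]
  -- For `s > 0` the abscissa `x s` is less than `ε`, and a vertical segment from the lower end to
  -- the upper piece would pass through `(x s, 0)`, which lies in the removed disc.
  have hmeet : ∀ w s, ψ w = a s → s = 0 := by
    intro w s hws
    obtain ⟨q, rfl⟩ := reebMk_surjective _ w
    rw [hψ] at hws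
    obtain ⟨h1, h2⟩ := (reebMk_abscissa_eq_iff _ _).1 hws
    rw [hr1] at h1
    simp only at h1
    by_contra hs
    have hxlt : x s < ε := by
      have : 0 < (s : ℝ) := lt_of_le_of_ne s.2.1 fun h => hs (Subtype.ext h.symm)
      simp only [x]; nlinarith [hxr.2]
    have hqSt : (q : ℝ × ℝ) ∈ St := by
      have h3 := hincl _ _ hws
      rw [hrK] at h3
      exact hStclass (q := ⟨(x s, T (x s)), hsub (hxK s)⟩) (hupSt (hxR s)) h3.symm
    have h4 := h2 0 (by
      rw [hr_in q hqSt, mem_uIcc]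
      left
      have hq := hb _ hqSt.1
      exact ⟨by simp only; linarith,
        (hpos (x s) (hxr.1.trans_le (hxm s).1) ((hxm s).2.trans_lt hεR)).le⟩)
    have h5 := h4.2
    simp only [hr1, h1] at h5
    nlinarith [(hxm s).1, hxr.1]
  have hcov : ∀ y, y ∈ range ψ ∪ range a := by
    intro y
    obtain ⟨q, rfl⟩ := reebMk_surjective _ y
    by_cases hq : (q : ℝ × ℝ) ∈ St
    · by_cases hl : ε ≤ |(q : ℝ × ℝ).1| ∨ (q : ℝ × ℝ).2 ≤ 0
      · left
        exact ⟨hst.sliceClass (q : ℝ × ℝ).1, by rw [hslice hq.1, hlowclass q hq hl]⟩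
      · right
        obtain ⟨⟨u, z⟩, hqK, hqε⟩ := q
        simp only [not_or, not_le] at hl hq hqε
        have hbz := hmemSt hqK hq.1 hq.2.1 hq.2.2
        rw [abs_lt] at hl
        -- A remaining point with `|u| < ε` and positive height lies above the disc. This is
        -- impossible for `u ≤ 0`, where `T u ≤ 0`; for `u > 0` the curve is above it as well, so
        -- `xr ≤ u`.
        have hu0 : 0 < u := by
          by_contra hu
          have := hneg u (not_lt.1 hu) (by linarith [hl.1.1])
          linarith [hl.2, hbz.2]
        have hxu : xr ≤ u := (hside u hu0 (by linarith [hl.1.2])).1 (by nlinarith [hbz.2, hl.2])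
        have hxε : xr - ε < 0 := by linarith [hxr.2]
        refine ⟨⟨(u - ε) / (xr - ε), div_nonneg_of_nonpos (by linarith [hl.1.2]) hxε.le,
          (div_le_one_of_neg hxε).2 (by linarith)⟩, ?_⟩
        have hxs : x ⟨(u - ε) / (xr - ε), div_nonneg_of_nonpos (by linarith [hl.1.2]) hxε.le,
          (div_le_one_of_neg hxε).2 (by linarith)⟩ = u := by
          simp only [x]
          rw [div_mul_cancel₀ _ hxε.ne]; ring
        refine (reebMk_abscissa_eq_iff _ _).2 ⟨hxs, fun s hs => ?_⟩
        simp only [hxs] at hs ⊢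
        rw [uIcc_comm, uIcc_of_le hbz.2] at hs
        refine ⟨(hst.mem_iff u s (hst0 u hq.1) (hq.2.1.le.trans hs.1)
          (hs.2.trans (hst.lt_hi u (hst0 u hq.1)).le)).2 ⟨hbz.1.trans hs.1, hs.2⟩, ?_⟩
        simp only
        nlinarith [hs.1, hl.2]
    · left
      exact ⟨reebMk (abscissa K) ⟨q, hsub q.2⟩, by rw [hψ, hr_out ⟨q, hsub q.2⟩ hq]⟩
  refine ⟨ψ, a, ⟨hψc, hψi, hac, hai, ha0, hmeet, hcov⟩, ?_⟩
  have hxlR : |xl| < R := abs_lt.2 ⟨by linarith, by linarith⟩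
  have hlK : (xl, T xl) ∈ K' := ⟨hupK hxlR, hEl.ge⟩
  have hrK' : (xr, T xr) ∈ K' := ⟨hupK (abs_lt.2 ⟨by linarith, by linarith⟩), hEr.ge⟩
  have hTε := hpos ε hε hεR
  have hpSt : (ε, (0 : ℝ)) ∈ St := ⟨hεabs, by simp only; linarith, by simp only; linarith⟩
  have hpK : (ε, (0 : ℝ)) ∈ K' := by
    refine ⟨(hst.mem_iff ε 0 (hst0 ε hεabs) (by linarith) (by linarith)).2
      ⟨by linarith [hb ε hεabs], hTε.le⟩, ?_⟩
    simp
  -- The left corner has negative height and the right pole has height `0`, so both are joined to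
  -- lower ends and become the two vertices on the old edge. The right corner is the free end of the
  -- arc.
  have e1 : ψ (hst.sliceClass xl) = reebMk (abscissa K') ⟨_, hlK⟩ := by
    rw [hslice hxlR]
    exact hlowclass ⟨_, hlK⟩ (hupSt hxlR) (Or.inr hTl.le)
  have e2 : ψ (hst.sliceClass ε) = reebMk (abscissa K') ⟨_, hpK⟩ := by
    rw [hslice hεabs]
    exact hlowclass ⟨_, hpK⟩ hpSt (Or.inr le_rfl)
  have e3 : a 1 = reebMk (abscissa K') ⟨_, hrK'⟩ := by
    simp only [a]
    congr 1
    exact Subtype.ext (by simp only [hx1])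
  have e4 : ∀ (q : K) (hq : (q : ℝ × ℝ) ∈ S), (q : ℝ × ℝ) ∉ St := fun q hq hqS =>
    hS _ hq hqS.1 ⟨hqS.2.1.le, hqS.2.2.le⟩
  rw [image_union, image_pair, e1, e2, e3]
  ext y
  constructor
  · rintro ⟨q, hq | hq | hq | hq, rfl⟩
    · refine Or.inl (Or.inl ⟨_, ⟨⟨q, hsub q.2⟩, hq, rfl⟩, ?_⟩)
      rw [hψ, hr_out _ (e4 ⟨q, hsub q.2⟩ hq)]
    · exact Or.inl (Or.inr (Or.inl (congrArg _ (Subtype.ext hq))))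
    · exact Or.inr (congrArg _ (Subtype.ext hq))
    · exact Or.inl (Or.inr (Or.inr (congrArg _ (Subtype.ext hq))))
  · rintro ((⟨_, ⟨q, hq, rfl⟩, rfl⟩ | rfl | rfl) | rfl)
    · rw [hψ, hr_out _ (e4 q hq)]
      exact ⟨⟨q, hout q q.2 (e4 q hq)⟩, Or.inl hq, rfl⟩
    · exact ⟨⟨_, hlK⟩, Or.inr (Or.inl rfl), rfl⟩
    · exact ⟨⟨_, hpK⟩, Or.inr (Or.inr (Or.inr rfl)), rfl⟩
    · exact ⟨⟨_, hrK'⟩, Or.inr (Or.inr (Or.inl rfl)), rfl⟩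

end PlanarSurgery

/-! ### Transversality and the local shape of an admissible region -/

namespace CircleData

open Set Topology Filter

variable {l₁ l₂ : ℕ} (A : CircleData l₁ l₂)

/-- The sign of `f_j` outside the circle. -/
def sgn (j : Fin l₁) : ℝ := if A.inside j then -1 else 1

lemma sgn_mul_sgn (j : Fin l₁) : A.sgn j * A.sgn j = 1 := by
  unfold sgn; split_ifs <;> norm_num

lemma sgn_ne_zero (j : Fin l₁) : A.sgn j ≠ 0 := by
  unfold sgn; split_ifs <;> norm_num

lemma sgn_eq (j : Fin l₁) : A.sgn j = 1 ∨ A.sgn j = -1 := by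
  unfold sgn; split_ifs <;> simp

lemma f_eq (j : Fin l₁) (x : Plane) : A.f j x =
    A.sgn j * ((x 0 - A.center j 0) ^ 2 + (x 1 - A.center j 1) ^ 2 - A.radius j ^ 2) := by
  unfold f poly sgn
  split_ifs <;> simp [Fin.sum_univ_two]

lemma continuous_f (j : Fin l₁) : Continuous (A.f j) := by
  rw [show A.f j = fun x => A.f j x from rfl]
  simp only [f_eq]
  fun_prop

lemma f_eq_zero_iff (j : Fin l₁) (x : Plane) : A.f j x = 0 ↔
    (x 0 - A.center j 0) ^ 2 + (x 1 - A.center j 1) ^ 2 = A.radius j ^ 2 := by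
  rw [f_eq, mul_eq_zero, or_iff_right (A.sgn_ne_zero j), sub_eq_zero]

lemma mem_circle_iff {j : Fin l₁} (hr : 0 < A.radius j) (x : Plane) :
    x ∈ A.circle j ↔ A.f j x = 0 := by
  rw [f_eq_zero_iff, circle, mem_sphere_iff_norm, EuclideanSpace.norm_eq,
    Real.sqrt_eq_iff_mul_self_eq (by positivity) hr.le]
  simp [Fin.sum_univ_two]
  constructor <;> intro h <;> linarith

/-- The determinant of the gradients of two circles. -/
def det (j k : Fin l₁) (x : Plane) : ℝ :=
  (x 0 - A.center j 0) * (x 1 - A.center k 1) - (x 1 - A.center j 1) * (x 0 - A.center k 0)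

/-- At most two circles pass through `x`, with independent gradients. -/
def TransverseAt (x : Plane) : Prop :=
  (∀ j k, j ≠ k → A.f j x = 0 → A.f k x = 0 → A.det j k x ≠ 0) ∧
    ∀ j k l, j ≠ k → j ≠ l → k ≠ l → A.f j x = 0 → A.f k x = 0 → A.f l x ≠ 0

lemma mem_tangentLine_iff (j : Fin l₁) (x v : Plane) : v ∈ A.tangentLine j x ↔
    (x 0 - A.center j 0) * v 0 + (x 1 - A.center j 1) * v 1 = 0 := by
  rw [tangentLine, Submodule.mem_orthogonal_singleton_iff_inner_right, PiLp.inner_apply]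
  simp [Fin.sum_univ_two, mul_comm]

lemma plane_eq_zero_iff (v : Plane) : v = 0 ↔ v 0 = 0 ∧ v 1 = 0 := by
  constructor
  · rintro rfl; simp
  · rintro ⟨h0, h1⟩
    ext i; fin_cases i <;> simpa

lemma tangentLine_inf_eq_bot_iff {j k : Fin l₁} {x : Plane} (hj : x ≠ A.center j) :
    A.tangentLine j x ⊓ A.tangentLine k x = ⊥ ↔ A.det j k x ≠ 0 := by
  constructor
  · intro h hd
    have hv : (!₂[-(x 1 - A.center j 1), x 0 - A.center j 0] : Plane) ∈
        A.tangentLine j x ⊓ A.tangentLine k x := by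
      rw [Submodule.mem_inf, mem_tangentLine_iff, mem_tangentLine_iff]
      unfold det at hd
      simp
      constructor <;> linarith
    rw [h, Submodule.mem_bot, plane_eq_zero_iff] at hv
    simp at hv
    apply hj
    ext i; fin_cases i <;> simp <;> linarith
  · intro hd
    rw [eq_bot_iff]
    intro v hv
    rw [Submodule.mem_inf, mem_tangentLine_iff, mem_tangentLine_iff] at hv
    rw [Submodule.mem_bot, plane_eq_zero_iff]
    obtain ⟨h1, h2⟩ := hv
    constructor
    · refine (mul_eq_zero.1 (?_ : A.det j k x * v 0 = 0)).resolve_left hd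
      unfold det
      linear_combination (x 1 - A.center k 1) * h1 - (x 1 - A.center j 1) * h2
    · refine (mul_eq_zero.1 (?_ : A.det j k x * v 1 = 0)).resolve_left hd
      unfold det
      linear_combination (x 0 - A.center j 0) * h2 - (x 0 - A.center k 0) * h1

lemma ne_center {j : Fin l₁} (hr : 0 < A.radius j) {x : Plane} (hx : A.f j x = 0) :
    x ≠ A.center j := by
  rintro rfl
  rw [f_eq_zero_iff] at hx
  simp at hx
  exact (pow_pos hr 2).ne hx

/-- In the plane the dimension condition is automatic for one circle, says that the gradients are
independent for two, and fails for three or more. The determinant form suits explicit computations.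
-/
lemma transverse_iff (hr : ∀ j, 0 < A.radius j) :
    (∀ J : Finset (Fin l₁), J.Nonempty → ∀ p ∈ (⋂ j ∈ J, A.circle j) ∩ closure A.D,
      Module.finrank ℝ (⨅ j ∈ J, A.tangentLine j p : Submodule ℝ Plane) + J.card = 2) ↔
    ∀ x ∈ closure A.D, A.TransverseAt x := by
  have hmem : ∀ (J : Finset (Fin l₁)) (p : Plane),
      (p ∈ ⋂ j ∈ J, A.circle j) ↔ ∀ j ∈ J, A.f j p = 0 := by
    intro J p
    simp only [mem_iInter]
    exact forall₂_congr fun j _ => A.mem_circle_iff (hr j) p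
  constructor
  · intro h x hx
    refine ⟨fun j k hjk hj hk => ?_, fun j k l hjk hjl hkl hj hk hl => ?_⟩
    · have := h {j, k} ⟨j, by simp⟩ x ⟨(hmem _ _).2 (by simp [hj, hk]), hx⟩
      rw [Finset.card_pair hjk, Finset.iInf_insert, Finset.iInf_singleton] at this
      exact (A.tangentLine_inf_eq_bot_iff (A.ne_center (hr j) hj)).1
        (Submodule.finrank_eq_zero.1 (by omega))
    · have := h {j, k, l} ⟨j, by simp⟩ x ⟨(hmem _ _).2 (by simp [hj, hk, hl]), hx⟩
      rw [Finset.card_eq_three.2 ⟨j, k, l, hjk, hjl, hkl, rfl⟩] at this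
      omega
  · rintro h J hJ p ⟨hp, hpD⟩
    rw [hmem] at hp
    have hT := h p hpD
    have hle : J.card ≤ 2 := by
      by_contra hlt
      obtain ⟨j, k, l, hj, hk, hl, hjk, hjl, hkl⟩ := Finset.two_lt_card_iff.1 (not_le.1 hlt)
      exact hT.2 j k l hjk hjl hkl (hp j hj) (hp k hk) (hp l hl)
    have hpos : 0 < J.card := hJ.card_pos
    obtain h1 | h2 : J.card = 1 ∨ J.card = 2 := by omega
    · obtain ⟨j, rfl⟩ := Finset.card_eq_one.1 h1
      rw [h1, Finset.iInf_singleton]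
      have : Fact (Module.finrank ℝ Plane = 1 + 1) := ⟨by simp⟩
      have hne : p - A.center j ≠ 0 := sub_ne_zero.2 (A.ne_center (hr j) (hp j (by simp)))
      rw [tangentLine, Submodule.finrank_orthogonal_span_singleton (n := 1) hne]
    · obtain ⟨j, k, hjk, rfl⟩ := Finset.card_eq_two.1 h2
      have hj := hp j (by simp)
      have hk := hp k (by simp)
      rw [h2, Finset.iInf_insert, Finset.iInf_singleton,
        (A.tangentLine_inf_eq_bot_iff (A.ne_center (hr j) hj)).2 (hT.1 j k hjk hj hk)]
      simp

/-- The gradients of the circles through `x` can be prescribed on a vector. -/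
lemma TransverseAt.exists_vector {x : Plane} (h : A.TransverseAt x) (hr : ∀ j, 0 < A.radius j)
    (a : Fin l₁ → ℝ) : ∃ v : Plane, ∀ j, A.f j x = 0 →
      (x 0 - A.center j 0) * v 0 + (x 1 - A.center j 1) * v 1 = a j := by
  by_cases h2 : ∃ j k, j ≠ k ∧ A.f j x = 0 ∧ A.f k x = 0
  · obtain ⟨j, k, hjk, hj, hk⟩ := h2
    have hd := h.1 j k hjk hj hk
    refine ⟨!₂[(a j * (x 1 - A.center k 1) - a k * (x 1 - A.center j 1)) / A.det j k x,
      ((x 0 - A.center j 0) * a k - (x 0 - A.center k 0) * a j) / A.det j k x], fun l hl => ?_⟩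
    obtain rfl | rfl : l = j ∨ l = k := by
      by_contra hn
      rw [not_or] at hn
      exact h.2 j k l hjk (Ne.symm hn.1) (Ne.symm hn.2) hj hk hl
    · simp
      field_simp
      unfold det
      ring
    · simp
      field_simp
      unfold det
      ring
  · by_cases h1 : ∃ j, A.f j x = 0
    · obtain ⟨j, hj⟩ := h1
      have hr2 : A.radius j ^ 2 ≠ 0 := by have := hr j; positivity
      refine ⟨!₂[a j / A.radius j ^ 2 * (x 0 - A.center j 0),
        a j / A.radius j ^ 2 * (x 1 - A.center j 1)], fun l hl => ?_⟩
      obtain rfl : l = j := by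
        by_contra hn
        exact h2 ⟨l, j, hn, hl, hj⟩
      rw [f_eq_zero_iff] at hj
      have : ∀ s t : ℝ, s * (a l / A.radius l ^ 2 * s) + t * (a l / A.radius l ^ 2 * t) =
          a l / A.radius l ^ 2 * (s ^ 2 + t ^ 2) := fun s t => by ring
      simp [this, hj, hr2]
    · exact ⟨0, fun j hj => absurd ⟨j, hj⟩ h1⟩

lemma f_add_smul (j : Fin l₁) (y v : Plane) (t : ℝ) : A.f j (y + t • v) = A.f j y +
    t * (A.sgn j * (2 * ((y 0 - A.center j 0) * v 0 + (y 1 - A.center j 1) * v 1)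
      + t * (v 0 ^ 2 + v 1 ^ 2))) := by
  simp only [f_eq, PiLp.add_apply, PiLp.smul_apply, smul_eq_mul]
  ring

/-- Near a transverse point, the region `{f_j ≥ 0}` is the closure of `{f_j > 0}`. -/
lemma TransverseAt.eventually_mem_closure {x : Plane} (h : A.TransverseAt x)
    (hr : ∀ j, 0 < A.radius j) {U : Set Plane} (hU : IsOpen U) (hx : x ∈ U) :
    ∀ᶠ y in 𝓝 x, (∀ j, 0 ≤ A.f j y) → y ∈ closure (U ∩ {z | ∀ j, 0 < A.f j z}) := by
  -- The gradient of `f_j` is `2 * sgn j` times the vector from the centre, so pairing that vector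
  -- with `v` to `sgn j` makes all vanishing `f_j` grow along `v`. Moving a little along `v` from
  -- any nearby point with all `f_j ≥ 0` enters the open region.
  obtain ⟨v, hv⟩ := h.exists_vector A hr A.sgn
  have hev : ∀ᶠ y in 𝓝 x, ∀ j, (A.f j x = 0 →
      0 < A.sgn j * ((y 0 - A.center j 0) * v 0 + (y 1 - A.center j 1) * v 1)) ∧
      (A.f j x ≠ 0 → A.f j y ≠ 0) := by
    rw [eventually_all]
    intro j
    by_cases hj : A.f j x = 0
    · have hc : Continuous fun y : Plane =>
          A.sgn j * ((y 0 - A.center j 0) * v 0 + (y 1 - A.center j 1) * v 1) := by fun_prop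
      have : 0 < A.sgn j * ((x 0 - A.center j 0) * v 0 + (x 1 - A.center j 1) * v 1) := by
        rw [hv j hj, sgn_mul_sgn]; exact one_pos
      filter_upwards [hc.continuousAt.eventually (lt_mem_nhds this)] with y hy
      exact ⟨fun _ => hy, fun h => absurd hj h⟩
    · filter_upwards [(A.continuous_f j).continuousAt.eventually_ne hj] with y hy
      exact ⟨fun h => absurd h hj, fun _ => hy⟩
  filter_upwards [hev, hU.mem_nhds hx] with y hy hyU hnn
  have hc : Continuous fun t : ℝ => y + t • v := by fun_prop
  have ht : Tendsto (fun t : ℝ => y + t • v) (𝓝[>] 0) (𝓝 y) := by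
    have := (hc.tendsto 0).mono_left (nhdsWithin_le_nhds (s := Ioi (0 : ℝ)))
    simpa using this
  refine mem_closure_of_tendsto ht ?_
  have hall : ∀ᶠ t in 𝓝[>] (0 : ℝ), ∀ j, 0 < A.f j (y + t • v) := by
    rw [eventually_all]
    intro j
    by_cases hj : A.f j x = 0
    · have h1 := (hy j).1 hj
      have hc2 : Continuous fun t : ℝ => A.sgn j * (2 * ((y 0 - A.center j 0) * v 0 +
        (y 1 - A.center j 1) * v 1) + t * (v 0 ^ 2 + v 1 ^ 2)) := by fun_prop
      have h2 : 0 < A.sgn j * (2 * ((y 0 - A.center j 0) * v 0 +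
        (y 1 - A.center j 1) * v 1) + 0 * (v 0 ^ 2 + v 1 ^ 2)) := by linarith
      filter_upwards [(hc2.continuousAt.eventually (lt_mem_nhds h2)).filter_mono
        nhdsWithin_le_nhds, self_mem_nhdsWithin] with t ht ht0
      rw [f_add_smul]
      have := mul_pos (show 0 < t from ht0) ht
      linarith [hnn j]
    · have h1 : 0 < A.f j y := lt_of_le_of_ne (hnn j) (Ne.symm ((hy j).2 hj))
      exact ht.eventually ((A.continuous_f j).continuousAt.eventually (lt_mem_nhds h1))
  filter_upwards [hall, ht.eventually (hU.mem_nhds hyU)] with t h1 h2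
  exact ⟨h2, h1⟩

variable {A}

lemma IsAdmissible.transverseAt (hA : A.IsAdmissible) {x : Plane} (hx : x ∈ closure A.D) :
    A.TransverseAt x :=
  (A.transverse_iff hA.radius_pos).1 hA.transverse x hx

lemma IsAdmissible.exists_open (hA : A.IsAdmissible) : ∃ U, IsOpen U ∧ closure A.D ⊆ U ∧
    A.D = U ∩ {x | ∀ j, 0 < A.f j x} := by
  obtain ⟨U, hU, hDU, h⟩ := hA.eq_inter
  exact ⟨U, hU, hDU, h U hU hDU le_rfl⟩

lemma IsAdmissible.f_pos (hA : A.IsAdmissible) {x : Plane} (hx : x ∈ A.D) (j : Fin l₁) :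
    0 < A.f j x := by
  obtain ⟨U, -, -, h⟩ := hA.exists_open
  rw [h] at hx
  exact hx.2 j

lemma IsAdmissible.mem_of_f_pos (hA : A.IsAdmissible) {x : Plane} (hx : x ∈ closure A.D)
    (h : ∀ j, 0 < A.f j x) : x ∈ A.D := by
  obtain ⟨U, -, hDU, h'⟩ := hA.exists_open
  rw [h']
  exact ⟨hDU hx, h⟩

lemma IsAdmissible.f_nonneg (hA : A.IsAdmissible) {x : Plane} (hx : x ∈ closure A.D)
    (j : Fin l₁) : 0 ≤ A.f j x := by
  have : closure A.D ⊆ {x | 0 ≤ A.f j x} :=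
    closure_minimal (fun y hy => (hA.f_pos hy j).le) (isClosed_le continuous_const (A.continuous_f j))
  exact this hx

lemma IsAdmissible.exists_f_eq_zero (hA : A.IsAdmissible) {x : Plane} (hx : x ∈ closure A.D)
    (h : x ∉ A.D) : ∃ j, A.f j x = 0 := by
  by_contra hn
  push Not at hn
  exact h (hA.mem_of_f_pos hx fun j => lt_of_le_of_ne (hA.f_nonneg hx j) (hn j).symm)

lemma IsAdmissible.eventually_mem_closure (hA : A.IsAdmissible) {x : Plane}
    (hx : x ∈ closure A.D) : ∀ᶠ y in 𝓝 x, (∀ j, 0 ≤ A.f j y) → y ∈ closure A.D := by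
  obtain ⟨U, hU, hDU, h⟩ := hA.exists_open
  have := (hA.transverseAt hx).eventually_mem_closure A hA.radius_pos hU (hDU hx)
  rwa [← h] at this

lemma IsAdmissible.cls_ne (hA : A.IsAdmissible) {x : Plane} (hx : x ∈ closure A.D)
    {j k : Fin l₁} (hjk : j ≠ k) (hj : A.f j x = 0) (hk : A.f k x = 0) : A.cls j ≠ A.cls k := by
  intro h
  refine hjk (hA.cls_injOn {j, k} ⟨j, by simp⟩ ⟨x, ?_, hx⟩ (by simp) (by simp) h)
  simp [mem_circle_iff, hA.radius_pos, hj, hk]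

variable (A) in
/-- The product of the polynomials of a class. -/
def classProd (i : Fin l₂) (x : Plane) : ℝ := ∏ j with A.cls j = i, A.f j x

variable (A) in
/-- The product of the polynomials in the class of `j` other than `f_j`. -/
def cofactor (j : Fin l₁) (x : Plane) : ℝ :=
  ∏ k ∈ (Finset.univ.filter fun k => A.cls k = A.cls j).erase j, A.f k x

lemma classProd_eq (j : Fin l₁) (x : Plane) :
    A.classProd (A.cls j) x = A.f j x * A.cofactor j x :=
  (Finset.mul_prod_erase _ (fun k => A.f k x) (by simp)).symm

lemma continuous_cofactor (j : Fin l₁) : Continuous (A.cofactor j) :=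
  continuous_finsetProd _ fun k _ => A.continuous_f k

lemma continuous_classProd (i : Fin l₂) : Continuous (A.classProd i) :=
  continuous_finsetProd _ fun k _ => A.continuous_f k

/-- Circles through a common point of `closure D` have distinct classes, so no second factor of the
class product vanishes at `x`. Near a boundary point the class product thus has the sign of a single
`f_j`. -/
lemma IsAdmissible.cofactor_pos (hA : A.IsAdmissible) {x : Plane} (hx : x ∈ closure A.D)
    {j : Fin l₁} (hj : A.f j x = 0) : 0 < A.cofactor j x := by
  refine Finset.prod_pos fun k hk => ?_
  rw [Finset.mem_erase, Finset.mem_filter] at hk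
  refine lt_of_le_of_ne (hA.f_nonneg hx k) fun h => ?_
  exact hA.cls_ne hx hk.1 h.symm hj hk.2.2

lemma IsAdmissible.classProd_nonneg (hA : A.IsAdmissible) {x : Plane} (hx : x ∈ closure A.D)
    (i : Fin l₂) : 0 ≤ A.classProd i x :=
  Finset.prod_nonneg fun j _ => hA.f_nonneg hx j

/-- Dividing by the positive cofactors recovers `f_j ≥ 0` for the circles through `x`; the other
`f_j` stay positive near `x`. This is why the zero set of the moment system has no points near
`closure D` but off it. -/
lemma IsAdmissible.eventually_mem_closure_of_classProd (hA : A.IsAdmissible) {x : Plane}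
    (hx : x ∈ closure A.D) : ∀ᶠ y in 𝓝 x, (∀ i, 0 ≤ A.classProd i y) → y ∈ closure A.D := by
  have hev : ∀ᶠ y in 𝓝 x, ∀ j, (A.f j x = 0 → 0 < A.cofactor j y) ∧
      (A.f j x ≠ 0 → 0 < A.f j y) := by
    rw [eventually_all]
    intro j
    by_cases hj : A.f j x = 0
    · filter_upwards [(continuous_cofactor j).continuousAt.eventually
        (lt_mem_nhds (hA.cofactor_pos hx hj))] with y hy
      exact ⟨fun _ => hy, fun h => absurd hj h⟩
    · filter_upwards [(A.continuous_f j).continuousAt.eventually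
        (lt_mem_nhds (lt_of_le_of_ne (hA.f_nonneg hx j) (Ne.symm hj)))] with y hy
      exact ⟨fun h => absurd h hj, fun _ => hy⟩
  filter_upwards [hev, hA.eventually_mem_closure hx] with y hy hcl hprod
  refine hcl fun j => ?_
  by_cases hj : A.f j x = 0
  · have h1 := hprod (A.cls j)
    rw [classProd_eq] at h1
    exact nonneg_of_mul_nonneg_left h1 ((hy j).1 hj)
  · exact ((hy j).2 hj).le

lemma IsAdmissible.exists_open_classProd (hA : A.IsAdmissible) :
    ∃ U, IsOpen U ∧ closure A.D ⊆ U ∧ ∀ y ∈ U, (∀ i, 0 ≤ A.classProd i y) → y ∈ closure A.D :=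
  ⟨interior {y | (∀ i, 0 ≤ A.classProd i y) → y ∈ closure A.D}, isOpen_interior,
    fun _ hx => mem_interior_iff_mem_nhds.2 (hA.eventually_mem_closure_of_classProd hx),
    fun _ hy => interior_subset hy⟩

variable (A) in
/-- The points of `closure D` over which the singular points lie: the corners and the vertical
poles. -/
def sing : Set Plane := {x | x ∈ closure A.D ∧ ((∃ j k, j ≠ k ∧ A.f j x = 0 ∧ A.f k x = 0) ∨
  ∃ j, A.f j x = 0 ∧ x 1 = A.center j 1)}

lemma finite_circle_inter {c c' : Plane} (hc : c ≠ c') (r r' : ℝ) :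
    (Metric.sphere c r ∩ Metric.sphere c' r').Finite := by
  by_cases h : ∃ p q, p ≠ q ∧ p ∈ Metric.sphere c r ∩ Metric.sphere c' r' ∧
      q ∈ Metric.sphere c r ∩ Metric.sphere c' r'
  · obtain ⟨p, q, hpq, hp, hq⟩ := h
    refine (toFinite {p, q}).subset fun x hx => ?_
    exact EuclideanGeometry.eq_of_dist_eq_of_dist_eq_of_finrank_eq_two (by simp) hc hpq
      hp.1 hq.1 hx.1 hp.2 hq.2 hx.2
  · push Not at h
    refine Set.Subsingleton.finite fun x hx y hy => ?_
    by_contra hxy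
    exact h x y hxy hx hy

/-- Circles that cross transversely are not concentric, since otherwise `det` would vanish, and so
have at most two common points. A point at the height of the centre is one of two vertical poles. -/
lemma IsAdmissible.finite_sing (hA : A.IsAdmissible) : A.sing.Finite := by
  have h1 : (⋃ (j : Fin l₁) (k : Fin l₁), {x | x ∈ A.circle j ∩ A.circle k ∧
      A.center j ≠ A.center k}).Finite := by
    refine finite_iUnion fun j => finite_iUnion fun k => ?_
    by_cases h : A.center j = A.center k
    · simp [h]
    · exact (finite_circle_inter h _ _).subset fun x hx => hx.1
  have h2 : (⋃ j : Fin l₁, ({!₂[A.center j 0 + A.radius j, A.center j 1],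
      !₂[A.center j 0 - A.radius j, A.center j 1]} : Set Plane)).Finite :=
    finite_iUnion fun j => toFinite _
  refine (h1.union h2).subset ?_
  rintro x ⟨hx, ⟨j, k, hjk, hj, hk⟩ | ⟨j, hj, hx1⟩⟩
  · left
    simp only [mem_iUnion]
    refine ⟨j, k, ⟨(A.mem_circle_iff (hA.radius_pos j) x).2 hj,
      (A.mem_circle_iff (hA.radius_pos k) x).2 hk⟩, fun h => ?_⟩
    refine (hA.transverseAt hx).1 j k hjk hj hk ?_
    unfold det
    rw [h]; ring
  · right
    simp only [mem_iUnion]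
    refine ⟨j, ?_⟩
    rw [f_eq_zero_iff, hx1] at hj
    have : (x 0 - A.center j 0 - A.radius j) * (x 0 - A.center j 0 + A.radius j) = 0 := by
      linear_combination hj
    rcases mul_eq_zero.1 this with h | h
    · left
      ext i; fin_cases i
      · simp; linarith
      · simpa using hx1
    · right
      ext i; fin_cases i
      · simp; linarith
      · simpa using hx1

/-- The affine chart of the plane with origin `p` and first axis scaled by `σ`. -/
def planeChart (σ : ℝ) (p : Plane) (q : ℝ × ℝ) : Plane := !₂[p 0 + σ * q.1, p 1 + q.2]

@[simp] lemma planeChart_zero (σ : ℝ) (p : Plane) (q : ℝ × ℝ) :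
    planeChart σ p q 0 = p 0 + σ * q.1 := rfl

@[simp] lemma planeChart_one (σ : ℝ) (p : Plane) (q : ℝ × ℝ) :
    planeChart σ p q 1 = p 1 + q.2 := rfl

lemma continuous_planeChart (σ : ℝ) (p : Plane) : Continuous (planeChart σ p) := by
  unfold planeChart
  fun_prop

lemma injective_planeChart {σ : ℝ} (hσ : σ * σ = 1) (p : Plane) :
    Function.Injective (planeChart σ p) := by
  intro q q' h
  have h0 := congrArg (fun x : Plane => x 0) h
  have h1 := congrArg (fun x : Plane => x 1) h
  simp only [planeChart_zero, planeChart_one, add_right_inj] at h0 h1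
  have hσ0 : σ ≠ 0 := by rintro rfl; simp at hσ
  exact Prod.ext (mul_left_cancel₀ hσ0 h0) h1

/-- The inverse of `planeChart` when `σ = ±1`. -/
def planeCoord (σ : ℝ) (p x : Plane) : ℝ × ℝ := (σ * (x 0 - p 0), x 1 - p 1)

lemma continuous_planeCoord (σ : ℝ) (p : Plane) : Continuous (planeCoord σ p) := by
  unfold planeCoord
  fun_prop

lemma planeChart_planeCoord {σ : ℝ} (hσ : σ * σ = 1) (p x : Plane) :
    planeChart σ p (planeCoord σ p x) = x := by
  ext i; fin_cases i
  · change p 0 + σ * (σ * (x 0 - p 0)) = x 0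
    linear_combination (x 0 - p 0) * hσ
  · change p 1 + (x 1 - p 1) = x 1
    ring

lemma planeCoord_planeChart {σ : ℝ} (hσ : σ * σ = 1) (p : Plane) (q : ℝ × ℝ) :
    planeCoord σ p (planeChart σ p q) = q :=
  injective_planeChart hσ p (planeChart_planeCoord hσ p _)

variable (A) in
/-- The closure of `D` in the coordinates given by `planeChart`. -/
def chartRegion (σ : ℝ) (p : Plane) : Set (ℝ × ℝ) := planeChart σ p ⁻¹' closure A.D

variable (A) in
/-- The set `A.sing` in the coordinates given by `planeChart`. -/
def chartSing (σ : ℝ) (p : Plane) : Set (ℝ × ℝ) := planeChart σ p ⁻¹' A.sing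

lemma IsAdmissible.isCompact_chartRegion (hA : A.IsAdmissible) {σ : ℝ} (hσ : σ * σ = 1)
    (p : Plane) : IsCompact (A.chartRegion σ p) := by
  have : A.chartRegion σ p = planeCoord σ p '' closure A.D := by
    ext q
    constructor
    · intro hq
      exact ⟨_, hq, planeCoord_planeChart hσ p q⟩
    · rintro ⟨x, hx, rfl⟩
      change planeChart σ p (planeCoord σ p x) ∈ closure A.D
      rwa [planeChart_planeCoord hσ]
  rw [this]
  exact hA.isCompact_closure.image (continuous_planeCoord σ p)

/-- Near a point of exactly one circle, membership in `closure D` is decided by that circle. -/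
lemma IsAdmissible.eventually_mem_closure_iff (hA : A.IsAdmissible) {x : Plane}
    (hx : x ∈ closure A.D) {j : Fin l₁} (huniq : ∀ k, A.f k x = 0 → k = j) :
    ∀ᶠ y in 𝓝 x, (y ∈ closure A.D ↔ 0 ≤ A.f j y) ∧ ∀ k, k ≠ j → 0 < A.f k y := by
  have h1 : ∀ᶠ y in 𝓝 x, ∀ k, k ≠ j → 0 < A.f k y := by
    rw [eventually_all]
    intro k
    by_cases hk : k = j
    · exact Eventually.of_forall fun y h => absurd hk h
    · have : 0 < A.f k x := lt_of_le_of_ne (hA.f_nonneg hx k) fun h => hk (huniq k h.symm)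
      filter_upwards [(A.continuous_f k).continuousAt.eventually (lt_mem_nhds this)] with y hy _
      exact hy
  filter_upwards [h1, hA.eventually_mem_closure hx] with y hy1 hy2
  refine ⟨⟨fun h => hA.f_nonneg h j, fun h => hy2 fun k => ?_⟩, hy1⟩
  by_cases hk : k = j
  · rwa [hk]
  · exact (hy1 k hk).le

/-- A boundary point that is neither a corner nor a vertical pole lies on one circle, off its
horizontal axis. There the circle is the graph of a square root, and the sign of `f_j` decides on
which side the region lies. -/
lemma IsAdmissible.hasRegularSlices (hA : A.IsAdmissible) (σ : ℝ) (p : Plane) :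
    HasRegularSlices (A.chartRegion σ p) (A.chartSing σ p) := by
  intro q hq hqs
  set x := planeChart σ p q with hx
  have hxD : x ∈ closure A.D := hq
  have hct := (continuous_planeChart σ p).continuousAt (x := q)
  by_cases hD : x ∈ A.D
  · left
    exact mem_of_superset (hct (hA.isOpen.mem_nhds hD)) fun y hy => subset_closure hy
  right
  obtain ⟨j, hj⟩ := hA.exists_f_eq_zero hxD hD
  have hns : ¬ ((∃ j k, j ≠ k ∧ A.f j x = 0 ∧ A.f k x = 0) ∨
    ∃ j, A.f j x = 0 ∧ x 1 = A.center j 1) := fun h => hqs ⟨hxD, h⟩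
  rw [not_or] at hns
  have huniq : ∀ k, A.f k x = 0 → k = j := fun k hk => by
    by_contra hkj
    exact hns.1 ⟨k, j, hkj, hk, hj⟩
  have hx1 : x 1 ≠ A.center j 1 := fun h => hns.2 ⟨j, hj, h⟩
  have hev : ∀ᶠ q' in 𝓝 q, (q' ∈ A.chartRegion σ p ↔ 0 ≤ A.f j (planeChart σ p q')) := by
    filter_upwards [hct.eventually (hA.eventually_mem_closure_iff hxD huniq)] with q' hq'
    exact hq'.1
  set c := A.center j with hc
  -- Where `B` is negative its square root is `0`, so the graph functions below are continuous on
  -- the whole line; the comparisons used with `√` do not need `0 ≤ B`.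
  set B : ℝ → ℝ := fun u => A.radius j ^ 2 - (p 0 + σ * u - c 0) ^ 2 with hB
  have hBc : Continuous B := by fun_prop
  have hf : ∀ q', A.f j (planeChart σ p q') = A.sgn j * ((p 1 + q'.2 - c 1) ^ 2 - B q'.1) := by
    intro q'
    rw [f_eq]
    simp only [planeChart_zero, planeChart_one, hB]
    ring
  have hq0 : (p 1 + q.2 - c 1) ^ 2 = B q.1 := by
    have := hf q
    rw [hj, zero_eq_mul, or_iff_right (A.sgn_ne_zero j), sub_eq_zero] at this
    exact this
  have hx1' : p 1 + q.2 - c 1 ≠ 0 := sub_ne_zero.2 hx1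
  have hcy : Continuous fun q' : ℝ × ℝ => p 1 + q'.2 - c 1 := by fun_prop
  rcases lt_or_gt_of_ne hx1' with hneg | hpos
  · have hh : -(√(B q.1)) + c 1 - p 1 = q.2 := by
      rw [← hq0, Real.sqrt_sq_eq_abs, abs_of_neg hneg]; ring
    have hevn := hcy.continuousAt.eventually (gt_mem_nhds hneg)
    rcases A.sgn_eq j with hs | hs
    · left
      refine ⟨fun u => -(√(B u)) + c 1 - p 1, by fun_prop, hh, ?_⟩
      filter_upwards [hev, hevn] with q' h1 h2
      rw [h1, hf, hs, one_mul, sub_nonneg, ← neg_sq (p 1 + q'.2 - c 1)]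
      have := Real.sqrt_le_left (x := B q'.1) (show 0 ≤ -(p 1 + q'.2 - c 1) by linarith)
      rw [← this]
      constructor <;> intro h <;> linarith
    · right
      refine ⟨fun u => -(√(B u)) + c 1 - p 1, by fun_prop, hh, ?_⟩
      filter_upwards [hev, hevn] with q' h1 h2
      have := Real.le_sqrt' (y := B q'.1) (show 0 < -(p 1 + q'.2 - c 1) by linarith)
      rw [h1, hf, hs, neg_one_mul, neg_sub, sub_nonneg, ← neg_sq (p 1 + q'.2 - c 1), ← this]
      constructor <;> intro h <;> linarith
  · have hh : √(B q.1) + c 1 - p 1 = q.2 := by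
      rw [← hq0, Real.sqrt_sq_eq_abs, abs_of_pos hpos]; ring
    have hevn := hcy.continuousAt.eventually (lt_mem_nhds hpos)
    rcases A.sgn_eq j with hs | hs
    · right
      refine ⟨fun u => √(B u) + c 1 - p 1, by fun_prop, hh, ?_⟩
      filter_upwards [hev, hevn] with q' h1 h2
      have := Real.sqrt_le_left (x := B q'.1) h2.le
      rw [h1, hf, hs, one_mul, sub_nonneg, ← this]
      constructor <;> intro h <;> linarith
    · left
      refine ⟨fun u => √(B u) + c 1 - p 1, by fun_prop, hh, ?_⟩
      filter_upwards [hev, hevn] with q' h1 h2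
      have := Real.le_sqrt' (y := B q'.1) h2
      rw [h1, hf, hs, neg_one_mul, neg_sub, sub_nonneg, ← this]
      constructor <;> intro h <;> linarith

end CircleData

/-! ### Local forms of Morse-Bott functions -/

section MorseBott

open Set Topology Filter

/-- A diagonal quadratic function with non-zero coefficients is a Morse function. -/
lemma isMorseOn_diagonal {k : ℕ} (c : ℝ) (ε : Fin k → ℝ) (hε : ∀ i, ε i ≠ 0) :
    IsMorseOn (fun y : EuclideanSpace ℝ (Fin k) => c + ∑ i, ε i * y i ^ 2) univ := by
  have hs : ContDiff ℝ ∞ (fun y : EuclideanSpace ℝ (Fin k) => c + ∑ i, ε i * y i ^ 2) := by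
    fun_prop
  refine ⟨isOpen_univ, hs.contDiffOn, fun y _ _ v hv => ?_⟩
  let π : Fin k → EuclideanSpace ℝ (Fin k) →L[ℝ] ℝ := fun i => EuclideanSpace.proj i
  let L : EuclideanSpace ℝ (Fin k) →L[ℝ] (EuclideanSpace ℝ (Fin k) →L[ℝ] ℝ) :=
    ∑ i, (2 * ε i) • (π i).smulRight (π i)
  have hL : fderiv ℝ (fun y : EuclideanSpace ℝ (Fin k) => c + ∑ i, ε i * y i ^ 2) = L := by
    funext y
    have h1 : ∀ i, HasFDerivAt (fun y : EuclideanSpace ℝ (Fin k) => ε i * y i ^ 2)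
        ((2 * ε i) • (y i • π i)) y := by
      intro i
      have h2 : HasFDerivAt (fun y : EuclideanSpace ℝ (Fin k) => y i) (π i) y :=
        (π i).hasFDerivAt
      have h3 := (h2.pow 2).const_mul (ε i)
      refine h3.congr_fderiv ?_
      ext w
      simp
      ring
    have h4 := (HasFDerivAt.fun_sum (u := Finset.univ) fun i _ => h1 i).const_add c
    rw [h4.fderiv]
    ext w
    simp [L, π]
  rw [hL, ContinuousLinearMap.fderiv] at hv
  ext i
  have := hv (EuclideanSpace.single i 1)
  simp [L, π] at this
  rcases this with h | h
  · exact absurd h (hε i)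
  · simpa using h

variable {E G : Type*} [NormedAddCommGroup E] [NormedSpace ℝ E]
  [NormedAddCommGroup G] [NormedSpace ℝ G]

/-- A right inverse `R` of `L p` makes `L z ∘ R` close to the identity for `z` near `p`, and the
invertible operators form an open set. -/
lemma eventually_surjective_of_continuousAt [FiniteDimensional ℝ G] {L : E → (E →L[ℝ] G)} {p : E}
    (hc : ContinuousAt L p) (hs : Function.Surjective (L p)) :
    ∀ᶠ z in 𝓝 p, Function.Surjective (L z) := by
  obtain ⟨R, hR⟩ := LinearMap.exists_rightInverse_of_surjective (L p : E →ₗ[ℝ] G)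
    (LinearMap.range_eq_top.2 hs)
  have : CompleteSpace G := FiniteDimensional.complete ℝ G
  let R' : G →L[ℝ] E := LinearMap.toContinuousLinearMap R
  have h1 : (L p).comp R' = 1 := by
    ext x
    exact LinearMap.congr_fun hR x
  have h2 : ContinuousAt (fun z => (L z).comp R') p := hc.clm_comp continuousAt_const
  have h3 : ∀ᶠ z in 𝓝 p, IsUnit ((L z).comp R') := by
    refine h2.eventually (Units.isOpen.mem_nhds ?_)
    simp only [h1]
    exact isUnit_one
  filter_upwards [h3] with z hz x
  obtain ⟨u, hu⟩ := hz
  refine ⟨R' (((u⁻¹ : (G →L[ℝ] G)ˣ) : G →L[ℝ] G) x), ?_⟩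
  have h4 : ((u : G →L[ℝ] G) * ((u⁻¹ : (G →L[ℝ] G)ˣ) : G →L[ℝ] G)) x = x := by
    rw [u.mul_inv]; rfl
  rw [hu] at h4
  exact h4

/-- A function which on `M` is a sum of squares `a_t ℓ_t²`, with independent `ℓ_t` and non-vanishing
coefficients `a_t`, has the local form of a Morse-Bott function. -/
lemma exists_morseBott_form [FiniteDimensional ℝ G] {F : E → G} {M : Set E} {g : E → ℝ} {p : E}
    (hF : ContDiff ℝ ω F) (hsurj : Function.Surjective (fderiv ℝ F p))
    {ι : Type*} [Fintype ι] (a ℓ : ι → E → ℝ) (ha : ∀ t, ContDiffAt ℝ ω (a t) p)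
    (hℓ : ∀ t, ContDiffAt ℝ ω (ℓ t) p) (ha0 : ∀ t, a t p ≠ 0) (hℓ0 : ∀ t, ℓ t p = 0) (c : ℝ)
    (hg : ∀ᶠ z in 𝓝 p, z ∈ M → g z = c + ∑ t, a t z * ℓ t z ^ 2)
    (hjoint : ∀ u : ι → ℝ, ∃ v ∈ locusTangent F p, ∀ t, fderiv ℝ (ℓ t) p v = u t) :
    ∃ (k : ℕ) (N : Set E) (s : E → EuclideanSpace ℝ (Fin k))
      (V : Set (EuclideanSpace ℝ (Fin k))) (h : EuclideanSpace ℝ (Fin k) → ℝ),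
      IsOpen N ∧ p ∈ N ∧ ContDiffOn ℝ ∞ s N ∧
      (∀ z ∈ M ∩ N, ∀ u, ∃ v ∈ locusTangent F z, fderiv ℝ s z v = u) ∧
      (∀ z ∈ M ∩ N, s z ∈ V) ∧ IsMorseOn h V ∧ ∀ z ∈ M ∩ N, g z = h (s z) := by
  classical
  set e := Fintype.equivFin ι with he
  set ε : ι → ℝ := fun t => if 0 < a t p then 1 else -1 with hε
  have hεε : ∀ t, ε t * ε t = 1 := fun t => by simp only [hε]; split_ifs <;> norm_num
  have hε0 : ∀ t, ε t ≠ 0 := fun t h => by have := hεε t; rw [h] at this; norm_num at this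
  have hεa : ∀ t, 0 < ε t * a t p := fun t => by
    simp only [hε]
    split_ifs with h
    · linarith
    · have := lt_of_le_of_ne (not_lt.1 h) (ha0 t)
      linarith
  -- The modulus of the coefficient is absorbed into the coordinate and only its sign `ε t` at `p`
  -- remains, so `g` becomes a diagonal quadratic form in `s`.
  set st : ι → E → ℝ := fun t z => √(ε t * a t z) * ℓ t z with hst
  have hrootc : ∀ t, ContDiffAt ℝ ω (fun z => √(ε t * a t z)) p := fun t =>
    (contDiffAt_const.mul (ha t)).sqrt (hεa t).ne'
  have hstc : ∀ t, ContDiffAt ℝ ω (st t) p := fun t => (hrootc t).mul (hℓ t)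
  set s : E → EuclideanSpace ℝ (Fin (Fintype.card ι)) :=
    fun z => WithLp.toLp 2 fun i => st (e.symm i) z with hs
  have hsc : ContDiffAt ℝ ω s p := contDiffAt_euclidean.2 fun i => hstc _
  have hsd : ∀ v i, fderiv ℝ s p v i = √(ε (e.symm i) * a (e.symm i) p) *
      fderiv ℝ (ℓ (e.symm i)) p v := by
    intro v i
    have h1 : HasFDerivAt s (fderiv ℝ s p) p := (hsc.differentiableAt (by simp)).hasFDerivAt
    have h2 : HasFDerivAt (fun z => s z i) ((EuclideanSpace.proj i).comp (fderiv ℝ s p)) p :=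
      (EuclideanSpace.proj (𝕜 := ℝ) i).hasFDerivAt.comp p h1
    have h3 := (((hrootc (e.symm i)).differentiableAt (by simp)).hasFDerivAt).mul
      (((hℓ (e.symm i)).differentiableAt (by simp)).hasFDerivAt)
    have h4 := h2.unique h3
    have h5 := congrArg (fun L => L v) h4
    simpa [hℓ0] using h5
  -- Surjectivity on the varying kernels of `fderiv ℝ F z` is not visibly an open condition; joint
  -- surjectivity of both differentials on the fixed space `E` is, and it implies the former.
  have hjs : Function.Surjective ((fderiv ℝ F p).prod (fderiv ℝ s p)) := by
    rintro ⟨x, y⟩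
    obtain ⟨v₁, hv₁⟩ := hsurj x
    obtain ⟨v₂, hv₂, hv₂'⟩ := hjoint fun t => (y (e t) - fderiv ℝ s p v₁ (e t)) / √(ε t * a t p)
    have hk : fderiv ℝ F p v₂ = 0 := hv₂
    refine ⟨v₁ + v₂, ?_⟩
    rw [ContinuousLinearMap.prod_apply, map_add, map_add, hv₁, hk, add_zero]
    congr 1
    ext i
    have hne : √(ε (e.symm i) * a (e.symm i) p) ≠ 0 := (Real.sqrt_pos.2 (hεa _)).ne'
    rw [PiLp.add_apply, hsd v₂, hv₂', Equiv.apply_symm_apply, mul_div_cancel₀ _ hne]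
    ring
  have hLc : ContinuousAt (fun z => (fderiv ℝ F z).prod (fderiv ℝ s z)) p := by
    have h1 : ContinuousAt (fderiv ℝ F) p := (hF.continuous_fderiv (by simp)).continuousAt
    have h2 : ContinuousAt (fderiv ℝ s) p :=
      (hsc.fderiv_right (m := 0) (by simp)).continuousAt
    have h3 : (fun z => (fderiv ℝ F z).prod (fderiv ℝ s z)) = fun z =>
        (ContinuousLinearMap.inl ℝ G (EuclideanSpace ℝ (Fin (Fintype.card ι)))).comp (fderiv ℝ F z)
        + (ContinuousLinearMap.inr ℝ G (EuclideanSpace ℝ (Fin (Fintype.card ι)))).comp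
          (fderiv ℝ s z) := by
      funext z
      ext v <;> simp
    rw [h3]
    exact (continuousAt_const.clm_comp h1).add (continuousAt_const.clm_comp h2)
  have hev : ∀ᶠ z in 𝓝 p, ContDiffAt ℝ ω s z ∧ (∀ t, 0 < ε t * a t z) ∧
      (z ∈ M → g z = c + ∑ t, a t z * ℓ t z ^ 2) ∧
      Function.Surjective ((fderiv ℝ F z).prod (fderiv ℝ s z)) := by
    refine (hsc.eventually (by simp)).and (Eventually.and ?_ (hg.and
      (eventually_surjective_of_continuousAt hLc hjs)))
    rw [eventually_all]
    intro t
    exact (contDiffAt_const.mul (ha t)).continuousAt.eventually (lt_mem_nhds (hεa t))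
  obtain ⟨N, hN, hNo, hpN⟩ := eventually_nhds_iff.1 hev
  refine ⟨Fintype.card ι, N, s, univ, fun y => c + ∑ i, ε (e.symm i) * y i ^ 2, hNo, hpN, ?_, ?_,
    fun _ _ => mem_univ _, isMorseOn_diagonal c _ fun i => hε0 _, ?_⟩
  · intro z hz
    exact ((hN z hz).1.of_le le_top).contDiffWithinAt
  · rintro z ⟨-, hz⟩ u
    obtain ⟨v, hv⟩ := (hN z hz).2.2.2 (0, u)
    rw [ContinuousLinearMap.prod_apply, Prod.mk.injEq] at hv
    exact ⟨v, hv.1, hv.2⟩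
  · rintro z ⟨hzM, hz⟩
    rw [(hN z hz).2.2.1 hzM, ← e.symm.sum_comp]
    congr 1
    refine Finset.sum_congr rfl fun i _ => ?_
    simp only [hs, hst]
    rw [mul_pow, Real.sq_sqrt ((hN z hz).2.1 _).le, ← mul_assoc, ← mul_assoc, hεε, one_mul]

end MorseBott

/-! ### The moment manifold, its singular points and its Reeb space -/

namespace CircleData

open Set Topology Filter

variable {l₁ l₂ : ℕ} {A : CircleData l₁ l₂} {m : Fin l₂ → ℕ}

lemma momentSystem_apply (z : Ambient m) (i : Fin l₂) :
    A.momentSystem m z i = A.classProd i z.1 - ‖z.2 i‖ ^ 2 := by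
  unfold momentSystem momentPoly classProd
  rw [map_sub, map_prod, EuclideanSpace.norm_sq_eq]
  congr 1
  · refine Finset.prod_congr rfl fun j _ => ?_
    rw [MvPolynomial.eval_rename]
    rfl
  · simp [ambientCoords]

lemma mem_zerosOver_iff {U : Set Plane} (z : Ambient m) :
    z ∈ A.zerosOver m U ↔ z.1 ∈ U ∧ ∀ i, A.classProd i z.1 = ‖z.2 i‖ ^ 2 := by
  unfold zerosOver
  refine and_congr Iff.rfl ?_
  rw [funext_iff]
  refine forall_congr' fun i => ?_
  rw [momentSystem_apply, Pi.zero_apply, sub_eq_zero]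

lemma mem_momentManifold_iff (z : Ambient m) :
    z ∈ A.momentManifold m ↔ z.1 ∈ closure A.D ∧ ∀ i, A.classProd i z.1 = ‖z.2 i‖ ^ 2 :=
  mem_zerosOver_iff z

/-- On the zero set every class product is a squared norm, hence non-negative, and close to `closure
D` this forces the base point into `closure D`. -/
lemma IsAdmissible.isLocusOverSmallNhds (hA : A.IsAdmissible) : A.IsLocusOverSmallNhds m := by
  obtain ⟨U₀, hU₀, hDU, h⟩ := hA.exists_open_classProd
  refine ⟨U₀, hU₀, hDU, fun U _ hDU' hUU => ?_⟩
  ext z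
  rw [mem_zerosOver_iff, mem_momentManifold_iff]
  refine and_congr_left fun hz => ⟨fun hzU => h _ (hUU hzU) fun i => ?_, fun hzD => hDU' hzD⟩
  rw [hz i]; positivity

/-- The full zero set lies over the closure of `D` when the products of the classes are
non-negative only there. -/
lemma momentManifold_eq_zerosOver_univ_iff : A.momentManifold m = A.zerosOver m univ ↔
    ∀ x, (∀ i, 0 ≤ A.classProd i x) → x ∈ closure A.D := by
  constructor
  · intro h x hx
    let z : Ambient m := (x, fun i => EuclideanSpace.single 0 √(A.classProd i x))
    have hz : z ∈ A.zerosOver m univ := by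
      rw [mem_zerosOver_iff]
      refine ⟨mem_univ _, fun i => ?_⟩
      simp [z, Real.sq_sqrt (hx i)]
    rw [← h, mem_momentManifold_iff] at hz
    exact hz.1
  · intro h
    ext z
    rw [mem_zerosOver_iff, mem_momentManifold_iff]
    refine and_congr_left fun hz => ⟨fun _ => mem_univ _, fun _ => h _ fun i => ?_⟩
    rw [hz i]; positivity

lemma contDiff_f {n : WithTop ℕ∞} (j : Fin l₁) : ContDiff ℝ n (A.f j) := by
  rw [show A.f j = fun x => A.f j x from rfl]
  simp only [f_eq]
  fun_prop

lemma contDiff_classProd {n : WithTop ℕ∞} (i : Fin l₂) : ContDiff ℝ n (A.classProd i) :=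
  contDiff_prod fun j _ => contDiff_f j

lemma contDiff_cofactor {n : WithTop ℕ∞} (j : Fin l₁) : ContDiff ℝ n (A.cofactor j) :=
  contDiff_prod fun j _ => contDiff_f j

lemma contDiff_momentSystem {n : WithTop ℕ∞} : ContDiff ℝ n (A.momentSystem m) := by
  rw [contDiff_pi]
  intro i
  simp only [momentSystem_apply]
  have h1 : ContDiff ℝ n fun z : Ambient m => A.classProd i z.1 :=
    (contDiff_classProd i).comp contDiff_fst
  have h2 : ContDiff ℝ n fun z : Ambient m => z.2 i := contDiff_pi.1 contDiff_snd i
  exact h1.sub (h2.norm_sq ℝ)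

lemma fderiv_momentSystem (z v : Ambient m) (i : Fin l₂) :
    fderiv ℝ (A.momentSystem m) z v i =
      fderiv ℝ (A.classProd i) z.1 v.1 - 2 * inner ℝ (z.2 i) (v.2 i) := by
  have h0 : HasFDerivAt (A.momentSystem m) (fderiv ℝ (A.momentSystem m) z) z :=
    ((contDiff_momentSystem (n := 1)).differentiable (by simp) z).hasFDerivAt
  have h1 := hasFDerivAt_pi'.1 h0 i
  have h2 : HasFDerivAt (fun z : Ambient m => A.classProd i z.1)
      ((fderiv ℝ (A.classProd i) z.1).comp (ContinuousLinearMap.fst ℝ _ _)) z :=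
    (((contDiff_classProd (A := A) (n := 1) i).differentiable (by simp) z.1).hasFDerivAt).comp z
      hasFDerivAt_fst
  have h3 : HasFDerivAt (fun z : Ambient m => z.2 i) ((ContinuousLinearMap.proj (R := ℝ)
      (φ := fun i : Fin l₂ => EuclideanSpace ℝ (Fin (m i + 1))) i).comp
        (ContinuousLinearMap.snd ℝ _ _)) z :=
    (ContinuousLinearMap.hasFDerivAt (ContinuousLinearMap.proj (R := ℝ)
      (φ := fun i : Fin l₂ => EuclideanSpace ℝ (Fin (m i + 1))) i)).comp z hasFDerivAt_snd
  have h4 := h2.sub h3.norm_sq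
  have h5 : (fun z : Ambient m => A.momentSystem m z i) =
      fun z => A.classProd i z.1 - ‖z.2 i‖ ^ 2 := funext fun z => momentSystem_apply z i
  rw [h5] at h1
  have h6 := congrArg (fun L => L v) (h1.unique h4)
  simpa using h6

lemma fderiv_f (j : Fin l₁) (x v : Plane) : fderiv ℝ (A.f j) x v =
    A.sgn j * (2 * ((x 0 - A.center j 0) * v 0 + (x 1 - A.center j 1) * v 1)) := by
  have h0 : ∀ i : Fin 2, HasFDerivAt (fun y : Plane => (y i - A.center j i) ^ 2)
      ((2 * (x i - A.center j i)) • (EuclideanSpace.proj i : Plane →L[ℝ] ℝ)) x := by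
    intro i
    have := (((EuclideanSpace.proj (𝕜 := ℝ) i : Plane →L[ℝ] ℝ).hasFDerivAt (x := x)).sub_const
      (A.center j i)).pow 2
    refine this.congr_fderiv ?_
    ext w; simp
  have h1 := (((h0 0).add (h0 1)).sub_const (A.radius j ^ 2)).const_mul (A.sgn j)
  have h2 : A.f j = fun y => A.sgn j * ((y 0 - A.center j 0) ^ 2 + (y 1 - A.center j 1) ^ 2
      - A.radius j ^ 2) := funext fun y => A.f_eq j y
  have h3 := h1.congr_of_eventuallyEq (f₁ := A.f j) (Filter.Eventually.of_forall fun y => by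
    rw [h2]; rfl)
  rw [h3.fderiv]
  simp
  ring

/-- By the product rule: on `S_j` the term with the derivative of the cofactor drops out. -/
lemma fderiv_classProd {j : Fin l₁} {x : Plane} (hj : A.f j x = 0) (v : Plane) :
    fderiv ℝ (A.classProd (A.cls j)) x v = A.cofactor j x *
      (A.sgn j * (2 * ((x 0 - A.center j 0) * v 0 + (x 1 - A.center j 1) * v 1))) := by
  have h1 : HasFDerivAt (A.f j) (fderiv ℝ (A.f j) x) x :=
    ((contDiff_f (n := 1) j).differentiable (by simp) x).hasFDerivAt
  have h2 : HasFDerivAt (A.cofactor j) (fderiv ℝ (A.cofactor j) x) x :=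
    ((contDiff_cofactor (n := 1) j).differentiable (by simp) x).hasFDerivAt
  have h3 : A.classProd (A.cls j) = fun y => A.f j y * A.cofactor j y :=
    funext fun y => classProd_eq j y
  have h4 := (h1.mul h2).congr_of_eventuallyEq (f₁ := A.classProd (A.cls j))
    (Filter.Eventually.of_forall fun y => by rw [h3]; rfl)
  rw [h4.fderiv]
  simp [hj, fderiv_f]

/-- Tangent vectors of the moment manifold can be found with prescribed base component. -/
lemma exists_vector_of_base {z : Ambient m} (hz : z ∈ A.momentManifold m) (v : Plane)
    (t : Fin l₂ → ℝ) (w₀ : (i : Fin l₂) → EuclideanSpace ℝ (Fin (m i + 1)))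
    (hv : ∀ j, A.f j z.1 = 0 → fderiv ℝ (A.classProd (A.cls j)) z.1 v = t (A.cls j)) :
    ∃ w : (i : Fin l₂) → EuclideanSpace ℝ (Fin (m i + 1)),
      fderiv ℝ (A.momentSystem m) z (v, w) = t ∧ ∀ i, z.2 i = 0 → w i = w₀ i := by
  classical
  rw [mem_momentManifold_iff] at hz
  -- Where `y_i` is non-zero, a multiple of `y_i` itself corrects the `i`-th equation. Where it
  -- vanishes, the equation does not involve `w i`, which stays free, and some circle of the class
  -- passes through the base point, so that `hv` applies.
  refine ⟨fun i => if z.2 i = 0 then w₀ i else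
    ((fderiv ℝ (A.classProd i) z.1 v - t i) / (2 * ‖z.2 i‖ ^ 2)) • z.2 i, ?_, fun i hi => ?_⟩
  · funext i
    rw [fderiv_momentSystem]
    by_cases hi : z.2 i = 0
    · have h0 : A.classProd i z.1 = 0 := by rw [hz.2 i, hi]; simp
      obtain ⟨j, hj, hj0⟩ := Finset.prod_eq_zero_iff.1 h0
      rw [Finset.mem_filter] at hj
      have := hv j hj0
      rw [hj.2] at this
      simp only [hi, inner_zero_left, this]
      ring
    · have hne : ‖z.2 i‖ ^ 2 ≠ 0 := by simpa using hi
      simp only [hi, if_false, inner_smul_right, real_inner_self_eq_norm_sq]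
      field_simp
      ring
  · simp [hi]

lemma coord_eq_zero {z : Ambient m} (hz : z ∈ A.momentManifold m) {j : Fin l₁}
    (hj : A.f j z.1 = 0) : z.2 (A.cls j) = 0 := by
  have := ((mem_momentManifold_iff z).1 hz).2 (A.cls j)
  rw [classProd_eq, hj, zero_mul] at this
  simpa using this.symm

/-- Equations with `y_i ≠ 0` are solved by `y_i`; those with `y_i = 0` belong to circles through the
base point, and transversality prescribes their derivatives at once by a vector of the plane. -/
lemma IsAdmissible.surjective_fderiv (hA : A.IsAdmissible) {z : Ambient m}
    (hz : z ∈ A.momentManifold m) : Function.Surjective (fderiv ℝ (A.momentSystem m) z) := by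
  intro t
  have hzD := ((mem_momentManifold_iff z).1 hz).1
  obtain ⟨v, hv⟩ := (hA.transverseAt hzD).exists_vector A hA.radius_pos
    (fun j => t (A.cls j) / (A.cofactor j z.1 * (A.sgn j * 2)))
  obtain ⟨w, hw, -⟩ := exists_vector_of_base hz v t 0 (by
    intro j hj
    have h1 := (hA.cofactor_pos hzD hj).ne'
    have h2 := A.sgn_ne_zero j
    rw [fderiv_classProd hj, hv j hj]
    field_simp)
  exact ⟨(v, w), hw⟩

/-- Within the full zero set the manifold is closed by `hM`, and open because it is the part over
the open set `U₀`; so a component that meets it is contained in it. -/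
lemma IsAdmissible.isNonsingularLocus (hA : A.IsAdmissible)
    (hM : IsClosed (A.momentManifold m)) :
    IsNonsingularLocus (A.momentSystem m) (A.momentManifold m) := by
  refine ⟨fun z hz => hz.2, fun p hp => ?_, fun z hz => hA.surjective_fderiv hz⟩
  obtain ⟨U₀, hU₀, hDU, h⟩ := hA.isLocusOverSmallNhds (m := m)
  have hz : A.zerosOver m U₀ = A.momentManifold m := h U₀ hU₀ hDU le_rfl
  have hoU : IsOpen (Prod.fst ⁻¹' U₀ : Set (Ambient m)) := hU₀.preimage continuous_fst
  have heq : ∀ z ∈ A.momentSystem m ⁻¹' {0}, z ∈ A.momentManifold m ∨ z.1 ∉ U₀ := by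
    intro z hz0
    by_cases hzU : z.1 ∈ U₀
    · left; rw [← hz]; exact ⟨hzU, hz0⟩
    · exact Or.inr hzU
  have hp0 : p ∈ A.momentSystem m ⁻¹' {0} := hp.2
  intro z hzc
  have hsub : connectedComponentIn (A.momentSystem m ⁻¹' {0}) p ⊆
      (Prod.fst ⁻¹' U₀) ∪ (A.momentManifold m)ᶜ := by
    intro y hy
    rcases heq y (connectedComponentIn_subset _ _ hy) with h' | h'
    · exact Or.inl (hDU h'.1)
    · exact Or.inr fun hyM => h' (hDU hyM.1)
  by_contra hzM
  obtain ⟨y, hy, hy1, hy2⟩ := isPreconnected_connectedComponentIn _ _ hoU hM.isOpen_compl hsub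
    ⟨p, mem_connectedComponentIn hp0, hDU hp.1⟩ ⟨z, hzc, hzM⟩
  rcases heq y (connectedComponentIn_subset _ _ hy) with h' | h'
  exacts [hy2 h', h' hy1]

/-- Rank and nullity: the ambient dimension is `2 + ∑ i, (m i + 1)`, and the `l₂` equations are
independent. -/
lemma IsAdmissible.finrank_locusTangent (hA : A.IsAdmissible) {z : Ambient m}
    (hz : z ∈ A.momentManifold m) :
    Module.finrank ℝ (locusTangent (A.momentSystem m) z) = (∑ i, m i) + 2 := by
  have h1 := LinearMap.finrank_range_add_finrank_ker
    (fderiv ℝ (A.momentSystem m) z : Ambient m →ₗ[ℝ] (Fin l₂ → ℝ))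
  have h2 : LinearMap.range (fderiv ℝ (A.momentSystem m) z : Ambient m →ₗ[ℝ] (Fin l₂ → ℝ)) = ⊤ :=
    LinearMap.range_eq_top.2 (hA.surjective_fderiv hz)
  rw [h2, finrank_top, Module.finrank_prod, Module.finrank_pi_fintype,
    Module.finrank_pi_fintype] at h1
  simp only [Module.finrank_self, finrank_euclideanSpace, Fintype.card_fin, Finset.sum_add_distrib, Finset.sum_const,
    Finset.card_univ, smul_eq_mul, mul_one] at h1
  unfold locusTangent
  omega

lemma fderiv_height (z v : Ambient m) : fderiv ℝ (height m) z v = v.1 0 := by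
  have : height m = ((EuclideanSpace.proj 0 : Plane →L[ℝ] ℝ).comp
    (ContinuousLinearMap.fst ℝ Plane _) : Ambient m →L[ℝ] ℝ) := rfl
  rw [this, ContinuousLinearMap.fderiv]
  rfl

lemma contDiff_height {n : WithTop ℕ∞} : ContDiff ℝ n (height m) :=
  ((EuclideanSpace.proj 0 : Plane →L[ℝ] ℝ).comp
    (ContinuousLinearMap.fst ℝ Plane _) : Ambient m →L[ℝ] ℝ).contDiff

/-- The singular points of the height function lie over the corners and the vertical poles. -/
lemma IsAdmissible.mem_singularPoints_iff (hA : A.IsAdmissible) (z : Ambient m) :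
    z ∈ singularPoints (A.momentSystem m) (A.momentManifold m) (height m) ↔
      z ∈ A.momentManifold m ∧ z.1 ∈ A.sing := by
  refine and_congr_right fun hz => ?_
  have hzD := ((mem_momentManifold_iff z).1 hz).1
  constructor
  · intro h
    refine ⟨hzD, ?_⟩
    by_contra hn
    rw [not_or] at hn
    have : ∃ v : Plane, v 0 ≠ 0 ∧ ∀ j, A.f j z.1 = 0 →
        (z.1 0 - A.center j 0) * v 0 + (z.1 1 - A.center j 1) * v 1 = 0 := by
      by_cases h1 : ∃ j, A.f j z.1 = 0
      · obtain ⟨j, hj⟩ := h1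
        -- The tangent direction of the only circle through the point; its first component is
        -- non-zero because the point is not a vertical pole.
        refine ⟨!₂[z.1 1 - A.center j 1, -(z.1 0 - A.center j 0)], ?_, fun k hk => ?_⟩
        · intro h0
          exact hn.2 ⟨j, hj, sub_eq_zero.1 (by simpa using h0)⟩
        · obtain rfl : k = j := by
            by_contra hkj
            exact hn.1 ⟨k, j, hkj, hk, hj⟩
          simp
          ring
      · exact ⟨!₂[1, 0], by simp, fun j hj => absurd ⟨j, hj⟩ h1⟩
    obtain ⟨v, hv0, hv⟩ := this
    obtain ⟨w, hw, -⟩ := exists_vector_of_base hz v 0 0 (by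
      intro j hj
      rw [fderiv_classProd hj, hv j hj]
      simp)
    have := h (v, w) hw
    rw [fderiv_height] at this
    exact hv0 this
  · rintro ⟨-, hs⟩ v hv
    rw [fderiv_height]
    -- Over `S_j` the coordinate of its class vanishes, so tangent vectors of the manifold project
    -- into the tangent line of `S_j`. At a corner two such lines meet in `0`, at a vertical pole
    -- the line is vertical; in both cases the first component is zero.
    have key : ∀ j, A.f j z.1 = 0 →
        (z.1 0 - A.center j 0) * v.1 0 + (z.1 1 - A.center j 1) * v.1 1 = 0 := by
      intro j hj
      have h1 : fderiv ℝ (A.momentSystem m) z v (A.cls j) = 0 := by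
        have : fderiv ℝ (A.momentSystem m) z v = 0 := hv
        rw [this]; rfl
      rw [fderiv_momentSystem, coord_eq_zero hz hj, inner_zero_left, fderiv_classProd hj] at h1
      have h2 := (hA.cofactor_pos hzD hj).ne'
      have h3 := A.sgn_ne_zero j
      have h4 : A.cofactor j z.1 * (A.sgn j * 2) ≠ 0 := by positivity
      refine (mul_eq_zero.1 (?_ : (A.cofactor j z.1 * (A.sgn j * 2)) * _ = 0)).resolve_left h4
      linear_combination h1
    rcases hs with ⟨j, k, hjk, hj, hk⟩ | ⟨j, hj, hp⟩
    · have hd := (hA.transverseAt hzD).1 j k hjk hj hk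
      refine (mul_eq_zero.1 (?_ : A.det j k z.1 * v.1 0 = 0)).resolve_left hd
      unfold det
      linear_combination (z.1 1 - A.center k 1) * key j hj - (z.1 1 - A.center j 1) * key k hk
    · have h1 := key j hj
      rw [hp, sub_self, zero_mul, add_zero] at h1
      refine (mul_eq_zero.1 h1).resolve_left fun h0 => ?_
      rw [f_eq_zero_iff, hp, h0] at hj
      have := hA.radius_pos j
      have : 0 < A.radius j ^ 2 := by positivity
      simp at hj
      linarith

/-- The height is Morse-Bott when no corner is a vertical pole. -/
lemma IsAdmissible.isMorseBottOn (hA : A.IsAdmissible)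
    (hpole : ∀ x ∈ closure A.D, ∀ j k, j ≠ k → A.f j x = 0 → A.f k x = 0 → x 1 ≠ A.center j 1) :
    IsMorseBottOn (A.momentSystem m) (A.momentManifold m) (height m) := by
  classical
  refine ⟨fun p _ => contDiff_height.contDiffAt, fun z₀ hz₀ => ?_⟩
  rw [hA.mem_singularPoints_iff] at hz₀
  obtain ⟨hz, hzD, hs⟩ := hz₀
  set p := z₀.1 with hp
  have hcof : ∀ j, A.f j p = 0 → A.cofactor j p ≠ 0 := fun j hj => (hA.cofactor_pos hzD hj).ne'
  have hcofc : ∀ j, ContDiffAt ℝ ω (fun z : Ambient m => A.cofactor j z.1) z₀ := fun j =>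
    ((contDiff_cofactor j).comp contDiff_fst).contDiffAt
  have hcofev : ∀ j, A.f j p = 0 → ∀ᶠ z : Ambient m in 𝓝 z₀, A.cofactor j z.1 ≠ 0 := fun j hj =>
    (hcofc j).continuousAt.eventually_ne (hcof j hj)
  have hM : ∀ z : Ambient m, z ∈ A.momentManifold m → ∀ j, A.cofactor j z.1 ≠ 0 →
      A.f j z.1 = (∑ s, z.2 (A.cls j) s ^ 2) / A.cofactor j z.1 := by
    intro z hz j hj
    rw [eq_div_iff hj, ← classProd_eq, ((mem_momentManifold_iff z).1 hz).2,
      EuclideanSpace.norm_sq_eq]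
    simp
  have hcoord : ∀ (i : Fin l₂) (s : Fin (m i + 1)) (v : Ambient m),
      fderiv ℝ (fun z : Ambient m => z.2 i s) z₀ v = v.2 i s := by
    intro i s v
    let L : Ambient m →L[ℝ] ℝ := (EuclideanSpace.proj s).comp ((ContinuousLinearMap.proj (R := ℝ)
      (φ := fun i : Fin l₂ => EuclideanSpace ℝ (Fin (m i + 1))) i).comp
        (ContinuousLinearMap.snd ℝ _ _))
    have : (fun z : Ambient m => z.2 i s) = L := rfl
    rw [this, ContinuousLinearMap.fderiv]
    rfl
  have hcoordc : ∀ (i : Fin l₂) (s : Fin (m i + 1)),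
      ContDiffAt ℝ ω (fun z : Ambient m => z.2 i s) z₀ := by
    intro i s
    let L : Ambient m →L[ℝ] ℝ := (EuclideanSpace.proj s).comp ((ContinuousLinearMap.proj (R := ℝ)
      (φ := fun i : Fin l₂ => EuclideanSpace ℝ (Fin (m i + 1))) i).comp
        (ContinuousLinearMap.snd ℝ _ _))
    exact L.contDiff.contDiffAt
  have hbase : ∀ r : Fin 2, ContDiffAt ℝ ω (fun z : Ambient m => z.1 r) z₀ := by
    intro r
    let L : Ambient m →L[ℝ] ℝ := (EuclideanSpace.proj r : Plane →L[ℝ] ℝ).comp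
      (ContinuousLinearMap.fst ℝ Plane _)
    exact L.contDiff.contDiffAt
  by_cases hc : ∃ j k, j ≠ k ∧ A.f j p = 0 ∧ A.f k p = 0
  · obtain ⟨j, k, hjk, hj, hk⟩ := hc
    have hcls : A.cls j ≠ A.cls k := hA.cls_ne hzD hjk hj hk
    have hd := (hA.transverseAt hzD).1 j k hjk hj hk
    -- Since `f_i` vanishes at `p`, differences of squares give exactly `f_i = Λ i 0 * (x₀ - p₀) + Λ
    -- i 1 * (x₁ - p₁)`. Cramer's rule with determinant `Δ` then expresses `x₀ - p₀` by `f_j` and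
    -- `f_k`, and on the manifold these are sums of squares divided by cofactors.
    let Λ : Fin l₁ → Fin 2 → Ambient m → ℝ := fun i r z =>
      A.sgn i * (z.1 r + p r - 2 * A.center i r)
    have hΛc : ∀ i r, ContDiffAt ℝ ω (Λ i r) z₀ := fun i r =>
      contDiffAt_const.mul (((hbase r).add contDiffAt_const).sub contDiffAt_const)
    let Δ : Ambient m → ℝ := fun z => Λ j 0 z * Λ k 1 z - Λ j 1 z * Λ k 0 z
    have hΔc : ContDiffAt ℝ ω Δ z₀ := ((hΛc j 0).mul (hΛc k 1)).sub ((hΛc j 1).mul (hΛc k 0))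
    have hΔ0 : Δ z₀ ≠ 0 := by
      have h1 : Δ z₀ = 4 * (A.sgn j * A.sgn k) * A.det j k p := by
        simp only [Δ, Λ, ← hp]
        unfold det
        ring
      have h2 := A.sgn_ne_zero j
      have h3 := A.sgn_ne_zero k
      rw [h1]; positivity
    -- A corner that is a vertical pole of one of its circles would give a vanishing coefficient of
    -- the squares; `hpole` excludes this.
    have hΛ1 : ∀ i i', i ≠ i' → A.f i p = 0 → A.f i' p = 0 → Λ i 1 z₀ ≠ 0 := by
      intro i i' hii hi hi'
      have h1 : Λ i 1 z₀ = 2 * A.sgn i * (p 1 - A.center i 1) := by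
        simp only [Λ, ← hp]; ring
      have h2 := A.sgn_ne_zero i
      have h3 : p 1 - A.center i 1 ≠ 0 := sub_ne_zero.2 (hpole p hzD i i' hii hi hi')
      rw [h1]; positivity
    have hfΛ : ∀ i, A.f i p = 0 → ∀ z : Ambient m,
        A.f i z.1 = Λ i 0 z * (z.1 0 - p 0) + Λ i 1 z * (z.1 1 - p 1) := by
      intro i hi z
      have h1 := (A.f_eq_zero_iff i p).1 hi
      rw [f_eq]
      simp only [Λ]
      linear_combination A.sgn i * h1
    refine exists_morseBott_form (ι := Fin (m (A.cls j) + 1) ⊕ Fin (m (A.cls k) + 1))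
      contDiff_momentSystem (hA.surjective_fderiv hz)
      (Sum.elim (fun _ z => Λ k 1 z / (Δ z * A.cofactor j z.1))
        (fun _ z => -Λ j 1 z / (Δ z * A.cofactor k z.1)))
      (Sum.elim (fun s z => z.2 (A.cls j) s) (fun s z => z.2 (A.cls k) s)) ?_ ?_ ?_ ?_ (p 0) ?_ ?_
    · rintro (s | s)
      · exact (hΛc k 1).div (hΔc.mul (hcofc j)) (mul_ne_zero hΔ0 (hcof j hj))
      · exact (hΛc j 1).neg.div (hΔc.mul (hcofc k)) (mul_ne_zero hΔ0 (hcof k hk))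
    · rintro (s | s)
      exacts [hcoordc _ s, hcoordc _ s]
    · rintro (s | s)
      · exact div_ne_zero (hΛ1 k j hjk.symm hk hj) (mul_ne_zero hΔ0 (hcof j hj))
      · exact div_ne_zero (neg_ne_zero.2 (hΛ1 j k hjk hj hk)) (mul_ne_zero hΔ0 (hcof k hk))
    · rintro (s | s) <;> simp [coord_eq_zero hz hj, coord_eq_zero hz hk]
    · filter_upwards [hcofev j hj, hcofev k hk, hΔc.continuousAt.eventually_ne hΔ0]
        with z h1 h2 h3 hzM
      simp only [Fintype.sum_sum_type, Sum.elim_inl, Sum.elim_inr]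
      rw [← Finset.mul_sum, ← Finset.mul_sum]
      have e1 := hM z hzM j h1
      have e2 := hM z hzM k h2
      rw [eq_div_iff h1] at e1
      rw [eq_div_iff h2] at e2
      rw [← e1, ← e2, height]
      have e3 := hfΛ j hj z
      have e4 := hfΛ k hk z
      have e5 : Δ z * (z.1 0 - p 0) = Λ k 1 z * A.f j z.1 - Λ j 1 z * A.f k z.1 := by
        rw [e3, e4]; simp only [Δ]; ring
      field_simp
      linear_combination e5
    · intro u
      obtain ⟨w, hw, hw0⟩ := exists_vector_of_base hz 0 0
        (Function.update (Function.update (0 : (i : Fin l₂) → EuclideanSpace ℝ (Fin (m i + 1)))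
          (A.cls j) (WithLp.toLp 2 fun s => u (Sum.inl s)))
          (A.cls k) (WithLp.toLp 2 fun s => u (Sum.inr s))) (by intro i _; simp)
      refine ⟨(0, w), hw, ?_⟩
      rintro (s | s)
      · simp only [Sum.elim_inl]
        rw [hcoord]
        change w (A.cls j) s = _
        rw [hw0 _ (coord_eq_zero hz hj), Function.update_of_ne hcls, Function.update_self]
      · simp only [Sum.elim_inr]
        rw [hcoord]
        change w (A.cls k) s = _
        rw [hw0 _ (coord_eq_zero hz hk), Function.update_self]
  · obtain ⟨j, hj, hpj⟩ := hs.resolve_left hc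
    have huniq : ∀ k, A.f k p = 0 → k = j := fun k hk => by
      by_contra hkj
      exact hc ⟨k, j, hkj, hk, hj⟩
    -- At a vertical pole `d ^ 2` is the squared radius, so with `c` the centre the equation of the
    -- circle factors as `(x₀ - c₀ + d) * (x₀ - p₀) = sgn j * f_j - (x₁ - c₁) ^ 2`. The height is a
    -- combination of the squares of the `y`-coordinates and of `x₁ - c₁`.
    set d := p 0 - A.center j 0 with hd
    have hd2 : d ^ 2 = A.radius j ^ 2 := by
      have := (A.f_eq_zero_iff j p).1 hj
      rw [hpj] at this
      simpa using this
    have hd0 : d ≠ 0 := by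
      intro h
      have := hA.radius_pos j
      have : 0 < A.radius j ^ 2 := by positivity
      rw [← hd2, h] at this
      simp at this
    let Δ : Ambient m → ℝ := fun z => z.1 0 - A.center j 0 + d
    have hΔc : ContDiffAt ℝ ω Δ z₀ := ((hbase 0).sub contDiffAt_const).add contDiffAt_const
    have hΔ0 : Δ z₀ ≠ 0 := by
      have : Δ z₀ = 2 * d := by simp only [Δ, ← hp]; rw [hd]; ring
      rw [this]; positivity
    refine exists_morseBott_form (ι := Fin (m (A.cls j) + 1) ⊕ Unit)
      contDiff_momentSystem (hA.surjective_fderiv hz)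
      (Sum.elim (fun _ z => A.sgn j / (Δ z * A.cofactor j z.1)) (fun _ z => -1 / Δ z))
      (Sum.elim (fun s z => z.2 (A.cls j) s) (fun _ z => z.1 1 - A.center j 1)) ?_ ?_ ?_ ?_
      (p 0) ?_ ?_
    · rintro (s | s)
      · exact contDiffAt_const.div (hΔc.mul (hcofc j)) (mul_ne_zero hΔ0 (hcof j hj))
      · exact contDiffAt_const.div hΔc hΔ0
    · rintro (s | s)
      exacts [hcoordc _ s, (hbase 1).sub contDiffAt_const]
    · rintro (s | s)
      · exact div_ne_zero (A.sgn_ne_zero j) (mul_ne_zero hΔ0 (hcof j hj))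
      · exact div_ne_zero (by norm_num) hΔ0
    · rintro (s | s)
      · simp [coord_eq_zero hz hj]
      · simp only [Sum.elim_inr, ← hp, hpj, sub_self]
    · filter_upwards [hcofev j hj, hΔc.continuousAt.eventually_ne hΔ0] with z h1 h3 hzM
      simp only [Fintype.sum_sum_type, Sum.elim_inl, Sum.elim_inr, Finset.univ_unique,
        Finset.sum_singleton]
      rw [← Finset.mul_sum]
      have e1 := hM z hzM j h1
      rw [eq_div_iff h1] at e1
      rw [← e1, height]
      have e3 := A.f_eq j z.1
      have e4 : Δ z * (z.1 0 - p 0) = A.sgn j * A.f j z.1 - (z.1 1 - A.center j 1) ^ 2 := by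
        rw [e3]
        simp only [Δ]
        linear_combination (-((z.1 0 - A.center j 0) ^ 2 + (z.1 1 - A.center j 1) ^ 2
          - A.radius j ^ 2)) * A.sgn_mul_sgn j + (z.1 0 - A.center j 0) * hd - d * hd - hd2
      field_simp
      linear_combination e4
    · intro u
      obtain ⟨w, hw, hw0⟩ := exists_vector_of_base hz !₂[0, u (Sum.inr ())] 0
        (Function.update (0 : (i : Fin l₂) → EuclideanSpace ℝ (Fin (m i + 1)))
          (A.cls j) (WithLp.toLp 2 fun s => u (Sum.inl s))) (by
            intro i hi
            rw [fderiv_classProd hi, huniq i hi, ← hp, hpj]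
            simp)
      refine ⟨(_, w), hw, ?_⟩
      rintro (s | s)
      · simp only [Sum.elim_inl]
        rw [hcoord]
        change w (A.cls j) s = _
        rw [hw0 _ (coord_eq_zero hz hj), Function.update_self]
      · simp only [Sum.elim_inr]
        let L : Ambient m →L[ℝ] ℝ := (EuclideanSpace.proj 1 : Plane →L[ℝ] ℝ).comp
          (ContinuousLinearMap.fst ℝ Plane _)
        have h1 : HasFDerivAt (fun z : Ambient m => z.1 1 - A.center j 1) L z₀ :=
          L.hasFDerivAt.sub_const _
        rw [h1.fderiv]
        simp [L]

/-! #### The moment manifold as a family of products of spheres -/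

variable (A m) in
/-- The parametrisation of the moment manifold by points of `closure D` and unit vectors. -/
def sphereParam (z : Ambient m) : Ambient m :=
  (z.1, fun i => √(A.classProd i z.1) • z.2 i)

lemma continuous_sphereParam : Continuous (A.sphereParam m) := by
  have := fun i => continuous_classProd (A := A) i
  unfold sphereParam
  fun_prop

variable (m) in
/-- The product of the unit spheres. -/
def unitSpheres : Set ((i : Fin l₂) → EuclideanSpace ℝ (Fin (m i + 1))) :=
  univ.pi fun _ => Metric.sphere 0 1

lemma isCompact_unitSpheres : IsCompact (unitSpheres m) :=
  isCompact_univ_pi fun _ => isCompact_sphere _ _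

/-- Here positivity of the `m i` enters: a sphere of dimension `0` is two points. -/
lemma isConnected_unitSpheres (hm : ∀ i, 0 < m i) : IsConnected (unitSpheres m) := by
  refine isConnected_univ_pi.2 fun i => isConnected_sphere ?_ _ zero_le_one
  rw [← Module.finrank_eq_rank, finrank_euclideanSpace, Fintype.card_fin]
  exact_mod_cast Nat.succ_lt_succ (hm i)

/-- Polar coordinates in each factor: `y_i` is its prescribed norm times a unit vector, and where
the norm is `0` any unit vector will do. Compactness, connectedness and connected fibres all follow
from this image. -/
lemma IsAdmissible.image_sphereParam (hA : A.IsAdmissible) {S : Set Plane}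
    (hS : S ⊆ closure A.D) : A.sphereParam m '' (S ×ˢ unitSpheres m) =
      {z | z ∈ A.momentManifold m ∧ z.1 ∈ S} := by
  classical
  ext z
  constructor
  · rintro ⟨⟨x, u⟩, ⟨hx, hu⟩, rfl⟩
    refine ⟨(mem_momentManifold_iff _).2 ⟨hS hx, fun i => ?_⟩, hx⟩
    have h1 : ‖u i‖ = 1 := by simpa using hu i (mem_univ i)
    simp only [sphereParam, norm_smul, h1, mul_one, Real.norm_eq_abs, sq_abs]
    rw [Real.sq_sqrt (hA.classProd_nonneg (hS hx) i)]
  · rintro ⟨hz, hzS⟩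
    have hz' := ((mem_momentManifold_iff z).1 hz).2
    refine ⟨(z.1, fun i => if z.2 i = 0 then EuclideanSpace.single 0 1 else ‖z.2 i‖⁻¹ • z.2 i),
      ⟨hzS, fun i _ => ?_⟩, ?_⟩
    · by_cases hi : z.2 i = 0
      · simp [hi]
      · have : ‖z.2 i‖ ≠ 0 := by simpa using hi
        simp [hi, norm_smul]
    · refine Prod.ext rfl (funext fun i => ?_)
      simp only [sphereParam, hz' i, Real.sqrt_sq (norm_nonneg _)]
      by_cases hi : z.2 i = 0
      · simp [hi]
      · have : ‖z.2 i‖ ≠ 0 := by simpa using hi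
        simp [hi, smul_smul]

lemma IsAdmissible.momentManifold_eq (hA : A.IsAdmissible) :
    A.momentManifold m = A.sphereParam m '' (closure A.D ×ˢ unitSpheres m) := by
  rw [hA.image_sphereParam le_rfl]
  ext z
  exact ⟨fun h => ⟨h, h.1⟩, fun h => h.1⟩

lemma IsAdmissible.isCompact_momentManifold (hA : A.IsAdmissible) :
    IsCompact (A.momentManifold m) := by
  rw [hA.momentManifold_eq]
  exact (hA.isCompact_closure.prod isCompact_unitSpheres).image continuous_sphereParam

lemma IsAdmissible.isConnected_momentManifold (hA : A.IsAdmissible) (hm : ∀ i, 0 < m i) :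
    IsConnected (A.momentManifold m) := by
  rw [hA.momentManifold_eq]
  exact (hA.isConnected_closure.prod (isConnected_unitSpheres hm)).image _
    continuous_sphereParam.continuousOn

/-- The Reeb space of the height is the Reeb space of the first coordinate on `closure D`. -/
lemma IsAdmissible.exists_homeomorph_momentReeb (hA : A.IsAdmissible) (hm : ∀ i, 0 < m i) {σ : ℝ}
    (hσ : σ * σ = 1) (p : Plane) :
    ∃ H : A.momentReeb m ≃ₜ ReebSpace (abscissa (A.chartRegion σ p)),
      H '' A.reebVertices m = reebMk _ '' (Subtype.val ⁻¹' A.chartSing σ p) ∧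
      ∀ (z : A.momentManifold m) (q : A.chartRegion σ p), planeCoord σ p (z : Ambient m).1 = q →
        H (reebMk _ z) = reebMk _ q := by
  have : CompactSpace (A.momentManifold m) :=
    isCompact_iff_compactSpace.1 hA.isCompact_momentManifold
  let F : A.momentManifold m → A.chartRegion σ p := fun z => ⟨planeCoord σ p (z : Ambient m).1, by
    change planeChart σ p (planeCoord σ p (z : Ambient m).1) ∈ closure A.D
    rw [planeChart_planeCoord hσ]
    exact z.2.1⟩
  have hFc : Continuous F := by
    refine Continuous.subtype_mk ?_ _
    have := continuous_planeCoord σ p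
    fun_prop
  have hfib : ∀ q : A.chartRegion σ p, (Subtype.val '' (F ⁻¹' {q}) : Set (Ambient m)) =
      A.sphereParam m '' ({planeChart σ p q} ×ˢ unitSpheres m) := by
    intro q
    rw [hA.image_sphereParam (singleton_subset_iff.2 q.2)]
    ext z
    constructor
    · rintro ⟨z, hz, rfl⟩
      refine ⟨z.2, ?_⟩
      have h1 : planeCoord σ p (z : Ambient m).1 = q := congrArg Subtype.val hz
      rw [mem_singleton_iff, ← h1, planeChart_planeCoord hσ]
    · rintro ⟨hz, hzq⟩
      refine ⟨⟨z, hz⟩, Subtype.ext ?_, rfl⟩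
      change planeCoord σ p z.1 = q
      rw [mem_singleton_iff.1 hzq, planeCoord_planeChart hσ]
  have hfib' : ∀ q, IsConnected (F ⁻¹' {q}) := by
    intro q
    have h1 : IsConnected (Subtype.val '' (F ⁻¹' {q}) : Set (Ambient m)) := by
      rw [hfib q]
      exact (isConnected_singleton.prod (isConnected_unitSpheres hm)).image _
        continuous_sphereParam.continuousOn
    exact ⟨h1.nonempty.of_image, Topology.IsInducing.subtypeVal.isPreconnected_image.1 h1.2⟩
  have hFs : Function.Surjective F := fun q => (hfib' q).nonempty
  have hσ0 : σ ≠ 0 := by rintro rfl; simp at hσ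
  obtain ⟨H, hH⟩ := exists_homeomorph_reebSpace hFc hFc.isClosedMap
    (fun q => (hfib' q).isPreconnected) hFs
    (c := fun z : A.momentManifold m => height m (z : Ambient m))
    (continuous_abscissa (A.chartRegion σ p)) (by
      intro z z'
      change (z : Ambient m).1 0 = (z' : Ambient m).1 0 ↔
        σ * ((z : Ambient m).1 0 - p 0) = σ * ((z' : Ambient m).1 0 - p 0)
      rw [mul_right_inj' hσ0, sub_left_inj])
  refine ⟨H, ?_, fun z q hq => by
    rw [hH z]
    exact congrArg _ (Subtype.ext hq)⟩
  have hmem : ∀ z : A.momentManifold m, (F z : ℝ × ℝ) ∈ A.chartSing σ p ↔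
      (z : Ambient m) ∈ singularPoints (A.momentSystem m) (A.momentManifold m) (height m) := by
    intro z
    rw [hA.mem_singularPoints_iff]
    change planeChart σ p (planeCoord σ p (z : Ambient m).1) ∈ A.sing ↔ _
    rw [planeChart_planeCoord hσ]
    exact ⟨fun h => ⟨z.2, h⟩, fun h => h.2⟩
  ext w
  constructor
  · rintro ⟨_, ⟨z, hz, rfl⟩, rfl⟩
    exact ⟨F z, (hmem z).2 hz, (hH z).symm⟩
  · rintro ⟨q, hq, rfl⟩
    obtain ⟨z, rfl⟩ := hFs q
    exact ⟨_, ⟨z, (hmem z).1 hq, rfl⟩, hH z⟩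

lemma finite_chartSing (hA : A.IsAdmissible) {σ : ℝ} (hσ : σ * σ = 1) (p : Plane) :
    (A.chartSing σ p).Finite :=
  hA.finite_sing.preimage (injective_planeChart hσ p).injOn

lemma IsAdmissible.isFiniteGraph_chart (hA : A.IsAdmissible) {σ : ℝ} (hσ : σ * σ = 1)
    (p : Plane) :
    IsFiniteGraph (reebMk (abscissa (A.chartRegion σ p)) ''
      (Subtype.val ⁻¹' A.chartSing σ p)) :=
  isFiniteGraph_of_hasRegularSlices (hA.isCompact_chartRegion hσ p) (finite_chartSing hA hσ p)
    (fun _ hq => hq.1) (hA.hasRegularSlices σ p)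

end CircleData

/-! ### Adding a small circle centred at a boundary point; admissibility of the new data -/

namespace CircleData

open Set Topology Filter

variable {l₁ l₂ : ℕ}

/-- The data obtained by removing a closed disc, whose circle forms a new class. -/
def addCircle (A : CircleData l₁ l₂) (p : Plane) (ε : ℝ) : CircleData (l₁ + 1) (l₂ + 1) where
  D := {x | x ∈ A.D ∧ ε ^ 2 < (x 0 - p 0) ^ 2 + (x 1 - p 1) ^ 2}
  center := Fin.snoc (α := fun _ => Plane) A.center p
  radius := Fin.snoc (α := fun _ => ℝ) A.radius ε
  inside := Fin.snoc (α := fun _ => Bool) A.inside false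
  cls := Fin.snoc (α := fun _ => Fin (l₂ + 1)) (fun j => (A.cls j).castSucc) (Fin.last l₂)

section AddCircle

variable (A : CircleData l₁ l₂) (p : Plane) (ε : ℝ)

@[simp] lemma addCircle_center_castSucc (j : Fin l₁) :
    (A.addCircle p ε).center j.castSucc = A.center j := by simp [addCircle]

@[simp] lemma addCircle_radius_castSucc (j : Fin l₁) :
    (A.addCircle p ε).radius j.castSucc = A.radius j := by simp [addCircle]

@[simp] lemma addCircle_inside_castSucc (j : Fin l₁) :
    (A.addCircle p ε).inside j.castSucc = A.inside j := by simp [addCircle]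

@[simp] lemma addCircle_cls_castSucc (j : Fin l₁) :
    (A.addCircle p ε).cls j.castSucc = (A.cls j).castSucc := by simp [addCircle]

@[simp] lemma addCircle_center_last : (A.addCircle p ε).center (Fin.last l₁) = p := by
  simp [addCircle]

@[simp] lemma addCircle_radius_last : (A.addCircle p ε).radius (Fin.last l₁) = ε := by
  simp [addCircle]

@[simp] lemma addCircle_inside_last : (A.addCircle p ε).inside (Fin.last l₁) = false := by
  simp [addCircle]

@[simp] lemma addCircle_cls_last : (A.addCircle p ε).cls (Fin.last l₁) = Fin.last l₂ := by
  simp [addCircle]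

@[simp] lemma addCircle_f_castSucc (j : Fin l₁) (x : Plane) :
    (A.addCircle p ε).f j.castSucc x = A.f j x := by
  simp [f_eq, sgn]

lemma addCircle_f_last (x : Plane) :
    (A.addCircle p ε).f (Fin.last l₁) x = (x 0 - p 0) ^ 2 + (x 1 - p 1) ^ 2 - ε ^ 2 := by
  simp [f_eq, sgn]

@[simp] lemma addCircle_circle_castSucc (j : Fin l₁) :
    (A.addCircle p ε).circle j.castSucc = A.circle j := by
  simp [circle]

lemma addCircle_classProd_castSucc (i : Fin l₂) (x : Plane) :
    (A.addCircle p ε).classProd i.castSucc x = A.classProd i x := by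
  unfold classProd
  rw [Finset.prod_filter, Finset.prod_filter, Fin.prod_univ_castSucc]
  simp [Fin.castSucc_inj, (Fin.castSucc_lt_last i).ne']

lemma addCircle_classProd_last (x : Plane) :
    (A.addCircle p ε).classProd (Fin.last l₂) x = (A.addCircle p ε).f (Fin.last l₁) x := by
  unfold classProd
  rw [Finset.prod_filter, Fin.prod_univ_castSucc]
  simp [(Fin.castSucc_lt_last _).ne]

lemma mem_addCircle_D (x : Plane) :
    x ∈ (A.addCircle p ε).D ↔ x ∈ A.D ∧ ε ^ 2 < (x 0 - p 0) ^ 2 + (x 1 - p 1) ^ 2 := Iff.rfl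

end AddCircle

/-- The disc of radius `ε` around the point `p` of `S_j` lies in a larger disc of radius `ρ` in
which the region is one side of `S_j`, and which avoids the horizontal and vertical axes of
`S_j`. -/
structure IsSmallDisc (A : CircleData l₁ l₂) (j : Fin l₁) (p : Plane) (ρ ε : ℝ) : Prop where
  f_eq_zero : A.f j p = 0
  pos : 0 < ε
  lt : ε < ρ
  lt_fst : ρ < |p 0 - A.center j 0|
  lt_snd : ρ < |p 1 - A.center j 1|
  mem_iff : ∀ x : Plane, (x 0 - p 0) ^ 2 + (x 1 - p 1) ^ 2 < ρ ^ 2 →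
    (x ∈ closure A.D ↔ 0 ≤ A.f j x) ∧ ∀ k, k ≠ j → 0 < A.f k x

namespace IsSmallDisc

variable {A : CircleData l₁ l₂} {j : Fin l₁} {p : Plane} {ρ ε : ℝ}

lemma sq_lt (h : A.IsSmallDisc j p ρ ε) : ε ^ 2 < ρ ^ 2 := by
  nlinarith [h.pos, h.lt]

lemma mem_closure (h : A.IsSmallDisc j p ρ ε) : p ∈ closure A.D :=
  (h.mem_iff p (by
    have : 0 < ρ := h.pos.trans h.lt
    rw [sub_self, sub_self]; nlinarith)).1.2 h.f_eq_zero.ge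

/-- The distance from `p` to the vertical axis of `S_j` exceeds `ρ` and is at most the radius. -/
lemma lt_radius (h : A.IsSmallDisc j p ρ ε) : ρ ^ 2 < A.radius j ^ 2 := by
  have h1 := (A.f_eq_zero_iff j p).1 h.f_eq_zero
  have h2 : ρ ^ 2 < (p 0 - A.center j 0) ^ 2 := by
    rw [← sq_abs (p 0 - A.center j 0)]
    nlinarith [h.lt_fst, h.pos, h.lt]
  nlinarith [sq_nonneg (p 1 - A.center j 1)]

lemma eq_of_f_eq_zero (h : A.IsSmallDisc j p ρ ε) {x : Plane}
    (hx : (x 0 - p 0) ^ 2 + (x 1 - p 1) ^ 2 = ε ^ 2) {k : Fin l₁} (hk : A.f k x = 0) : k = j := by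
  by_contra hkj
  exact ((h.mem_iff x (hx ▸ h.sq_lt)).2 k hkj).ne' hk

/-- The new circle can meet only `S_j`, so triple points do not arise. With `n` the vector from the
centre of `S_j` to `p` and `v` that from `p` to `x`, lying on both circles gives `2 * ⟨n, v⟩ = -ε ^
2`. If the gradients were dependent, `v` would be parallel to `n`, and Lagrange's identity would
force `ε` to be the diameter of `S_j`, while `ε < ρ` is less than its radius. -/
lemma transverseAt (h : A.IsSmallDisc j p ρ ε) {x : Plane} (hx : A.TransverseAt x) :
    (A.addCircle p ε).TransverseAt x := by
  have hnew : ∀ k, A.f k x = 0 → (A.addCircle p ε).f (Fin.last l₁) x = 0 →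
      k = j ∧ (A.addCircle p ε).det k.castSucc (Fin.last l₁) x ≠ 0 := by
    intro k hk hl
    rw [addCircle_f_last, sub_eq_zero] at hl
    obtain rfl := h.eq_of_f_eq_zero hl hk
    refine ⟨rfl, fun hd => ?_⟩
    unfold det at hd
    simp only [addCircle_center_castSucc, addCircle_center_last] at hd
    have h1 := (A.f_eq_zero_iff k p).1 h.f_eq_zero
    have h2 := (A.f_eq_zero_iff k x).1 hk
    have h3 := h.lt_radius
    have h4 := h.sq_lt
    have hε : 0 < ε ^ 2 := by have := h.pos; positivity
    set n0 := p 0 - A.center k 0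
    set n1 := p 1 - A.center k 1
    set v0 := x 0 - p 0
    set v1 := x 1 - p 1
    have e0 : x 0 - A.center k 0 = n0 + v0 := by ring
    have e1 : x 1 - A.center k 1 = n1 + v1 := by ring
    rw [e0, e1] at hd h2
    have h5 : n0 * v1 - n1 * v0 = 0 := by linarith
    have h6 : 2 * (n0 * v0 + n1 * v1) = -ε ^ 2 := by linarith
    have h7 : (n0 * v0 + n1 * v1) ^ 2 = A.radius k ^ 2 * ε ^ 2 := by
      rw [← h1, ← hl]
      linear_combination (-(n0 * v1 - n1 * v0)) * h5
    have h8 : ε ^ 2 * ε ^ 2 = 4 * A.radius k ^ 2 * ε ^ 2 := by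
      linear_combination 4 * h7 - (2 * (n0 * v0 + n1 * v1) - ε ^ 2) * h6
    nlinarith
  have hdet : ∀ a b, (A.addCircle p ε).det a b x = -(A.addCircle p ε).det b a x := by
    intro a b; unfold det; ring
  constructor
  · intro a b hab ha hb
    induction a using Fin.lastCases with
    | last =>
      induction b using Fin.lastCases with
      | last => exact absurd rfl hab
      | cast b =>
        rw [addCircle_f_castSucc] at hb
        rw [hdet, neg_ne_zero]
        exact (hnew b hb ha).2
    | cast a =>
      rw [addCircle_f_castSucc] at ha
      induction b using Fin.lastCases with
      | last => exact (hnew a ha hb).2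
      | cast b =>
        rw [addCircle_f_castSucc] at hb
        have := hx.1 a b (fun hh => hab (by rw [hh])) ha hb
        unfold det at this ⊢
        simpa using this
  · intro a b c hab hac hbc ha hb hc
    induction a using Fin.lastCases with
    | last =>
      induction b using Fin.lastCases with
      | last => exact hab rfl
      | cast b =>
        induction c using Fin.lastCases with
        | last => exact hac rfl
        | cast c =>
          rw [addCircle_f_castSucc] at hb hc
          exact hbc (by rw [(hnew b hb ha).1, (hnew c hc ha).1])
    | cast a =>
      rw [addCircle_f_castSucc] at ha
      induction b using Fin.lastCases with
      | last =>
        induction c using Fin.lastCases with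
        | last => exact hbc rfl
        | cast c =>
          rw [addCircle_f_castSucc] at hc
          exact hac (by rw [(hnew a ha hb).1, (hnew c hc hb).1])
      | cast b =>
        rw [addCircle_f_castSucc] at hb
        induction c using Fin.lastCases with
        | last => exact hab (by rw [(hnew a ha hc).1, (hnew b hb hc).1])
        | cast c =>
          rw [addCircle_f_castSucc] at hc
          exact hx.2 a b c (fun hh => hab (by rw [hh])) (fun hh => hac (by rw [hh]))
            (fun hh => hbc (by rw [hh])) ha hb hc

lemma radius_pos (h : A.IsSmallDisc j p ρ ε) (hA : A.IsAdmissible) (a : Fin (l₁ + 1)) :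
    0 < (A.addCircle p ε).radius a := by
  induction a using Fin.lastCases with
  | last => simpa using h.pos
  | cast a => simpa using hA.radius_pos a

lemma exists_open (hA : A.IsAdmissible) (p : Plane) (ε : ℝ) :
    ∃ U, IsOpen U ∧ closure A.D ⊆ U ∧
      (A.addCircle p ε).D = U ∩ {x | ∀ a, 0 < (A.addCircle p ε).f a x} := by
  obtain ⟨U, hU, hDU, h⟩ := hA.exists_open
  refine ⟨U, hU, hDU, ?_⟩
  ext x
  rw [mem_addCircle_D, h]
  constructor
  · rintro ⟨⟨h1, h2⟩, h3⟩
    refine ⟨h1, fun a => ?_⟩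
    induction a using Fin.lastCases with
    | last => rw [addCircle_f_last]; linarith
    | cast a => rw [addCircle_f_castSucc]; exact h2 a
  · rintro ⟨h1, h2⟩
    refine ⟨⟨h1, fun a => by simpa using h2 a.castSucc⟩, ?_⟩
    have := h2 (Fin.last l₁)
    rw [addCircle_f_last] at this
    linarith

/-- Points of the new circle in `closure D` are limits of the new region because the enlarged system
of circles is still transverse there. -/
lemma closure_eq (h : A.IsSmallDisc j p ρ ε) (hA : A.IsAdmissible) :
    closure (A.addCircle p ε).D =
      {x | x ∈ closure A.D ∧ ε ^ 2 ≤ (x 0 - p 0) ^ 2 + (x 1 - p 1) ^ 2} := by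
  have hc : Continuous fun x : Plane => (x 0 - p 0) ^ 2 + (x 1 - p 1) ^ 2 := by fun_prop
  refine Subset.antisymm ?_ ?_
  · intro x hx
    refine ⟨closure_mono (fun y hy => hy.1) hx, ?_⟩
    have : closure (A.addCircle p ε).D ⊆ {x | ε ^ 2 ≤ (x 0 - p 0) ^ 2 + (x 1 - p 1) ^ 2} :=
      closure_minimal (fun y hy => hy.2.le) (isClosed_le continuous_const hc)
    exact this hx
  · rintro x ⟨hx, hε⟩
    obtain ⟨U, hU, hDU, hD⟩ := exists_open hA p ε
    have := (h.transverseAt (hA.transverseAt hx)).eventually_mem_closure _ (h.radius_pos hA) hU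
      (hDU hx)
    rw [← hD] at this
    refine this.self_of_nhds fun a => ?_
    induction a using Fin.lastCases with
    | last => rw [addCircle_f_last]; linarith
    | cast a => rw [addCircle_f_castSucc]; exact hA.f_nonneg hx a

/-- Near `p`, the region outside the disc is an annular sector. -/
lemma isConnected_sector (h : A.IsSmallDisc j p ρ ε) (hA : A.IsAdmissible) :
    IsConnected ({x | (x 0 - p 0) ^ 2 + (x 1 - p 1) ^ 2 < ρ ^ 2} ∩ (A.addCircle p ε).D) := by
  set G := {x | (x 0 - p 0) ^ 2 + (x 1 - p 1) ^ 2 < ρ ^ 2} ∩ (A.addCircle p ε).D with hG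
  set r := A.radius j with hr
  have hr0 : 0 < r := hA.radius_pos j
  have hρ : 0 < ρ := h.pos.trans h.lt
  have hρr : ρ < r := lt_of_pow_lt_pow_left₀ 2 hr0.le h.lt_radius
  set s := A.sgn j with hs
  have hss : s * s = 1 := A.sgn_mul_sgn j
  set e0 := s * (p 0 - A.center j 0) / r with he0
  set e1 := s * (p 1 - A.center j 1) / r with he1
  have hn := (A.f_eq_zero_iff j p).1 h.f_eq_zero
  have he : e0 ^ 2 + e1 ^ 2 = 1 := by
    rw [he0, he1]
    field_simp
    rw [← hr] at hn
    linear_combination hn + ((p 0 - A.center j 0) ^ 2 + (p 1 - A.center j 1) ^ 2) * hss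
  -- Orthonormal coordinates at `p` whose first axis `e` is normal to `S_j` and points to the side
  -- where `f_j` is positive.
  let Q : ℝ → ℝ → Plane := fun a b => !₂[p 0 + a * e0 - b * e1, p 1 + a * e1 + b * e0]
  have hQ0 : ∀ a b, Q a b 0 = p 0 + a * e0 - b * e1 := fun _ _ => rfl
  have hQ1 : ∀ a b, Q a b 1 = p 1 + a * e1 + b * e0 := fun _ _ => rfl
  have hQsq : ∀ a b, (Q a b 0 - p 0) ^ 2 + (Q a b 1 - p 1) ^ 2 = a ^ 2 + b ^ 2 := by
    intro a b
    rw [hQ0, hQ1]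
    linear_combination (a ^ 2 + b ^ 2) * he
  have hQf : ∀ a b, A.f j (Q a b) = 2 * r * a + s * (a ^ 2 + b ^ 2) := by
    intro a b
    have h1 : r * e0 = s * (p 0 - A.center j 0) := by rw [he0]; field_simp
    have h2 : r * e1 = s * (p 1 - A.center j 1) := by rw [he1]; field_simp
    rw [f_eq, hQ0, hQ1]
    linear_combination s * hn - 2 * (a * e0 - b * e1) * h1 - 2 * (a * e1 + b * e0) * h2
      + (2 * r * a + s * (a ^ 2 + b ^ 2)) * he
  have hmem : ∀ a b, Q a b ∈ G ↔
      a ^ 2 + b ^ 2 < ρ ^ 2 ∧ ε ^ 2 < a ^ 2 + b ^ 2 ∧ 0 < 2 * r * a + s * (a ^ 2 + b ^ 2) := by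
    intro a b
    rw [hG, mem_inter_iff, mem_ofPred_eq, mem_addCircle_D, hQsq, ← hQf]
    constructor
    · rintro ⟨h1, h2, h3⟩
      exact ⟨h1, h3, hA.f_pos h2 j⟩
    · rintro ⟨h1, h2, h3⟩
      have hx := h.mem_iff (Q a b) (by rwa [hQsq])
      refine ⟨h1, hA.mem_of_f_pos (hx.1.2 h3.le) fun k => ?_, h2⟩
      by_cases hk : k = j
      · rwa [hk]
      · exact hx.2 k hk
  have hQc : Continuous fun t : ℝ × ℝ => Q t.1 t.2 := by fun_prop
  have hseg : ∀ t, ε < t → t < ρ → Q t 0 ∈ G := by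
    intro t h1 h2
    have ht : 0 < t := h.pos.trans h1
    rw [hmem]
    refine ⟨by nlinarith, by nlinarith [h.pos], ?_⟩
    rcases A.sgn_eq j with hs' | hs' <;> rw [hs, hs'] <;> nlinarith
  have hsurj : ∀ x : Plane, ∃ a b, x = Q a b := by
    intro x
    refine ⟨(x 0 - p 0) * e0 + (x 1 - p 1) * e1, -(x 0 - p 0) * e1 + (x 1 - p 1) * e0, ?_⟩
    ext i; fin_cases i
    · change x 0 = Q _ _ 0
      rw [hQ0]
      linear_combination (-(x 0 - p 0)) * he
    · change x 1 = Q _ _ 1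
      rw [hQ1]
      linear_combination (-(x 1 - p 1)) * he
  set t₀ := (ε + ρ) / 2 with ht₀
  have ht₀1 : ε < t₀ := by rw [ht₀]; linarith [h.lt]
  have ht₀2 : t₀ < ρ := by rw [ht₀]; linarith [h.lt]
  refine ⟨⟨_, hseg t₀ ht₀1 ht₀2⟩, ?_⟩
  refine isPreconnected_of_forall (Q t₀ 0) fun x hx => ?_
  obtain ⟨a, b, rfl⟩ := hsurj x
  obtain ⟨h1, h2, h3⟩ := (hmem a b).1 hx
  set t := √(a ^ 2 + b ^ 2) with ht
  have htt : t ^ 2 = a ^ 2 + b ^ 2 := Real.sq_sqrt (by positivity)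
  have ht0 : 0 ≤ t := Real.sqrt_nonneg _
  have hat : |a| ≤ t := abs_le_of_sq_le_sq (by rw [htt]; nlinarith [sq_nonneg b]) ht0
  have hat' : a ≤ t := (le_abs_self a).trans hat
  have htε : ε < t := lt_of_pow_lt_pow_left₀ 2 ht0 (by rwa [htt])
  have htρ : t < ρ := lt_of_pow_lt_pow_left₀ 2 hρ.le (by rwa [htt])
  obtain ⟨c, hc, hcb⟩ : ∃ c : ℝ, c ^ 2 = 1 ∧ c * √(t ^ 2 - a ^ 2) = b := by
    have : t ^ 2 - a ^ 2 = b ^ 2 := by rw [htt]; ring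
    rw [this, Real.sqrt_sq_eq_abs]
    rcases le_total 0 b with hb | hb
    · exact ⟨1, by norm_num, by rw [abs_of_nonneg hb, one_mul]⟩
    · exact ⟨-1, by norm_num, by rw [abs_of_nonpos hb]; ring⟩
  -- On the circle of radius `t` around `p`, `f_j` equals `2 * r * a + s * t ^ 2`, which increases
  -- with `a`. So the arc from the given point to the axis stays in the region, and the axis segment
  -- leads to `Q t₀ 0`. The sign `c` selects the half of the circle.
  set arc : Set Plane := (fun a' => Q a' (c * √(t ^ 2 - a' ^ 2))) '' Icc a t with harc
  set seg : Set Plane := (fun t => Q t 0) '' Ioo ε ρ with hsegdef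
  have harcp : IsPreconnected arc := isPreconnected_Icc.image _ (by
    have : Continuous fun a' => Q a' (c * √(t ^ 2 - a' ^ 2)) :=
      hQc.comp (by fun_prop : Continuous fun a' : ℝ => (a', c * √(t ^ 2 - a' ^ 2)))
    exact this.continuousOn)
  have hsegp : IsPreconnected seg := isPreconnected_Ioo.image _ (by
    have : Continuous fun t => Q t 0 := hQc.comp (by fun_prop : Continuous fun t : ℝ => (t, (0 : ℝ)))
    exact this.continuousOn)
  refine ⟨arc ∪ seg, union_subset ?_ ?_, Or.inr ⟨t₀, ⟨ht₀1, ht₀2⟩, rfl⟩,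
    Or.inl ⟨a, ⟨le_rfl, hat'⟩, by simp only [hcb]⟩,
    harcp.union (Q t 0) ⟨t, ⟨hat', le_rfl⟩, by simp⟩ ⟨t, ⟨htε, htρ⟩, rfl⟩ hsegp⟩
  · rintro _ ⟨a', ⟨ha1, ha2⟩, rfl⟩
    have hle : a' ^ 2 ≤ t ^ 2 := by
      have := (abs_le.1 hat).1
      exact sq_le_sq' (by linarith) ha2
    have hsum : a' ^ 2 + (c * √(t ^ 2 - a' ^ 2)) ^ 2 = a ^ 2 + b ^ 2 := by
      rw [mul_pow, hc, Real.sq_sqrt (by linarith), ← htt]; ring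
    simp only
    rw [hmem, hsum]
    exact ⟨h1, h2, by nlinarith⟩
  · rintro _ ⟨t', ⟨ht1, ht2⟩, rfl⟩
    exact hseg t' ht1 ht2

lemma isOpen_D (hA : A.IsAdmissible) (p : Plane) (ε : ℝ) : IsOpen (A.addCircle p ε).D := by
  have hc : Continuous fun x : Plane => (x 0 - p 0) ^ 2 + (x 1 - p 1) ^ 2 := by fun_prop
  exact hA.isOpen.inter (isOpen_lt continuous_const hc)

/-- The connected sector lies on one side of any splitting of the new region. Adding the points of
`D` in the disc of radius `ρ` to that side gives a splitting of the connected set `D`. -/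
lemma isConnected_D (h : A.IsSmallDisc j p ρ ε) (hA : A.IsAdmissible) :
    IsConnected (A.addCircle p ε).D := by
  have hc : Continuous fun x : Plane => (x 0 - p 0) ^ 2 + (x 1 - p 1) ^ 2 := by fun_prop
  have hs := h.isConnected_sector hA
  set N := {x : Plane | (x 0 - p 0) ^ 2 + (x 1 - p 1) ^ 2 < ρ ^ 2} with hN
  set G := (A.addCircle p ε).D with hG
  have hNo : IsOpen N := isOpen_lt hc continuous_const
  have hGo : IsOpen G := isOpen_D hA p ε
  refine ⟨hs.nonempty.mono inter_subset_right, ?_⟩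
  rw [isPreconnected_iff_subset_of_disjoint]
  intro U V hU hV hUV hd
  have key : ∀ U V : Set Plane, IsOpen U → IsOpen V → G ⊆ U ∪ V → G ∩ (U ∩ V) = ∅ →
      N ∩ G ⊆ U → G ⊆ U := by
    intro U V hU hV hUV hd hNU
    have h1 : A.D ⊆ (G ∩ U ∪ A.D ∩ N) ∪ (G ∩ V) := by
      intro x hx
      by_cases hxG : x ∈ G
      · rcases hUV hxG with h' | h'
        exacts [Or.inl (Or.inl ⟨hxG, h'⟩), Or.inr ⟨hxG, h'⟩]
      · refine Or.inl (Or.inr ⟨hx, ?_⟩)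
        have : ¬ ε ^ 2 < (x 0 - p 0) ^ 2 + (x 1 - p 1) ^ 2 := fun h' => hxG ⟨hx, h'⟩
        exact (not_lt.1 this).trans_lt h.sq_lt
    have h2 : Disjoint (G ∩ U ∪ A.D ∩ N) (G ∩ V) := by
      rw [Set.disjoint_left]
      rintro x (hx | hx) hxV
      · exact (Set.eq_empty_iff_forall_notMem.1 hd x) ⟨hx.1, hx.2, hxV.2⟩
      · exact (Set.eq_empty_iff_forall_notMem.1 hd x) ⟨hxV.1, hNU ⟨hx.2, hxV.1⟩, hxV.2⟩
    obtain ⟨y, hy⟩ := hs.nonempty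
    have h3 := hA.isConnected.isPreconnected.subset_left_of_subset_union
      ((hGo.inter hU).union (hA.isOpen.inter hNo)) (hGo.inter hV) h2 h1
      ⟨y, hy.2.1, Or.inr ⟨hy.2.1, hy.1⟩⟩
    intro x hx
    rcases h3 hx.1 with h' | h'
    exacts [h'.2, hNU ⟨h'.2, hx⟩]
  rcases isPreconnected_iff_subset_of_disjoint.1 hs.isPreconnected U V hU hV
    (inter_subset_right.trans hUV)
    (by rw [inter_assoc, hd, inter_empty]) with h' | h'
  · exact Or.inl (key U V hU hV hUV hd h')
  · exact Or.inr (key V U hV hU (by rwa [union_comm]) (by rwa [inter_comm V U]) h')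

lemma isAdmissible (h : A.IsSmallDisc j p ρ ε) (hA : A.IsAdmissible) :
    (A.addCircle p ε).IsAdmissible := by
  have hcl := h.closure_eq hA
  have hconn := h.isConnected_D hA
  obtain ⟨U, hU, hDU, hD⟩ := exists_open hA p ε
  have hsub : closure (A.addCircle p ε).D ⊆ closure A.D := hcl ▸ fun x hx => hx.1
  refine ⟨Nat.succ_pos _, Nat.succ_pos _, h.radius_pos hA, isOpen_D hA p ε, hconn,
    hA.isCompact_closure.of_isClosed_subset isClosed_closure hsub, hconn.closure,
    ⟨U, hU, hsub.trans hDU, fun V _ hDV hVU => ?_⟩, ?_, ?_, ?_⟩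
  · refine Subset.antisymm (fun x hx => ⟨hDV (subset_closure hx), ?_⟩) ?_
    · rw [hD] at hx
      exact hx.2
    rintro x ⟨hx, hx'⟩
    rw [hD]
    exact ⟨hVU hx, hx'⟩
  · rw [transverse_iff _ (h.radius_pos hA)]
    exact fun x hx => h.transverseAt (hA.transverseAt (hsub hx))
  · intro i
    induction i using Fin.lastCases with
    | last => exact ⟨Fin.last l₁, by simp⟩
    | cast i =>
      obtain ⟨k, rfl⟩ := hA.cls_surjective i
      exact ⟨k.castSucc, by simp⟩
  · rintro J - ⟨x, hx, hxD⟩ a ha b hb hab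
    simp only [mem_iInter] at hx
    have hxa := hx a ha
    have hxb := hx b hb
    rw [mem_circle_iff _ (h.radius_pos hA _)] at hxa hxb
    induction a using Fin.lastCases with
    | last =>
      induction b using Fin.lastCases with
      | last => rfl
      | cast b =>
        rw [addCircle_cls_last, addCircle_cls_castSucc] at hab
        exact absurd hab (Fin.castSucc_lt_last _).ne'
    | cast a =>
      induction b using Fin.lastCases with
      | last =>
        rw [addCircle_cls_last, addCircle_cls_castSucc] at hab
        exact absurd hab (Fin.castSucc_lt_last _).ne
      | cast b =>
        rw [addCircle_cls_castSucc, addCircle_cls_castSucc, Fin.castSucc_inj] at hab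
        rw [addCircle_f_castSucc] at hxa hxb
        by_contra hne
        exact hA.cls_ne (hsub hxD) (fun hh => hne (by rw [hh])) hxa hxb hab

end IsSmallDisc

end CircleData

/-! ### Slices of a strip within one edge -/

section SliceClass

open Set Topology

variable {K S : Set (ℝ × ℝ)} {t δ lo hi : ℝ} {b T : ℝ → ℝ}

lemma IsStrip.upper_mem (h : IsStrip K t δ lo hi b T) {u : ℝ} (hu : |u - t| < δ) :
    (u, T u) ∈ K :=
  (h.mem_iff u (T u) hu ((h.lo_lt u hu).trans (h.lower_lt_upper u hu)).le
    (h.lt_hi u hu).le).2 ⟨(h.lower_lt_upper u hu).le, le_rfl⟩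

lemma IsStrip.sliceClass_eq_upper (h : IsStrip K t δ lo hi b T) {u : ℝ} (hu : |u - t| < δ) :
    h.sliceClass u = reebMk (abscissa K) ⟨_, h.upper_mem hu⟩ := by
  rw [h.sliceClass_eq hu]
  exact h.reebMk_eq ⟨_, h.upper_mem hu⟩ hu
    ((h.lo_lt u hu).trans (h.lower_lt_upper u hu)).le (h.lt_hi u hu).le

lemma IsStrip.reebLevel_sliceClass (h : IsStrip K t δ lo hi b T) {u : ℝ} (hu : |u - t| < δ) :
    reebLevel (abscissa K) (h.sliceClass u) = u := by
  rw [h.sliceClass_eq hu]; rfl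

/-- The slices of a strip that avoids `S` all belong to the same edge. -/
lemma IsStrip.sliceClass_mem_edge (h : IsStrip K t δ lo hi b T)
    (hS : ∀ x ∈ S, |x.1 - t| < δ → ¬ (lo ≤ x.2 ∧ x.2 ≤ hi)) {e : Set (ReebSpace (abscissa K))}
    (he : e ∈ graphEdges (reebMk (abscissa K) '' (Subtype.val ⁻¹' S))) {u u' : ℝ}
    (hu : |u - t| < δ) (hu' : |u' - t| < δ) (hue : h.sliceClass u ∈ e) : h.sliceClass u' ∈ e := by
  set V := reebMk (abscissa K) '' (Subtype.val ⁻¹' S) with hV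
  have hI : ∀ u, u ∈ Ioo (t - δ) (t + δ) ↔ |u - t| < δ := fun u => by
    rw [abs_lt, mem_Ioo]; constructor <;> rintro ⟨h1, h2⟩ <;> constructor <;> linarith
  have hsub : h.sliceClass '' Ioo (t - δ) (t + δ) ⊆ Vᶜ := by
    rintro _ ⟨s, hs, rfl⟩ ⟨q, hq, hqs⟩
    have hs' := (hI s).1 hs
    rw [h.sliceClass_eq hs'] at hqs
    obtain ⟨h1, h2, h3⟩ := h.mem_of_reebMk_eq (q := ⟨_, h.lower_mem hs'⟩) hs' (h.lo_lt s hs').le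
      ((h.lower_lt_upper s hs').trans (h.lt_hi s hs')).le hqs.symm
    exact hS _ hq (by rw [h1]; exact hs') ⟨h2.le, h3.le⟩
  obtain ⟨w, hw, rfl⟩ := he
  rw [connectedComponentIn_eq hue]
  exact (isPreconnected_Ioo.image _ h.continuousOn_sliceClass).subset_connectedComponentIn
    (mem_image_of_mem _ ((hI u).2 hu)) hsub (mem_image_of_mem _ ((hI u').2 hu'))

end SliceClass

/-! ### Boundary charts on a given edge -/

namespace CircleData

open Set Topology Filter

variable {l₁ l₂ : ℕ} {A : CircleData l₁ l₂} {m : Fin l₂ → ℕ}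

lemma IsAdmissible.isFiniteGraph_reebVertices (hA : A.IsAdmissible) (hm : ∀ i, 0 < m i) :
    IsFiniteGraph (A.reebVertices m) := by
  obtain ⟨H, hH, -⟩ := hA.exists_homeomorph_momentReeb hm (one_mul 1) 0
  have := (hA.isFiniteGraph_chart (one_mul 1) 0).image H.symm
  rwa [← hH, ← image_comp, H.symm_comp_self, image_id] at this

lemma exists_momentManifold_over (hA : A.IsAdmissible) {x : Plane} (hx : x ∈ closure A.D) :
    ∃ z : A.momentManifold m, (z : Ambient m).1 = x := by
  let z : Ambient m := (x, fun i => EuclideanSpace.single 0 √(A.classProd i x))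
  refine ⟨⟨z, (mem_momentManifold_iff z).2 ⟨hx, fun i => ?_⟩⟩, rfl⟩
  simp [z, Real.sq_sqrt (hA.classProd_nonneg hx i)]

lemma planeChart_eq (σ : ℝ) (p : Plane) (q : ℝ × ℝ) :
    planeChart σ p q = planeChart 1 0 (p 0 + σ * q.1, p 1 + q.2) := by
  ext i; fin_cases i
  · change p 0 + σ * q.1 = (0 : Plane) 0 + 1 * (p 0 + σ * q.1)
    simp
  · change p 1 + q.2 = (0 : Plane) 1 + (p 1 + q.2)
    simp

/-- A strip in the standard chart stays a strip after recentring and possible reflection, over a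
symmetric interval that fits in the old one. -/
lemma IsStrip.planeChart {t δ lo hi : ℝ} {b T : ℝ → ℝ}
    (h : IsStrip (A.chartRegion 1 0) t δ lo hi b T) {σ : ℝ} (hσ : σ * σ = 1) (p : Plane) {R : ℝ}
    (hR : 0 < R) (hle : |p 0 - t| + R ≤ δ) :
    (∀ u, |u| < R → |p 0 + σ * u - t| < δ) ∧
    IsStrip (A.chartRegion σ p) 0 R (lo - p 1) (hi - p 1) (fun u => b (p 0 + σ * u) - p 1)
      (fun u => T (p 0 + σ * u) - p 1) := by
  have hu : ∀ u, |u| < R → |p 0 + σ * u - t| < δ := by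
    intro u hu
    have h1 : |σ * u| = |u| := by
      rw [abs_mul, show |σ| = 1 by
        rcases mul_self_eq_one_iff.1 hσ with rfl | rfl <;> simp, one_mul]
    have h2 := abs_add_le (p 0 - t) (σ * u)
    rw [show p 0 + σ * u - t = (p 0 - t) + σ * u by ring]
    linarith
  have h1 := h.continuous_lower
  have h2 := h.continuous_upper
  refine ⟨hu, hR, by fun_prop, by fun_prop, ?_, ?_, ?_, ?_⟩ <;> simp only [sub_zero] <;> intro u
  · intro hu'; linarith [h.lo_lt _ (hu u hu')]
  · intro hu'; linarith [h.lower_lt_upper _ (hu u hu')]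
  · intro hu'; linarith [h.lt_hi _ (hu u hu')]
  · intro y hu' h1 h2
    have := h.mem_iff _ (p 1 + y) (hu u hu') (by linarith) (by linarith)
    rw [chartRegion, mem_preimage, planeChart_eq]
    rw [chartRegion, mem_preimage] at this
    rw [this]
    constructor <;> rintro ⟨h3, h4⟩ <;> constructor <;> linarith

/-- As `D` is open, points slightly above would belong to it, against the description of the strip.
So the upper graph runs along the circles. -/
lemma upper_notMem_D {σ t δ lo hi : ℝ} {p : Plane} {b T : ℝ → ℝ}
    (hA : A.IsAdmissible) (h : IsStrip (A.chartRegion σ p) t δ lo hi b T) {u : ℝ}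
    (hu : |u - t| < δ) : planeChart σ p (u, T u) ∉ A.D := by
  intro hD
  have hc : Continuous fun s : ℝ => planeChart σ p (u, s) :=
    (continuous_planeChart σ p).comp (by fun_prop)
  have h1 : ∀ᶠ s in 𝓝 (T u), planeChart σ p (u, s) ∈ A.D :=
    hc.continuousAt (hA.isOpen.mem_nhds hD)
  have h2 : ∀ᶠ s in 𝓝[>] T u, (planeChart σ p (u, s) ∈ A.D ∧ s < hi) ∧ T u < s :=
    ((h1.and (gt_mem_nhds (h.lt_hi u hu))).filter_mono nhdsWithin_le_nhds).and self_mem_nhdsWithin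
  obtain ⟨s, ⟨h3, h4⟩, h5⟩ := h2.exists
  have h6 := (h.mem_iff u s hu ((h.lo_lt u hu).trans ((h.lower_lt_upper u hu).trans h5)).le
    h4.le).1 (subset_closure h3)
  linarith [h6.2]

/-- A chart centred at a boundary point `p` on `S_j`, in which `closure D` is near `p` the region
under an increasing function `T`, and an admissible radius `ε` for a disc to be removed. -/
structure IsBoundaryChart (A : CircleData l₁ l₂) (j : Fin l₁) (p : Plane) (σ R lo hi : ℝ)
    (b T : ℝ → ℝ) (ρ ε : ℝ) : Prop where
  sq : σ * σ = 1
  disc : A.IsSmallDisc j p ρ ε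
  strip : IsStrip (A.chartRegion σ p) 0 R lo hi b T
  upper_zero : T 0 = 0
  mono : StrictMonoOn T (Ioo (-R) R)
  abs_upper_lt : ∀ u, |u| < R → |T u| < |p 1 - A.center j 1|
  f_upper : ∀ u, |u| < R → A.f j (planeChart σ p (u, T u)) = 0
  sing : ∀ x ∈ A.chartSing σ p, |x.1| < R → ¬ (lo ≤ x.2 ∧ x.2 ≤ hi)
  lt_length : ε < R
  lt_hi : ε < hi
  lower_lt : ∀ u, |u| < R → b u < -ε

/-- Subtracting the equations at `u` and `u'` gives `(T u' + a) ^ 2 - (T u + a) ^ 2 = -(u' - u) * (u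
+ u' + 2 * σ * d)`. The size bounds give the last factor the sign of `σ * d` and each `T + a` the
sign of `a`, and these signs are opposite. -/
lemma strictMonoOn_of_circle {a d r σ R : ℝ} (hσ : σ * σ = 1) (hsign : σ * (a * d) < 0)
    (hRd : R ≤ |d|) {T : ℝ → ℝ} (hT : ∀ u, |u| < R → |T u| < |a|)
    (hc : ∀ u, |u| < R → (σ * u + d) ^ 2 + (T u + a) ^ 2 = r ^ 2) :
    StrictMonoOn T (Ioo (-R) R) := by
  intro u hu u' hu' huu
  have h1 : |u| < R := abs_lt.2 hu
  have h2 : |u'| < R := abs_lt.2 hu'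
  have h3 : (T u' + a) ^ 2 - (T u + a) ^ 2 = -(u' - u) * (u + u' + 2 * (σ * d)) := by
    linear_combination hc u' h2 - hc u h1 - (u' ^ 2 - u ^ 2) * hσ
  have h4 : |σ * d| = |d| := by
    rw [abs_mul, show |σ| = 1 by rcases mul_self_eq_one_iff.1 hσ with rfl | rfl <;> simp, one_mul]
  rw [← h4] at hRd
  have h5 : a * (σ * d) < 0 := by linarith
  have h6 := hT u h1
  have h7 := hT u' h2
  rcases lt_or_ge a 0 with ha | ha
  · have h8 : 0 < σ * d := by nlinarith
    rw [abs_of_pos h8] at hRd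
    rw [abs_of_neg ha, abs_lt] at h6 h7
    by_contra hn
    rw [not_lt] at hn
    nlinarith [mul_pos (sub_pos.2 huu) (show 0 < u + u' + 2 * (σ * d) by linarith [hu.1, hu'.1])]
  · have ha' : 0 < a := lt_of_le_of_ne ha (by rintro rfl; simp at h5)
    have h8 : σ * d < 0 := by nlinarith
    rw [abs_of_neg h8] at hRd
    rw [abs_of_pos ha', abs_lt] at h6 h7
    by_contra hn
    rw [not_lt] at hn
    nlinarith [mul_pos (sub_pos.2 huu) (show 0 < -(u + u' + 2 * (σ * d)) by linarith [hu.2, hu'.2])]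

lemma IsAdmissible.exists_isBoundaryChart_of_isStrip (hA : A.IsAdmissible) {t δ lo hi : ℝ}
    {b T : ℝ → ℝ} (h : IsStrip (A.chartRegion 1 0) t δ lo hi b T)
    (hS : ∀ x ∈ A.chartSing 1 0, |x.1 - t| < δ → ¬ (lo ≤ x.2 ∧ x.2 ≤ hi)) :
    ∃ (t' : ℝ) (j : Fin l₁) (σ R lo' hi' : ℝ) (b' T' : ℝ → ℝ) (ρ ε : ℝ), |t' - t| < δ ∧
      A.IsBoundaryChart j (planeChart 1 0 (t', T t')) σ R lo' hi' b' T' ρ ε := by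
  -- Avoiding the abscissas of all centres makes the boundary point no horizontal pole, so the
  -- tangent there is not horizontal.
  obtain ⟨t', ht', hne⟩ := (Ioo_infinite (show t - δ < t + δ by linarith [h.pos])).exists_notMem_finite
    (finite_range fun j => A.center j 0)
  have htδ : |t' - t| < δ := abs_lt.2 ⟨by linarith [ht'.1], by linarith [ht'.2]⟩
  set p := planeChart 1 0 (t', T t') with hp
  have hp0 : p 0 = t' := by simp [hp]
  have hp1 : p 1 = T t' := by simp [hp]
  have hpK : p ∈ closure A.D := h.upper_mem htδ
  have hpD : p ∉ A.D := upper_notMem_D hA h htδ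
  have hps : p ∉ A.sing := fun hs => hS (t', T t') hs htδ
    ⟨((h.lo_lt _ htδ).trans (h.lower_lt_upper _ htδ)).le, (h.lt_hi _ htδ).le⟩
  obtain ⟨j, hj⟩ := hA.exists_f_eq_zero hpK hpD
  have huniq : ∀ k, A.f k p = 0 → k = j := by
    intro k hk
    by_contra hkj
    exact hps ⟨hpK, Or.inl ⟨k, j, hkj, hk, hj⟩⟩
  set a := p 1 - A.center j 1 with ha
  set d := p 0 - A.center j 0 with hd
  have ha0 : a ≠ 0 := fun h0 => hps ⟨hpK, Or.inr ⟨j, hj, sub_eq_zero.1 h0⟩⟩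
  have hd0 : d ≠ 0 := fun h0 => hne ⟨j, by rw [← hp0]; exact (sub_eq_zero.1 h0).symm⟩
  -- The slope of the circle at `p` is `-d / a`; the reflection is used exactly when it is negative.
  obtain ⟨σ, hσ, hsign⟩ : ∃ σ : ℝ, σ * σ = 1 ∧ σ * (a * d) < 0 := by
    rcases lt_or_gt_of_ne (mul_ne_zero ha0 hd0) with h' | h'
    · exact ⟨1, by norm_num, by linarith⟩
    · exact ⟨-1, by norm_num, by linarith⟩
  obtain ⟨ρ₀, hρ₀, hball⟩ := Metric.eventually_nhds_iff.1 (hA.eventually_mem_closure_iff hpK huniq)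
  have hball' : ∀ x : Plane, (x 0 - p 0) ^ 2 + (x 1 - p 1) ^ 2 < ρ₀ ^ 2 →
      (x ∈ closure A.D ↔ 0 ≤ A.f j x) ∧ ∀ k, k ≠ j → 0 < A.f k x := by
    intro x hx
    refine hball ?_
    rw [EuclideanSpace.dist_eq, Real.sqrt_lt' hρ₀]
    simpa [Fin.sum_univ_two, Real.dist_eq, sq_abs] using hx
  set ρ := min ρ₀ (min |a| |d|) / 2 with hρ
  have hmin : 0 < min ρ₀ (min |a| |d|) := by positivity
  have hρpos : 0 < ρ := by positivity
  have hρ1 : ρ ≤ ρ₀ / 2 := by rw [hρ]; linarith [min_le_left ρ₀ (min |a| |d|)]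
  have hρ2 : ρ < |a| := by
    linarith [(min_le_right ρ₀ (min |a| |d|)).trans (min_le_left _ _)]
  have hρ3 : ρ < |d| := by
    linarith [(min_le_right ρ₀ (min |a| |d|)).trans (min_le_right _ _)]
  set T' : ℝ → ℝ := fun u => T (p 0 + σ * u) - p 1 with hT'
  set b' : ℝ → ℝ := fun u => b (p 0 + σ * u) - p 1 with hb'
  have hT'c : Continuous T' := by have := h.continuous_upper; fun_prop
  have hb'c : Continuous b' := by have := h.continuous_lower; fun_prop
  have hT'0 : T' 0 = 0 := by simp [hT', hp0, hp1]
  have hb'0 : b' 0 < 0 := by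
    simp only [hb', mul_zero, add_zero, hp0, hp1]
    linarith [h.lower_lt_upper t' htδ]
  have hhi : 0 < hi - p 1 := by rw [hp1]; linarith [h.lt_hi t' htδ]
  obtain ⟨R₁, hR₁, hR⟩ : ∃ R₁ > 0, ∀ u : ℝ, |u| < R₁ → |T' u| < ρ ∧ b' u < b' 0 / 2 := by
    have h1 : ∀ᶠ u in 𝓝 (0 : ℝ), |T' u| < ρ ∧ b' u < b' 0 / 2 :=
      (hT'c.abs.continuousAt.eventually (gt_mem_nhds (by simpa [hT'0] using hρpos))).and
        (hb'c.continuousAt.eventually (gt_mem_nhds (by linarith)))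
    obtain ⟨R₁, hR₁, h2⟩ := Metric.eventually_nhds_iff.1 h1
    exact ⟨R₁, hR₁, fun u hu => h2 (by simpa using hu)⟩
  set R := min R₁ (min (δ - |t' - t|) ρ) with hRdef
  have hRpos : 0 < R := lt_min hR₁ (lt_min (by linarith) hρpos)
  have hR1 : R ≤ R₁ := min_le_left _ _
  have hR2 : R ≤ δ - |t' - t| := (min_le_right _ _).trans (min_le_left _ _)
  have hR3 : R ≤ ρ := (min_le_right _ _).trans (min_le_right _ _)
  obtain ⟨hsub, hst⟩ := IsStrip.planeChart h hσ p hRpos (by rw [hp0]; linarith)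
  -- The disc must fit over the interval, below the top of the box and above the lower boundary,
  -- which stays under `b' 0 / 2` on the interval.
  set ε := min R (min (hi - p 1) (-b' 0 / 2)) / 2 with hε
  have hmin' : 0 < min R (min (hi - p 1) (-b' 0 / 2)) :=
    lt_min hRpos (lt_min hhi (by linarith))
  have hεpos : 0 < ε := by positivity
  have hε1 : ε < R := by linarith [min_le_left R (min (hi - p 1) (-b' 0 / 2))]
  have hε2 : ε < hi - p 1 := by
    linarith [(min_le_right R (min (hi - p 1) (-b' 0 / 2))).trans (min_le_left _ _)]
  have hε3 : ε < -b' 0 / 2 := by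
    linarith [(min_le_right R (min (hi - p 1) (-b' 0 / 2))).trans (min_le_right _ _)]
  -- Points of the upper graph are boundary points, so some circle passes through them, and in the
  -- ball of radius `ρ₀` only `S_j` can.
  have hf : ∀ u, |u| < R → A.f j (planeChart σ p (u, T' u)) = 0 := by
    intro u hu
    have hu' : |u - 0| < R := by simpa using hu
    have h1 := (hR u (hu.trans_le hR1)).1
    have hx := hball' (planeChart σ p (u, T' u)) (by
      simp only [planeChart_zero, planeChart_one, add_sub_cancel_left]
      have e1 : (σ * u) ^ 2 = u ^ 2 := by linear_combination u ^ 2 * hσ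
      have e2 : u ^ 2 < ρ ^ 2 := sq_lt_sq' (by linarith [(abs_lt.1 hu).1]) (by linarith [(abs_lt.1 hu).2])
      have e3 : T' u ^ 2 < ρ ^ 2 := sq_lt_sq' (abs_lt.1 h1).1 (abs_lt.1 h1).2
      nlinarith)
    obtain ⟨k, hk⟩ := hA.exists_f_eq_zero (hst.upper_mem hu') (upper_notMem_D hA hst hu')
    by_cases hkj : k = j
    · rwa [hkj] at hk
    · exact absurd hk (hx.2 k hkj).ne'
  refine ⟨t', j, σ, R, lo - p 1, hi - p 1, b', T', ρ, ε, htδ, hσ, ⟨hj, hεpos, hε1.trans_le hR3,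
    hρ3, hρ2, fun x hx => hball' x (hx.trans_le (by nlinarith))⟩, hst, hT'0, ?_,
    fun u hu => (hR u (hu.trans_le hR1)).1.trans hρ2, hf, ?_, hε1, hε2, fun u hu => ?_⟩
  · refine strictMonoOn_of_circle (r := A.radius j) hσ hsign (hR3.trans hρ3.le)
      (fun u hu => (hR u (hu.trans_le hR1)).1.trans hρ2) fun u hu => ?_
    have := (A.f_eq_zero_iff j _).1 (hf u hu)
    simp only [planeChart_zero, planeChart_one] at this
    rw [← this]
    ring
  · rintro x hx hxR ⟨h1, h2⟩
    rw [chartSing, mem_preimage, planeChart_eq] at hx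
    exact hS _ hx (hsub _ hxR) ⟨by simp only; linarith, by simp only; linarith⟩
  · linarith [(hR u (hu.trans_le hR1)).2]

/-- Every edge of the Reeb graph contains the class of the origin of some boundary chart. -/
lemma IsAdmissible.exists_isBoundaryChart (hA : A.IsAdmissible) (hm : ∀ i, 0 < m i)
    {e : Set (A.momentReeb m)} (he : e ∈ graphEdges (A.reebVertices m)) :
    ∃ (j : Fin l₁) (p : Plane) (σ R lo hi : ℝ) (b T : ℝ → ℝ) (ρ ε : ℝ),
      A.IsBoundaryChart j p σ R lo hi b T ρ ε ∧
      ∃ z : A.momentManifold m, (z : Ambient m).1 = p ∧ reebMk _ z ∈ e := by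
  obtain ⟨H, hH, hHmk⟩ := hA.exists_homeomorph_momentReeb hm (one_mul 1) 0
  have he' : H '' e ∈ graphEdges (reebMk (abscissa (A.chartRegion 1 0)) ''
      (Subtype.val ⁻¹' A.chartSing 1 0)) := by
    rw [← hH, graphEdges_image]
    exact mem_image_of_mem _ he
  obtain ⟨w, hw, hwe⟩ := he'
  obtain ⟨⟨⟨t, y₀⟩, hq⟩, rfl⟩ := reebMk_surjective _ w
  obtain ⟨δ, lo, hi, b, T, hst, hb, hT, hS⟩ := exists_strip (hA.isCompact_chartRegion (one_mul 1) 0)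
    (finite_chartSing hA (one_mul 1) 0).isClosed (fun _ hq => hq.1) (hA.hasRegularSlices 1 0) hq
    (fun s hs hsS => hw ⟨⟨(t, s), hs s right_mem_uIcc⟩, hsS,
      ((reebMk_abscissa_eq_iff ⟨(t, y₀), hq⟩ ⟨(t, s), hs s right_mem_uIcc⟩).2 ⟨rfl, hs⟩).symm⟩)
  have ht : |t - t| < δ := by simpa using hst.pos
  obtain ⟨t', j, σ, R, lo', hi', b', T', ρ, ε, ht', hch⟩ :=
    hA.exists_isBoundaryChart_of_isStrip hst hS
  obtain ⟨z, hz⟩ := exists_momentManifold_over (m := m) hA hch.disc.mem_closure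
  refine ⟨j, _, σ, R, lo', hi', b', T', ρ, ε, hch, z, hz, ?_⟩
  have h1 : hst.sliceClass t ∈ H '' e := by
    rw [hwe, hst.sliceClass_eq ht, hst.reebMk_eq ⟨_, hq⟩ ht ((hst.lo_lt t ht).le.trans hb)
      (hT.trans (hst.lt_hi t ht).le)]
    exact mem_connectedComponentIn hw
  have h2 := hst.sliceClass_mem_edge hS ⟨_, hw, hwe⟩ ht ht' h1
  rw [hst.sliceClass_eq_upper ht', ← hHmk z _ (by rw [hz, planeCoord_planeChart (one_mul 1)])] at h2
  obtain ⟨w', hw', hww⟩ := h2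
  exact H.injective hww ▸ hw'

end CircleData

/-! ### Corners, poles and the Reeb graph of the new region -/

namespace CircleData

open Set Topology Filter

variable {l₁ l₂ : ℕ} {A : CircleData l₁ l₂} {m : Fin l₂ → ℕ}

namespace IsSmallDisc

variable {j : Fin l₁} {p : Plane} {ρ ε : ℝ}

lemma ssubset (h : A.IsSmallDisc j p ρ ε) : (A.addCircle p ε).D ⊂ A.D := by
  refine ⟨fun x hx => hx.1, fun hsub => ?_⟩
  have hc : Continuous fun x : Plane => (x 0 - p 0) ^ 2 + (x 1 - p 1) ^ 2 := by fun_prop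
  obtain ⟨x, hx, hxD⟩ := mem_closure_iff.1 h.mem_closure
    {x | (x 0 - p 0) ^ 2 + (x 1 - p 1) ^ 2 < ε ^ 2} (isOpen_lt hc continuous_const)
    (by have := pow_pos h.pos 2; simpa using this)
  exact lt_asymm hx (hsub hxD).2

lemma classProd_nonneg_imp (h : A.IsSmallDisc j p ρ ε) (hA : A.IsAdmissible)
    (hD : ∀ x, (∀ i, 0 ≤ A.classProd i x) → x ∈ closure A.D) (x : Plane)
    (hx : ∀ i, 0 ≤ (A.addCircle p ε).classProd i x) : x ∈ closure (A.addCircle p ε).D := by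
  rw [h.closure_eq hA]
  refine ⟨hD x fun i => by simpa [addCircle_classProd_castSucc] using hx i.castSucc, ?_⟩
  have := hx (Fin.last l₂)
  rw [addCircle_classProd_last, addCircle_f_last] at this
  linarith

/-- A new corner lies on `S_j` at distance `ε` from `p`. It is no vertical pole of `S_j`, whose
horizontal axis is further away than `ρ`. Were it a pole of the new circle, it would have the height
of `p`; but `S_j` meets that height only at `p` and at its mirror image, at distance more than `2 *
ρ`. -/
lemma snd_ne_center (h : A.IsSmallDisc j p ρ ε) (hA : A.IsAdmissible)
    (hpole : ∀ x ∈ closure A.D, ∀ j k, j ≠ k → A.f j x = 0 → A.f k x = 0 → x 1 ≠ A.center j 1)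
    (x : Plane) (hx : x ∈ closure (A.addCircle p ε).D) (a b : Fin (l₁ + 1)) (hab : a ≠ b)
    (ha : (A.addCircle p ε).f a x = 0) (hb : (A.addCircle p ε).f b x = 0) :
    x 1 ≠ (A.addCircle p ε).center a 1 := by
  rw [h.closure_eq hA] at hx
  have hlt := h.pos
  have hlt' := h.lt
  have key : ∀ k, A.f k x = 0 → (A.addCircle p ε).f (Fin.last l₁) x = 0 →
      x 1 ≠ A.center k 1 ∧ x 1 ≠ p 1 := by
    intro k hk hl
    rw [addCircle_f_last, sub_eq_zero] at hl
    obtain rfl := h.eq_of_f_eq_zero hl hk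
    have h1 := (A.f_eq_zero_iff k p).1 h.f_eq_zero
    rw [f_eq_zero_iff] at hk
    constructor <;> intro h2
    · rw [h2] at hl
      have h3 := h.lt_snd
      have h4 : ρ ^ 2 < (p 1 - A.center k 1) ^ 2 := by
        rw [← sq_abs (p 1 - _)]; nlinarith
      nlinarith [sq_nonneg (x 0 - p 0)]
    · rw [h2] at hl hk
      have h3 := h.lt_fst
      have h4 : ρ ^ 2 < (p 0 - A.center k 0) ^ 2 := by
        rw [← sq_abs (p 0 - _)]; nlinarith
      have h5 : (x 0 - p 0) ^ 2 = ε ^ 2 := by linarith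
      have h6 : (x 0 - p 0) * ((x 0 - p 0) + 2 * (p 0 - A.center k 0)) = 0 := by
        linear_combination hk - h1
      rcases mul_eq_zero.1 h6 with h7 | h7
      · rw [h7] at h5; nlinarith
      · have : x 0 - p 0 = -2 * (p 0 - A.center k 0) := by linarith
        rw [this] at h5
        nlinarith
  induction a using Fin.lastCases with
  | last =>
    induction b using Fin.lastCases with
    | last => exact absurd rfl hab
    | cast b =>
      rw [addCircle_f_castSucc] at hb
      rw [addCircle_center_last]
      exact (key b hb ha).2
  | cast a =>
    rw [addCircle_f_castSucc] at ha
    rw [addCircle_center_castSucc]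
    induction b using Fin.lastCases with
    | last => exact (key a ha hb).1
    | cast b =>
      rw [addCircle_f_castSucc] at hb
      exact hpole x hx.1 a b (fun hh => hab (by rw [hh])) ha hb

lemma mem_frontier_of_f_eq_zero (h : A.IsSmallDisc j p ρ ε) (hA : A.IsAdmissible) {x : Plane}
    {k : Fin l₁} (hx : x ∈ closure (A.addCircle p ε).D) (hk : A.f k x = 0) :
    x ∈ (closure (A.addCircle p ε).D \ (A.addCircle p ε).D) ∩
      (A.addCircle p ε).circle k.castSucc := by
  refine ⟨⟨hx, fun hD => ?_⟩, ?_⟩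
  · have := (h.isAdmissible hA).f_pos hD k.castSucc
    rw [addCircle_f_castSucc] at this
    exact this.ne' hk
  · rwa [addCircle_circle_castSucc, mem_circle_iff _ (hA.radius_pos k)]

end IsSmallDisc

namespace IsBoundaryChart

variable {j : Fin l₁} {p : Plane} {σ R lo hi : ℝ} {b T : ℝ → ℝ} {ρ ε : ℝ}

lemma sq_add_sq (hσ : σ * σ = 1) (q : ℝ × ℝ) :
    (planeChart σ p q 0 - p 0) ^ 2 + (planeChart σ p q 1 - p 1) ^ 2 = q.1 ^ 2 + q.2 ^ 2 := by
  simp only [planeChart_zero, planeChart_one]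
  linear_combination q.1 ^ 2 * hσ

lemma addCircle_f_last_planeChart (hσ : σ * σ = 1) (q : ℝ × ℝ) :
    (A.addCircle p ε).f (Fin.last l₁) (planeChart σ p q) = q.1 ^ 2 + q.2 ^ 2 - ε ^ 2 := by
  rw [addCircle_f_last, sq_add_sq hσ]

lemma chartRegion_eq (h : A.IsBoundaryChart j p σ R lo hi b T ρ ε) (hA : A.IsAdmissible) :
    (A.addCircle p ε).chartRegion σ p = removeDisc (A.chartRegion σ p) ε := by
  ext q
  rw [chartRegion, mem_preimage, h.disc.closure_eq hA, mem_ofPred_eq, sq_add_sq h.sq]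
  rfl

lemma abs_sub_zero_lt {u : ℝ} (hu : |u| < R) : |u - 0| < R := by simpa using hu

/-- Inside the removed disc, `S_j` is the graph of `T`. -/
lemma eq_upper (h : A.IsBoundaryChart j p σ R lo hi b T ρ ε) {q : ℝ × ℝ}
    (hq : q.1 ^ 2 + q.2 ^ 2 = ε ^ 2) (hf : A.f j (planeChart σ p q) = 0) : q.2 = T q.1 := by
  have hε := h.disc.pos
  have h1 : |q.1| ≤ ε := abs_le_of_sq_le_sq (by nlinarith [sq_nonneg q.2]) hε.le
  have h2 : |q.2| ≤ ε := abs_le_of_sq_le_sq (by nlinarith [sq_nonneg q.1]) hε.le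
  have hu : |q.1| < R := h1.trans_lt h.lt_length
  have hT := h.abs_upper_lt _ hu
  have h3 := (A.f_eq_zero_iff j _).1 hf
  have h4 := (A.f_eq_zero_iff j _).1 (h.f_upper _ hu)
  simp only [planeChart_zero, planeChart_one] at h3 h4
  have h5 : (q.2 - T q.1) * (q.2 + T q.1 + 2 * (p 1 - A.center j 1)) = 0 := by
    linear_combination h3 - h4
  rcases mul_eq_zero.1 h5 with h6 | h6
  · linarith
  · exfalso
    have h7 : |q.2| < |p 1 - A.center j 1| := h2.trans_lt (h.disc.lt.trans h.disc.lt_snd)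
    have h8 : 2 * |p 1 - A.center j 1| = |q.2 + T q.1| := by
      rw [show q.2 + T q.1 = -(2 * (p 1 - A.center j 1)) by linarith, abs_neg, abs_mul, abs_two]
    linarith [abs_add_le q.2 (T q.1)]

variable {xl xr : ℝ}

lemma corner_mem (h : A.IsBoundaryChart j p σ R lo hi b T ρ ε) (hA : A.IsAdmissible) {u : ℝ}
    (hu : |u| < R) (hE : u ^ 2 + T u ^ 2 = ε ^ 2) :
    planeChart σ p (u, T u) ∈ closure (A.addCircle p ε).D := by
  have : (u, T u) ∈ (A.addCircle p ε).chartRegion σ p := by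
    rw [h.chartRegion_eq hA]
    exact ⟨h.strip.upper_mem (abs_sub_zero_lt hu), hE.ge⟩
  exact this

/-- Old corners and poles avoid the box of the strip, hence the disc, so they all survive. New ones
are the two crossings with `S_j` and the right pole of the new circle. -/
lemma chartSing_eq (h : A.IsBoundaryChart j p σ R lo hi b T ρ ε) (hA : A.IsAdmissible)
    (hxl : |xl| < R) (hxr : |xr| < R) (hEl : xl ^ 2 + T xl ^ 2 = ε ^ 2)
    (hEr : xr ^ 2 + T xr ^ 2 = ε ^ 2)
    (huniq : ∀ u, |u| < R → u ^ 2 + T u ^ 2 = ε ^ 2 → u = xl ∨ u = xr) :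
    (A.addCircle p ε).chartSing σ p =
      A.chartSing σ p ∪ {(xl, T xl), (xr, T xr), (ε, 0)} := by
  have hε := h.disc.pos
  have hεR := h.lt_length
  have h0m : (0 : ℝ) ∈ Ioo (-R) R := ⟨by linarith, by linarith⟩
  have hεabs : |ε| < R := by rwa [abs_of_pos hε]
  have hcorner : ∀ (q : ℝ × ℝ) (k : Fin l₁), A.f k (planeChart σ p q) = 0 →
      (A.addCircle p ε).f (Fin.last l₁) (planeChart σ p q) = 0 →
      q ∈ ({(xl, T xl), (xr, T xr), (ε, 0)} : Set (ℝ × ℝ)) := by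
    intro q k hk hl
    rw [addCircle_f_last_planeChart h.sq, sub_eq_zero] at hl
    obtain rfl := h.disc.eq_of_f_eq_zero (by rw [sq_add_sq h.sq, hl]) hk
    have h2 := h.eq_upper hl hk
    have h1 : |q.1| < R :=
      (abs_le_of_sq_le_sq (by nlinarith [sq_nonneg q.2]) hε.le).trans_lt hεR
    rw [h2] at hl
    rcases huniq _ h1 hl with h3 | h3
    · left; exact Prod.ext h3 (by rw [h2, h3])
    · right; left; exact Prod.ext h3 (by rw [h2, h3])
  have hcmem : ∀ u, |u| < R → u ^ 2 + T u ^ 2 = ε ^ 2 →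
      (u, T u) ∈ (A.addCircle p ε).chartSing σ p := by
    intro u hu hE
    refine ⟨h.corner_mem hA hu hE, Or.inl ⟨j.castSucc, Fin.last l₁, (Fin.castSucc_lt_last j).ne,
      by rw [addCircle_f_castSucc]; exact h.f_upper u hu, ?_⟩⟩
    rw [addCircle_f_last_planeChart h.sq]
    simpa [sub_eq_zero] using hE
  ext q
  constructor
  · rintro ⟨hD, hs⟩
    have hD' := hD
    rw [h.disc.closure_eq hA] at hD'
    rcases hs with ⟨a, c, hac, ha, hc⟩ | ⟨a, ha, ha'⟩
    · induction a using Fin.lastCases with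
      | last =>
        induction c using Fin.lastCases with
        | last => exact absurd rfl hac
        | cast c =>
          rw [addCircle_f_castSucc] at hc
          exact Or.inr (hcorner q c hc ha)
      | cast a =>
        rw [addCircle_f_castSucc] at ha
        induction c using Fin.lastCases with
        | last => exact Or.inr (hcorner q a ha hc)
        | cast c =>
          rw [addCircle_f_castSucc] at hc
          exact Or.inl ⟨hD'.1, Or.inl ⟨a, c, fun hh => hac (by rw [hh]), ha, hc⟩⟩
    · induction a using Fin.lastCases with
      | last =>
        right; right; right
        rw [addCircle_f_last_planeChart h.sq, sub_eq_zero] at ha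
        rw [addCircle_center_last, planeChart_one, add_eq_left] at ha'
        rw [ha'] at ha
        have h1 : q.1 ^ 2 = ε ^ 2 := by linarith
        rcases sq_eq_sq_iff_eq_or_eq_neg.1 h1 with h2 | h2
        · exact Prod.ext h2 ha'
        -- The left pole `(-ε, 0)` lies above the curve, since `T` is negative to the left of the
        -- origin.
        · exfalso
          have hu : |q.1| < R := by rw [h2, abs_neg]; exact hεabs
          have h3 := (h.strip.mem_iff q.1 q.2 (abs_sub_zero_lt hu)
            (by linarith [h.strip.lo_lt _ (abs_sub_zero_lt hu), h.lower_lt _ hu])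
            (by linarith [h.lt_hi])).1 hD'.1
          have h4 := h.mono (by rw [h2]; exact ⟨by linarith, by linarith⟩) h0m
            (show q.1 < 0 by linarith)
          rw [h.upper_zero] at h4
          linarith [h3.2]
      | cast a =>
        rw [addCircle_f_castSucc] at ha
        rw [addCircle_center_castSucc] at ha'
        exact Or.inl ⟨hD'.1, Or.inr ⟨a, ha, ha'⟩⟩
  · rintro (hq | rfl | rfl | rfl)
    · refine ⟨?_, ?_⟩
      · rw [h.disc.closure_eq hA]
        refine ⟨hq.1, ?_⟩
        rw [sq_add_sq h.sq]
        by_contra hn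
        rw [not_le] at hn
        have h1 : |q.1| < ε := abs_lt_of_sq_lt_sq (by nlinarith [sq_nonneg q.2]) hε.le
        have h2 : |q.2| < ε := abs_lt_of_sq_lt_sq (by nlinarith [sq_nonneg q.1]) hε.le
        have hu := h1.trans hεR
        rw [abs_lt] at h2
        exact h.sing q hq hu
          ⟨by linarith [h.strip.lo_lt _ (abs_sub_zero_lt hu), h.lower_lt _ hu],
            by linarith [h.lt_hi]⟩
      · rcases hq.2 with ⟨a, c, hac, ha, hc⟩ | ⟨a, ha, ha'⟩
        · exact Or.inl ⟨a.castSucc, c.castSucc, fun hh => hac (Fin.castSucc_inj.1 hh),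
            by rwa [addCircle_f_castSucc], by rwa [addCircle_f_castSucc]⟩
        · exact Or.inr ⟨a.castSucc, by rwa [addCircle_f_castSucc],
            by rwa [addCircle_center_castSucc]⟩
    · exact hcmem xl hxl hEl
    · exact hcmem xr hxr hEr
    · refine ⟨?_, Or.inr ⟨Fin.last l₁, ?_, ?_⟩⟩
      · rw [h.disc.closure_eq hA]
        refine ⟨(h.strip.mem_iff ε 0 (abs_sub_zero_lt hεabs) ?_ ?_).2 ⟨?_, ?_⟩, ?_⟩
        · linarith [h.strip.lo_lt _ (abs_sub_zero_lt hεabs), h.lower_lt _ hεabs]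
        · linarith [h.lt_hi]
        · linarith [h.lower_lt _ hεabs]
        · have := h.mono h0m ⟨by linarith, hεR⟩ hε
          rw [h.upper_zero] at this
          exact this.le
        · rw [sq_add_sq h.sq]; simp
      · rw [addCircle_f_last_planeChart h.sq]; simp
      · simp

/-- Every common point of the two circles lies on the graph of `T`, because the other half of `S_j`
is too far from `p`; so the crossings of the curve are all of them. -/
lemma circle_inter_eq (h : A.IsBoundaryChart j p σ R lo hi b T ρ ε) (hA : A.IsAdmissible)
    (hxl : |xl| < R) (hxr : |xr| < R) (hEl : xl ^ 2 + T xl ^ 2 = ε ^ 2)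
    (hEr : xr ^ 2 + T xr ^ 2 = ε ^ 2)
    (huniq : ∀ u, |u| < R → u ^ 2 + T u ^ 2 = ε ^ 2 → u = xl ∨ u = xr) :
    (A.addCircle p ε).circle (Fin.last l₁) ∩ A.circle j =
      {planeChart σ p (xl, T xl), planeChart σ p (xr, T xr)} := by
  have hε := h.disc.pos
  have hmem : ∀ q, planeChart σ p q ∈ (A.addCircle p ε).circle (Fin.last l₁) ∩ A.circle j ↔
      q.1 ^ 2 + q.2 ^ 2 = ε ^ 2 ∧ A.f j (planeChart σ p q) = 0 := by
    intro q
    rw [mem_inter_iff, mem_circle_iff _ (h.disc.radius_pos hA _), mem_circle_iff _ (hA.radius_pos j),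
      addCircle_f_last_planeChart h.sq, sub_eq_zero]
  ext x
  rw [← planeChart_planeCoord h.sq p x]
  set q := planeCoord σ p x
  rw [hmem]
  constructor
  · rintro ⟨h1, h2⟩
    have h3 := h.eq_upper h1 h2
    have h4 : |q.1| < R :=
      (abs_le_of_sq_le_sq (by nlinarith [sq_nonneg q.2]) hε.le).trans_lt h.lt_length
    rw [h3] at h1
    rcases huniq _ h4 h1 with h5 | h5
    · left; rw [← h5, ← h3]
    · right; rw [← h5, ← h3]; rfl
  · rintro (h1 | h1) <;> rw [injective_planeChart h.sq p h1]
    · exact ⟨hEl, h.f_upper _ hxl⟩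
    · exact ⟨hEr, h.f_upper _ hxr⟩

/-- Removing the disc of a boundary chart subdivides an edge of the Reeb graph and attaches
an arc. -/
lemma exists_graphIsomorphic (h : A.IsBoundaryChart j p σ R lo hi b T ρ ε) (hA : A.IsAdmissible)
    (hm : ∀ i, 0 < m i) {m' : Fin (l₂ + 1) → ℕ} (hm' : ∀ i, 0 < m' i) {e : Set (A.momentReeb m)}
    (he : e ∈ graphEdges (A.reebVertices m)) {z : A.momentManifold m} (hz : (z : Ambient m).1 = p)
    (hze : reebMk _ z ∈ e) :
    ∃ v₁ ∈ e, ∃ v₂ ∈ e, v₁ ≠ v₂ ∧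
      GraphIsomorphic ((A.addCircle p ε).reebVertices m')
        (attachVertices (A.reebVertices m) v₁ v₂ v₂) := by
  have hε := h.disc.pos
  have hεR := h.lt_length
  obtain ⟨xl, xr, hxl, hxr, hTl, hTr, hEl, hEr, huniq, hside⟩ := exists_crossings
    h.strip.continuous_upper h.upper_zero hε hεR h.mono
  have hxlR : |xl| < R := abs_lt.2 ⟨by linarith, by linarith⟩
  have hxrR : |xr| < R := abs_lt.2 ⟨by linarith, by linarith⟩
  have hεabs : |ε| < R := by rwa [abs_of_pos hε]
  have h0R : |(0 : ℝ)| < R := by rw [abs_zero]; linarith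
  obtain ⟨ψ, a, hatt, himg⟩ := exists_arcAttachment_removeDisc h.strip hε hεR h.lt_hi h.lower_lt
    h.upper_zero h.mono h.sing hxl hxr hTl hEl hEr hside
  obtain ⟨H, hH, hHmk⟩ := hA.exists_homeomorph_momentReeb hm h.sq p
  obtain ⟨H', hH'⟩ : ∃ H' : (A.addCircle p ε).momentReeb m' ≃ₜ
      ReebSpace (abscissa (removeDisc (A.chartRegion σ p) ε)),
      H' '' (A.addCircle p ε).reebVertices m' = reebMk _ '' (Subtype.val ⁻¹'
        (A.chartSing σ p ∪ {(xl, T xl), (xr, T xr), (ε, 0)})) := by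
    rw [← h.chartRegion_eq hA, ← h.chartSing_eq hA hxlR hxrR hEl hEr huniq]
    obtain ⟨H', hH', -⟩ := (h.disc.isAdmissible hA).exists_homeomorph_momentReeb hm' h.sq p
    exact ⟨H', hH'⟩
  have he' : H '' e ∈ graphEdges (reebMk (abscissa (A.chartRegion σ p)) ''
      (Subtype.val ⁻¹' A.chartSing σ p)) := by
    rw [← hH, graphEdges_image]
    exact mem_image_of_mem _ he
  have hsing : ∀ x ∈ A.chartSing σ p, |x.1 - 0| < R → ¬ (lo ≤ x.2 ∧ x.2 ≤ hi) := by
    simpa using h.sing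
  have h0 : h.strip.sliceClass 0 ∈ H '' e := by
    rw [h.strip.sliceClass_eq_upper (abs_sub_zero_lt h0R), ← hHmk z _ (by
      rw [hz]; simp [planeCoord, h.upper_zero])]
    exact mem_image_of_mem _ hze
  have hmem : ∀ u, |u| < R → H.symm (h.strip.sliceClass u) ∈ e := by
    intro u hu
    obtain ⟨w, hw, hwu⟩ := h.strip.sliceClass_mem_edge hsing he' (abs_sub_zero_lt h0R)
      (abs_sub_zero_lt hu) h0
    rw [← hwu, H.symm_apply_apply]
    exact hw
  refine ⟨_, hmem xl hxlR, _, hmem ε hεabs, fun heq => ?_, ?_⟩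
  · have h1 := congrArg (reebLevel _) (H.symm.injective heq)
    rw [h.strip.reebLevel_sliceClass (abs_sub_zero_lt hxlR),
      h.strip.reebLevel_sliceClass (abs_sub_zero_lt hεabs)] at h1
    linarith
  · have : CompactSpace (A.momentManifold m) :=
      isCompact_iff_compactSpace.1 hA.isCompact_momentManifold
    have := compactSpace_reebSpace (fun z : A.momentManifold m => height m (z : Ambient m))
    have := ((h.disc.isAdmissible hA).isFiniteGraph_reebVertices hm').t2
    refine (hatt.comp_homeomorph H H').graphIsomorphic ?_
    rw [← hH, ← hH'] at himg
    have h1 := congrArg (fun s => H'.symm '' s) himg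
    simp only [image_union, image_pair, image_singleton, ← image_comp, Homeomorph.symm_comp_self,
      image_id] at h1
    rw [h1]
    simp only [image_union, image_pair, Function.comp_apply, Homeomorph.apply_symm_apply]

end IsBoundaryChart

end CircleData

end

/-! ### The theorem -/

theorem theorem3 {l₁ l₂ : ℕ} (A : CircleData l₁ l₂) (hA : A.IsAdmissible)
    (hfrontier : closure A.D \ A.D ⊆ ⋃ j, A.circle j)
    (htouch : ∀ j, ((closure A.D \ A.D) ∩ A.circle j).Nonempty)
    (hpoles : ∀ j k, j ≠ k →
      Disjoint (A.circle j) (A.verticalPoles k ∪ A.horizontalPoles k))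
    (m : Fin l₂ → ℕ) (hm : ∀ i, 0 < m i) :
    A.IsLocusOverSmallNhds m ∧ IsFiniteGraph (A.reebVertices m) ∧
    ∀ e ∈ graphEdges (A.reebVertices m),
    ∀ m' : Fin (l₂ + 1) → ℕ, (∀ i, 0 < m' i) → (∀ i : Fin l₂, m' i.castSucc = m i) →
    ∃ B : CircleData (l₁ + 1) (l₂ + 1),
      -- the new data: one further circle, which forms a class of its own
      B.IsAdmissible ∧
      (∀ j : Fin l₁, B.center j.castSucc = A.center j ∧ B.radius j.castSucc = A.radius j ∧
        B.inside j.castSucc = A.inside j ∧ B.cls j.castSucc = (A.cls j).castSucc) ∧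
      B.cls (Fin.last l₁) = Fin.last l₂ ∧
      B.D ⊂ A.D ∧
      (∀ j : Fin l₁, ((closure B.D \ B.D) ∩ B.circle j.castSucc).Nonempty) ∧
      (∃ j : Fin l₁, (B.circle (Fin.last l₁) ∩ A.circle j).ncard = 2 ∧
        ∀ k : Fin l₁, (B.circle (Fin.last l₁) ∩ A.circle k).Nonempty → k = j) ∧
      -- the manifold: closed, connected, real algebraic, non-singular, of the stated dimension
      B.IsLocusOverSmallNhds m' ∧
      IsNonsingularLocus (B.momentSystem m') (B.momentManifold m') ∧
      IsCompact (B.momentManifold m') ∧ IsConnected (B.momentManifold m') ∧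
      (∀ p ∈ B.momentManifold m',
        Module.finrank ℝ (locusTangent (B.momentSystem m') p) = (∑ i, m' i) + 2) ∧
      -- it is a full zero set as soon as the neighbourhood can be the whole plane
      (A.momentManifold m = A.zerosOver m Set.univ →
        B.momentManifold m' = B.zerosOver m' Set.univ) ∧
      -- the function is Morse-Bott
      IsMorseBottOn (B.momentSystem m') (B.momentManifold m') (CircleData.height m') ∧
      -- the Reeb graph
      IsFiniteGraph (B.reebVertices m') ∧
      (∃ v₁ ∈ e, ∃ v₂ ∈ e, v₁ ≠ v₂ ∧ ∃ v, (v = v₁ ∨ v = v₂) ∧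
        GraphIsomorphic (B.reebVertices m') (attachVertices (A.reebVertices m) v₁ v₂ v)) ∧
      (B.reebVertices m').ncard = (A.reebVertices m).ncard + 3 ∧
      (graphEdges (B.reebVertices m')).ncard = (graphEdges (A.reebVertices m)).ncard + 3 := by
  -- A point of `S_j` at the height of its centre is a vertical pole of `S_j`, and by hypothesis no
  -- other circle contains it.
  have hpole : ∀ x ∈ closure A.D, ∀ j k, j ≠ k → A.f j x = 0 → A.f k x = 0 →
      x 1 ≠ A.center j 1 := by
    intro x _ j k hjk hj hk h1
    refine Set.disjoint_left.1 (hpoles k j hjk.symm)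
      ((CircleData.mem_circle_iff A (hA.radius_pos k) x).2 hk) (Or.inl ?_)
    have h2 := (A.f_eq_zero_iff j x).1 hj
    rw [h1, sub_self, zero_pow two_ne_zero, add_zero] at h2
    rcases sq_eq_sq_iff_eq_or_eq_neg.1 h2 with h3 | h3
    · left
      ext i; fin_cases i
      · change x 0 = A.center j 0 + A.radius j
        linarith
      · exact h1
    · right
      ext i; fin_cases i
      · change x 0 = A.center j 0 - A.radius j
        linarith
      · exact h1
  refine ⟨hA.isLocusOverSmallNhds, hA.isFiniteGraph_reebVertices hm, ?_⟩
  intro e he m' hm' _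
  obtain ⟨j, p, σ, R, lo, hi, b, T, ρ, ε, h, z, hz, hze⟩ := hA.exists_isBoundaryChart hm he
  have hd := h.disc
  have hB := hd.isAdmissible hA
  have hcomp := hB.isCompact_momentManifold (m := m')
  have hεR := h.lt_length
  obtain ⟨xl, xr, hxl, hxr, hTl, hTr, hEl, hEr, huniq, -⟩ := exists_crossings
    h.strip.continuous_upper h.upper_zero hd.pos hεR h.mono
  have hxlR : |xl| < R := abs_lt.2 ⟨by linarith, by linarith⟩
  have hxrR : |xr| < R := abs_lt.2 ⟨by linarith, by linarith⟩
  obtain ⟨v₁, hv₁, v₂, hv₂, hne, hiso⟩ := h.exists_graphIsomorphic hA hm hm' he hz hze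
  have hgraph := hA.isFiniteGraph_reebVertices hm
  have hnot : ∀ v ∈ e, v ∉ A.reebVertices m := by
    obtain ⟨w, -, rfl⟩ := he
    exact fun v hv => connectedComponentIn_subset _ _ hv
  refine ⟨A.addCircle p ε, hB, fun j => ⟨by simp, by simp, by simp, by simp⟩, by simp,
    hd.ssubset, fun k => ?_, ⟨j, ?_, fun k => ?_⟩, hB.isLocusOverSmallNhds,
    hB.isNonsingularLocus hcomp.isClosed, hcomp, hB.isConnected_momentManifold hm',
    fun q hq => hB.finrank_locusTangent hq, fun hun => ?_,
    hB.isMorseBottOn (hd.snd_ne_center hA hpole), hB.isFiniteGraph_reebVertices hm',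
    ⟨v₁, hv₁, v₂, hv₂, hne, v₂, Or.inr rfl, hiso⟩, ?_, ?_⟩
  -- For the circle through `p` the left new corner is a frontier point. Any other circle misses the
  -- disc of radius `ρ`, so its old frontier point survives.
  · by_cases hkj : k = j
    · subst hkj
      exact ⟨_, hd.mem_frontier_of_f_eq_zero hA (h.corner_mem hA hxlR hEl) (h.f_upper _ hxlR)⟩
    · obtain ⟨x, ⟨hx, -⟩, hxk⟩ := htouch k
      rw [CircleData.mem_circle_iff _ (hA.radius_pos k)] at hxk
      refine ⟨x, hd.mem_frontier_of_f_eq_zero hA ?_ hxk⟩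
      rw [hd.closure_eq hA]
      refine ⟨hx, not_lt.1 fun hlt => ?_⟩
      exact ((hd.mem_iff x (hlt.trans hd.sq_lt)).2 k hkj).ne' hxk
  · rw [h.circle_inter_eq hA hxlR hxrR hEl hEr huniq]
    refine Set.ncard_pair fun heq => ?_
    have := congrArg Prod.fst (CircleData.injective_planeChart h.sq p heq)
    simp only at this
    linarith
  · rintro ⟨x, hx, hxk⟩
    rw [CircleData.mem_circle_iff _ (hd.radius_pos hA _), CircleData.addCircle_f_last,
      sub_eq_zero] at hx
    rw [CircleData.mem_circle_iff _ (hA.radius_pos k)] at hxk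
    exact hd.eq_of_f_eq_zero hx hxk
  · rw [CircleData.momentManifold_eq_zerosOver_univ_iff] at hun ⊢
    exact hd.classProd_nonneg_imp hA hun
  · rw [hiso.ncard_eq.2, ncard_attachVertices _ hgraph.finite_vertices (hnot _ hv₁) (hnot _ hv₂) hne]
  · rw [hiso.ncard_eq.1, ncard_graphEdges_attachVertices _ hgraph he hv₁ hv₂ hne (Or.inr rfl)]
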